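/- Let $R=\mathbf Z_{(2)}$ be the localisation of $\mathbf Z$ at the prime ideal $(2)$. Let $A_R$ be the $R$-algebra of block matrices \[ \left[\begin{array}{cccc} s & 0 & 0 & t\\ 0 & u & 0 & v\\ 0 & 0 & w & 0\\ x & y & 0 & z_1+z_2\bar\eta+z_3\bar\xi\end{array}\right],\qquad s\in R^{3\times 3},\ t\in R^{3\times 1},\ x\in R^{1\times 3},\ u,v,w,y,z_1,z_2,z_3\in R, \] where $R[\bar\eta,\bar\xi]=R[\eta,\xi]/(\eta^2,\eta\xi,\xi^2)$. Addition is entrywise. Multiplication is block matrix multiplication, where an element $z_1+z_2\bar\eta+z_3\bar\xi$ of the lower right corner acts on the entries $t,v,x,y$ as multiplication by $z_1$, and where the products of a last-column entry with a last-row entry, and of a last-row entry with a last-column entry, are given by $t\cdot x=0$, $v\cdot y=0$, $x\cdot t=(xt)\,\bar\eta$ and $y\cdot v=yv\,(\bar\xi-12\bar\eta)$. Let $\Lambda_{(2)}\subseteq A_R$ be the $R$-subalgebra of the elements satisfying \[ 2w-2z_1\equiv_8 z_2\equiv_4 z_3\equiv_4 0,\quad x_1\equiv_4 x_2\equiv_4x_3\equiv_4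 0,\quad y\equiv_2 0,\quad t_1\equiv_2t_2\equiv_2t_3\equiv_2 0,\quad v\equiv_2 0, \] where $a\equiv_n b$ means $a-b\in nR$. Let $\varepsilon\in\Lambda_{(2)}$ be the idempotent with $s=\mathrm{diag}(0,0,1)$, $u=w=z_1=1$ and all other entries $0$, and let $\Lambda'_{(2)}=\varepsilon\Lambda_{(2)}\varepsilon$. For a finite group $G$ and a commutative ring $k$, let $\mathrm B_k(G,G)$ be the double Burnside $k$-algebra: the $k$-module freely generated by the isomorphism classes of finite $(G,G)$-bisets modulo the relations $[M\sqcup N]=[M]+[N]$, with multiplication $[M]\cdot[N]=[M\times_G N]$. Let $\Psi$ be the quiver with three vertices $3,4,5$ and the arrows \[ \tilde\tau_1:5\to 3,\quad \tilde\tau_2:3\to 5,\quad \tilde\tau_3:5\to 4,\quad \tilde\tau_4:4\to 5,\quad \tilde\tau_7:5\to 5 . \] Products of paths are written in the order in which the paths are followed, so $\tilde\tau_1\tilde\tau_2$ is the path $5\to3\to5$. Let \[ Q=\mathbf F_2\Psi/\bigl(\tilde\tau_2\tilde\tau_1,\ \tilde\tau_2\tilde\tau_3,\ \tilde\tau_2\tilde\tau_7,\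 \tilde\tau_4\tilde\tau_1,\ \tilde\tau_4\tilde\tau_3,\ \tilde\tau_4\tilde\tau_7,\ \tilde\tau_7\tilde\tau_1,\ \tilde\tau_7\tilde\tau_3,\ \tilde\tau_7^2-\tilde\tau_1\tilde\tau_2\bigr) \] be the quotient of the path algebra by the two-sided ideal generated by these elements. Then $\Lambda'_{(2)}/2\Lambda'_{(2)}\cong Q$ as $\mathbf F_2$-algebras, and $\mathrm B_{\mathbf F_2}(\mathrm S_3,\mathrm S_3)$ is Morita equivalent, over $\mathbf F_2$, to $\Lambda'_{(2)}/2\Lambda'_{(2)}$ and hence to $Q$. -/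

import Mathlib

noncomputable section

namespace BurnsideS3

open scoped Matrix

/-! ### Bisets and the double Burnside algebra -/

/-- A finite `(G, G)`-biset: a finite set with a left action and a right action of `G`
that commute with each other. The right action `x · g` is `MulOpposite.op g • x`. -/
structure FinBiset (G : Type) [Group G] where
  carrier : Type
  [finite : Finite carrier]
  [left : MulAction G carrier]
  [right : MulAction Gᵐᵒᵖ carrier]
  [comm : SMulCommClass G Gᵐᵒᵖ carrier]

namespace FinBiset

attribute [instance] FinBiset.finite FinBiset.left FinBiset.right FinBiset.comm

variable {G : Type} [Group G]

/-- An isomorphism of bisets: a bijection compatible with both actions. -/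
structure Iso (M N : FinBiset G) where
  toEquiv : M.carrier ≃ N.carrier
  map_left : ∀ (g : G) (x : M.carrier), toEquiv (g • x) = g • toEquiv x
  map_right : ∀ (g : G) (x : M.carrier),
    toEquiv (MulOpposite.op g • x) = MulOpposite.op g • toEquiv x

/-- Isomorphism of bisets as an equivalence relation. -/
instance isoSetoid (G : Type) [Group G] : Setoid (FinBiset G) where
  r M N := Nonempty (Iso M N)
  iseqv :=
    { refl := fun M => ⟨⟨Equiv.refl _, fun _ _ => rfl, fun _ _ => rfl⟩⟩
      symm := by
        rintro M N ⟨e⟩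
        refine ⟨⟨e.toEquiv.symm, fun g x => ?_, fun g x => ?_⟩⟩
        · rw [Equiv.symm_apply_eq, e.map_left, Equiv.apply_symm_apply]
        · rw [Equiv.symm_apply_eq, e.map_right, Equiv.apply_symm_apply]
      trans := by
        rintro M N L ⟨e⟩ ⟨f⟩
        refine ⟨⟨e.toEquiv.trans f.toEquiv, fun g x => ?_, fun g x => ?_⟩⟩
        · simp [e.map_left, f.map_left]
        · simp [e.map_right, f.map_right] }

/-- The group `G` itself as a biset, through multiplication on both sides. -/
def regular (G : Type) [Group G] [Finite G] : FinBiset G where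
  carrier := G

/-- The disjoint union of two bisets. -/
def disjointUnion (M N : FinBiset G) : FinBiset G where
  carrier := M.carrier ⊕ N.carrier

/-- The orbit relation of the action `g (m, n) = (m g⁻¹, g n)` of `G` on `M × N`. -/
def tensorSetoid (M N : FinBiset G) : Setoid (M.carrier × N.carrier) where
  r p q := ∃ g : G, q = (MulOpposite.op g⁻¹ • p.1, g • p.2)
  iseqv :=
    { refl := fun p => ⟨1, by simp⟩
      symm := by
        rintro p q ⟨g, rfl⟩
        exact ⟨g⁻¹, by simp [smul_smul]⟩
      trans := by
        rintro p q r ⟨g, rfl⟩ ⟨h, rfl⟩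
        exact ⟨h * g, by simp [smul_smul]⟩ }

/-- `h (m ×_G n) = (h m) ×_G n`. -/
instance tensorLeft (M N : FinBiset G) : MulAction G (Quotient (tensorSetoid M N)) where
  smul h := Quotient.map (fun p => (h • p.1, p.2)) (by
    rintro p q ⟨g, rfl⟩
    exact ⟨g, by simp [smul_comm]⟩)
  one_smul := by
    rintro ⟨p⟩
    exact congrArg (Quotient.mk (tensorSetoid M N)) (by simp)
  mul_smul := by
    rintro a b ⟨p⟩
    exact congrArg (Quotient.mk (tensorSetoid M N)) (by simp [mul_smul])

/-- `(m ×_G n) h = m ×_G (n h)`. -/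
instance tensorRight (M N : FinBiset G) : MulAction Gᵐᵒᵖ (Quotient (tensorSetoid M N)) where
  smul h := Quotient.map (fun p => (p.1, h • p.2)) (by
    rintro p q ⟨g, rfl⟩
    exact ⟨g, by simp [smul_comm]⟩)
  one_smul := by
    rintro ⟨p⟩
    exact congrArg (Quotient.mk (tensorSetoid M N)) (by simp)
  mul_smul := by
    rintro a b ⟨p⟩
    exact congrArg (Quotient.mk (tensorSetoid M N)) (by simp [mul_smul])

/-- The tensor product `M ×_G N`: the biset of `G`-orbits on `M × N`. -/
def tensor (M N : FinBiset G) : FinBiset G where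
  carrier := Quotient (tensorSetoid M N)
  comm := ⟨by
    rintro a b ⟨p⟩
    rfl⟩

/-- The orbit `m ×_G n` of `(m, n)`. -/
def tmul {M N : FinBiset G} (m : M.carrier) (n : N.carrier) : (tensor M N).carrier :=
  Quotient.mk (tensorSetoid M N) (m, n)

lemma smul_tmul {M N : FinBiset G} (h : G) (m : M.carrier) (n : N.carrier) :
    h • (tmul m n : (tensor M N).carrier) = tmul (h • m) n := rfl

lemma op_smul_tmul {M N : FinBiset G} (h : Gᵐᵒᵖ) (m : M.carrier) (n : N.carrier) :
    h • (tmul m n : (tensor M N).carrier) = tmul m (h • n) := rfl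

lemma tmul_balanced {M N : FinBiset G} (g : G) (m : M.carrier) (n : N.carrier) :
    (tmul (MulOpposite.op g • m) n : (tensor M N).carrier) = tmul m (g • n) :=
  Quotient.sound ⟨g, by simp [smul_smul]⟩

lemma exists_tmul {M N : FinBiset G} (x : (tensor M N).carrier) : ∃ m n, x = tmul m n := by
  obtain ⟨⟨m, n⟩⟩ := x
  exact ⟨m, n, rfl⟩

/-- Balanced maps out of `M × N` factor through the tensor product. -/
def tensorLift {M N : FinBiset G} {α : Type*} (f : M.carrier → N.carrier → α)
    (hf : ∀ (g : G) m n, f (MulOpposite.op g • m) n = f m (g • n)) :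
    (tensor M N).carrier → α :=
  Quotient.lift (fun p => f p.1 p.2) (by
    rintro p q ⟨g, rfl⟩
    show f p.1 p.2 = f (MulOpposite.op g⁻¹ • p.1) (g • p.2)
    rw [hf, inv_smul_smul])

lemma tensorLift_tmul {M N : FinBiset G} {α : Type*} (f : M.carrier → N.carrier → α)
    (hf : ∀ (g : G) m n, f (MulOpposite.op g • m) n = f m (g • n)) (m n) :
    tensorLift f hf (tmul m n) = f m n := rfl

/-- Isomorphic factors have isomorphic tensor products. -/
def tensorCongr {M M' N N' : FinBiset G} (e : Iso M M') (f : Iso N N') :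
    Iso (tensor M N) (tensor M' N') where
  toEquiv :=
    { toFun := tensorLift (fun m n => tmul (e.toEquiv m) (f.toEquiv n)) (fun g m n => by
        rw [e.map_right, f.map_left, tmul_balanced])
      invFun := tensorLift (fun m n => tmul (e.toEquiv.symm m) (f.toEquiv.symm n))
        (fun g m n => by
          have h1 : e.toEquiv.symm (MulOpposite.op g • m)
              = MulOpposite.op g • e.toEquiv.symm m := by
            rw [Equiv.symm_apply_eq, e.map_right, Equiv.apply_symm_apply]
          have h2 : f.toEquiv.symm (g • n) = g • f.toEquiv.symm n := by
            rw [Equiv.symm_apply_eq, f.map_left, Equiv.apply_symm_apply]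
          rw [h1, h2, tmul_balanced])
      left_inv := fun x => by
        obtain ⟨m, n, rfl⟩ := exists_tmul x
        simp [tensorLift_tmul]
      right_inv := fun x => by
        obtain ⟨m, n, rfl⟩ := exists_tmul x
        simp [tensorLift_tmul] }
  map_left := fun g x => by
    obtain ⟨m, n, rfl⟩ := exists_tmul x
    simp [smul_tmul, tensorLift_tmul, e.map_left]
  map_right := fun g x => by
    obtain ⟨m, n, rfl⟩ := exists_tmul x
    simp [op_smul_tmul, tensorLift_tmul, f.map_right]

/-- `(M ×_G N) ×_G L ≅ M ×_G (N ×_G L)`. -/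
def tensorAssoc (M N L : FinBiset G) :
    Iso (tensor (tensor M N) L) (tensor M (tensor N L)) where
  toEquiv :=
    { toFun := tensorLift
        (fun x l => tensorLift (fun m n => tmul m (tmul n l)) (fun g m n => by
          rw [tmul_balanced, smul_tmul]) x)
        (fun g x l => by
          obtain ⟨m, n, rfl⟩ := exists_tmul x
          rw [op_smul_tmul, tensorLift_tmul, tensorLift_tmul, tmul_balanced])
      invFun := tensorLift
        (fun m y => tensorLift (fun n l => tmul (tmul m n) l) (fun g n l => by
          rw [← tmul_balanced, op_smul_tmul]) y)
        (fun g m y => by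
          obtain ⟨n, l, rfl⟩ := exists_tmul y
          rw [smul_tmul, tensorLift_tmul, tensorLift_tmul, tmul_balanced])
      left_inv := fun x => by
        obtain ⟨y, l, rfl⟩ := exists_tmul x
        obtain ⟨m, n, rfl⟩ := exists_tmul y
        rfl
      right_inv := fun x => by
        obtain ⟨m, y, rfl⟩ := exists_tmul x
        obtain ⟨n, l, rfl⟩ := exists_tmul y
        rfl }
  map_left := fun g x => by
    obtain ⟨y, l, rfl⟩ := exists_tmul x
    obtain ⟨m, n, rfl⟩ := exists_tmul y
    rfl
  map_right := fun g x => by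
    obtain ⟨y, l, rfl⟩ := exists_tmul x
    obtain ⟨m, n, rfl⟩ := exists_tmul y
    rfl

/-- `G ×_G M ≅ M`. -/
def regularTensor [Finite G] (M : FinBiset G) : Iso (tensor (regular G) M) M where
  toEquiv :=
    { toFun := tensorLift (M := regular G) (fun (g : G) m => g • m)
        (fun g (h : G) m => mul_smul h g m)
      invFun := fun m => tmul (M := regular G) (1 : G) m
      left_inv := fun x => by
        obtain ⟨g, m, rfl⟩ := exists_tmul x
        refine (tmul_balanced (M := regular G) (g : G) (1 : G) m).symm.trans ?_
        exact congrArg (fun k : G => tmul (M := regular G) k m) (one_mul (show G from g))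
      right_inv := fun m => one_smul G m }
  map_left := fun g x => by
    obtain ⟨h, m, rfl⟩ := exists_tmul x
    exact mul_smul g (h : G) m
  map_right := fun g x => by
    obtain ⟨h, m, rfl⟩ := exists_tmul x
    exact smul_comm (show G from h) (MulOpposite.op g) m

/-- `M ×_G G ≅ M`. -/
def tensorRegular [Finite G] (M : FinBiset G) : Iso (tensor M (regular G)) M where
  toEquiv :=
    { toFun := tensorLift (N := regular G) (fun m (g : G) => MulOpposite.op g • m)
        (fun g m (h : G) => (mul_smul (MulOpposite.op h) (MulOpposite.op g) m).symm)
      invFun := fun m => tmul (N := regular G) m (1 : G)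
      left_inv := fun x => by
        obtain ⟨m, g, rfl⟩ := exists_tmul x
        refine (tmul_balanced (N := regular G) (g : G) m (1 : G)).trans ?_
        exact congrArg (fun k : G => tmul (N := regular G) m k) (mul_one (show G from g))
      right_inv := fun m => one_smul Gᵐᵒᵖ m }
  map_left := fun g x => by
    obtain ⟨m, h, rfl⟩ := exists_tmul x
    exact (smul_comm g (MulOpposite.op (show G from h)) m).symm
  map_right := fun g x => by
    obtain ⟨m, h, rfl⟩ := exists_tmul x
    exact mul_smul (MulOpposite.op g) (MulOpposite.op (show G from h)) m

end FinBiset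

/-- The isomorphism classes of finite `(G, G)`-bisets. -/
def BisetClass (G : Type) [Group G] : Type 1 := Quotient (FinBiset.isoSetoid G)

/-- The isomorphism class of a biset. -/
def BisetClass.mk {G : Type} [Group G] (M : FinBiset G) : BisetClass G :=
  Quotient.mk (FinBiset.isoSetoid G) M

/-- Isomorphism classes of bisets form a monoid under the tensor product over `G`,
with unit the class of `G`. -/
instance (G : Type) [Group G] [Finite G] : Monoid (BisetClass G) where
  mul := Quotient.map₂ FinBiset.tensor (by
    rintro M M' ⟨e⟩ N N' ⟨f⟩
    exact ⟨FinBiset.tensorCongr e f⟩)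
  one := BisetClass.mk (FinBiset.regular G)
  mul_assoc := by
    rintro ⟨M⟩ ⟨N⟩ ⟨L⟩
    exact Quotient.sound ⟨FinBiset.tensorAssoc M N L⟩
  one_mul := by
    rintro ⟨M⟩
    exact Quotient.sound ⟨FinBiset.regularTensor M⟩
  mul_one := by
    rintro ⟨M⟩
    exact Quotient.sound ⟨FinBiset.tensorRegular M⟩

/-- The relation `[M ⊔ N] = [M] + [N]` on the free `R`-module on the isomorphism classes. -/
inductive BurnsideRel (R G : Type) [CommRing R] [Group G] [Finite G] :
    MonoidAlgebra R (BisetClass G) → MonoidAlgebra R (BisetClass G) → Prop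
  | disjointUnion (M N : FinBiset G) : BurnsideRel R G
      (MonoidAlgebra.of R _ (BisetClass.mk (M.disjointUnion N)))
      (MonoidAlgebra.of R _ (BisetClass.mk M) + MonoidAlgebra.of R _ (BisetClass.mk N))

/-- The double Burnside `R`-algebra `B_R(G, G)`: the free `R`-module on the isomorphism classes
of finite `(G, G)`-bisets with multiplication `[M] [N] = [M ×_G N]`, modulo the relations
`[M ⊔ N] = [M] + [N]`. (The submodule spanned by these relations is already a two-sided ideal,
because `×_G` distributes over disjoint unions.) -/
abbrev DoubleBurnside (R G : Type) [CommRing R] [Group G] [Finite G] : Type 1 :=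
  RingQuot (BurnsideRel R G)

/-! ### The order `Λ₍₂₎` and its corner `Λ'₍₂₎` -/

/-- The elements
```
⎡ s  0  0  t                 ⎤
⎢ 0  u  0  v                 ⎥
⎢ 0  0  w  0                 ⎥
⎣ x  y  0  z₁ + z₂ η + z₃ ξ  ⎦
```
with `s` a `3 × 3` matrix, `t` a column and `x` a row of length `3`, and
`z₁ + z₂ η + z₃ ξ` in `R[η, ξ] / (η², η ξ, ξ²)`. -/
@[ext]
structure BlockMat (R : Type) where
  s : Matrix (Fin 3) (Fin 3) R
  t : Fin 3 → R
  u : R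
  v : R
  w : R
  x : Fin 3 → R
  y : R
  z₁ : R
  z₂ : R
  z₃ : R

namespace BlockMat

variable {R : Type} [CommRing R]

instance : Zero (BlockMat R) := ⟨⟨0, 0, 0, 0, 0, 0, 0, 0, 0, 0⟩⟩
instance : One (BlockMat R) := ⟨⟨1, 0, 1, 0, 1, 0, 0, 1, 0, 0⟩⟩
instance : Add (BlockMat R) := ⟨fun a b => ⟨a.s + b.s, a.t + b.t, a.u + b.u, a.v + b.v,
  a.w + b.w, a.x + b.x, a.y + b.y, a.z₁ + b.z₁, a.z₂ + b.z₂, a.z₃ + b.z₃⟩⟩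
instance : Neg (BlockMat R) := ⟨fun a => ⟨-a.s, -a.t, -a.u, -a.v, -a.w, -a.x, -a.y,
  -a.z₁, -a.z₂, -a.z₃⟩⟩
instance : SMul R (BlockMat R) := ⟨fun r a => ⟨r • a.s, r • a.t, r * a.u, r * a.v, r * a.w,
  r • a.x, r * a.y, r * a.z₁, r * a.z₂, r * a.z₃⟩⟩

/-- Block matrix multiplication. Between the last column and the last row the products are
`t x = 0`, `v y = 0`, `x t = (∑ xᵢ tᵢ) η` and `y v = y v (ξ - 12 η)`; the corner entry
`z₁ + z₂ η + z₃ ξ` acts on `t`, `v`, `x`, `y` through `z₁`. -/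
instance : Mul (BlockMat R) := ⟨fun a b =>
  { s := a.s * b.s
    t := a.s *ᵥ b.t + b.z₁ • a.t
    u := a.u * b.u
    v := a.u * b.v + a.v * b.z₁
    w := a.w * b.w
    x := a.x ᵥ* b.s + a.z₁ • b.x
    y := a.y * b.u + a.z₁ * b.y
    z₁ := a.z₁ * b.z₁
    z₂ := a.z₁ * b.z₂ + a.z₂ * b.z₁ + a.x ⬝ᵥ b.t - 12 * (a.y * b.v)
    z₃ := a.z₁ * b.z₃ + a.z₃ * b.z₁ + a.y * b.v }⟩

section simps
variable (a b : BlockMat R) (r : R)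

@[simp] lemma zero_s : (0 : BlockMat R).s = 0 := rfl
@[simp] lemma zero_t : (0 : BlockMat R).t = 0 := rfl
@[simp] lemma zero_u : (0 : BlockMat R).u = 0 := rfl
@[simp] lemma zero_v : (0 : BlockMat R).v = 0 := rfl
@[simp] lemma zero_w : (0 : BlockMat R).w = 0 := rfl
@[simp] lemma zero_x : (0 : BlockMat R).x = 0 := rfl
@[simp] lemma zero_y : (0 : BlockMat R).y = 0 := rfl
@[simp] lemma zero_z₁ : (0 : BlockMat R).z₁ = 0 := rfl
@[simp] lemma zero_z₂ : (0 : BlockMat R).z₂ = 0 := rfl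
@[simp] lemma zero_z₃ : (0 : BlockMat R).z₃ = 0 := rfl
@[simp] lemma one_s : (1 : BlockMat R).s = 1 := rfl
@[simp] lemma one_t : (1 : BlockMat R).t = 0 := rfl
@[simp] lemma one_u : (1 : BlockMat R).u = 1 := rfl
@[simp] lemma one_v : (1 : BlockMat R).v = 0 := rfl
@[simp] lemma one_w : (1 : BlockMat R).w = 1 := rfl
@[simp] lemma one_x : (1 : BlockMat R).x = 0 := rfl
@[simp] lemma one_y : (1 : BlockMat R).y = 0 := rfl
@[simp] lemma one_z₁ : (1 : BlockMat R).z₁ = 1 := rfl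
@[simp] lemma one_z₂ : (1 : BlockMat R).z₂ = 0 := rfl
@[simp] lemma one_z₃ : (1 : BlockMat R).z₃ = 0 := rfl
@[simp] lemma add_s : (a + b).s = a.s + b.s := rfl
@[simp] lemma add_t : (a + b).t = a.t + b.t := rfl
@[simp] lemma add_u : (a + b).u = a.u + b.u := rfl
@[simp] lemma add_v : (a + b).v = a.v + b.v := rfl
@[simp] lemma add_w : (a + b).w = a.w + b.w := rfl
@[simp] lemma add_x : (a + b).x = a.x + b.x := rfl
@[simp] lemma add_y : (a + b).y = a.y + b.y := rfl
@[simp] lemma add_z₁ : (a + b).z₁ = a.z₁ + b.z₁ := rfl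
@[simp] lemma add_z₂ : (a + b).z₂ = a.z₂ + b.z₂ := rfl
@[simp] lemma add_z₃ : (a + b).z₃ = a.z₃ + b.z₃ := rfl
@[simp] lemma neg_s : (-a).s = -a.s := rfl
@[simp] lemma neg_t : (-a).t = -a.t := rfl
@[simp] lemma neg_u : (-a).u = -a.u := rfl
@[simp] lemma neg_v : (-a).v = -a.v := rfl
@[simp] lemma neg_w : (-a).w = -a.w := rfl
@[simp] lemma neg_x : (-a).x = -a.x := rfl
@[simp] lemma neg_y : (-a).y = -a.y := rfl
@[simp] lemma neg_z₁ : (-a).z₁ = -a.z₁ := rfl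
@[simp] lemma neg_z₂ : (-a).z₂ = -a.z₂ := rfl
@[simp] lemma neg_z₃ : (-a).z₃ = -a.z₃ := rfl
@[simp] lemma smul_s : (r • a).s = r • a.s := rfl
@[simp] lemma smul_t : (r • a).t = r • a.t := rfl
@[simp] lemma smul_u : (r • a).u = r * a.u := rfl
@[simp] lemma smul_v : (r • a).v = r * a.v := rfl
@[simp] lemma smul_w : (r • a).w = r * a.w := rfl
@[simp] lemma smul_x : (r • a).x = r • a.x := rfl
@[simp] lemma smul_y : (r • a).y = r * a.y := rfl
@[simp] lemma smul_z₁ : (r • a).z₁ = r * a.z₁ := rfl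
@[simp] lemma smul_z₂ : (r • a).z₂ = r * a.z₂ := rfl
@[simp] lemma smul_z₃ : (r • a).z₃ = r * a.z₃ := rfl
@[simp] lemma mul_s : (a * b).s = a.s * b.s := rfl
@[simp] lemma mul_t : (a * b).t = a.s *ᵥ b.t + b.z₁ • a.t := rfl
@[simp] lemma mul_u : (a * b).u = a.u * b.u := rfl
@[simp] lemma mul_v : (a * b).v = a.u * b.v + a.v * b.z₁ := rfl
@[simp] lemma mul_w : (a * b).w = a.w * b.w := rfl
@[simp] lemma mul_x : (a * b).x = a.x ᵥ* b.s + a.z₁ • b.x := rfl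
@[simp] lemma mul_y : (a * b).y = a.y * b.u + a.z₁ * b.y := rfl
@[simp] lemma mul_z₁ : (a * b).z₁ = a.z₁ * b.z₁ := rfl
@[simp] lemma mul_z₂ : (a * b).z₂ =
    a.z₁ * b.z₂ + a.z₂ * b.z₁ + a.x ⬝ᵥ b.t - 12 * (a.y * b.v) := rfl
@[simp] lemma mul_z₃ : (a * b).z₃ = a.z₁ * b.z₃ + a.z₃ * b.z₁ + a.y * b.v := rfl

end simps

instance : AddCommGroup (BlockMat R) where
  add_assoc a b c := by ext <;> simp [add_assoc]
  zero_add a := by ext <;> simp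
  add_zero a := by ext <;> simp
  add_comm a b := by ext <;> simp [add_comm]
  neg_add_cancel a := by ext <;> simp
  nsmul := nsmulRec
  zsmul := zsmulRec

instance : Ring (BlockMat R) where
  __ := (inferInstance : AddCommGroup (BlockMat R))
  left_distrib a b c := by
    ext <;> simp [mul_add, Matrix.mulVec_add, Matrix.vecMul_add, add_smul] <;> ring
  right_distrib a b c := by
    ext <;> simp [add_mul, Matrix.add_mulVec, Matrix.add_vecMul, add_smul, mul_add] <;> ring
  zero_mul a := by ext <;> simp
  mul_zero a := by ext <;> simp
  mul_assoc a b c := by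
    ext <;> simp [mul_assoc, Matrix.mulVec_add, Matrix.add_vecMul, Matrix.mulVec_smul,
      Matrix.smul_vecMul, Matrix.dotProduct_mulVec] <;> ring
  one_mul a := by ext <;> simp
  mul_one a := by ext <;> simp

instance : Module R (BlockMat R) where
  one_smul a := by ext <;> simp
  mul_smul r r' a := by ext <;> simp [mul_assoc]
  smul_zero r := by ext <;> simp
  smul_add r a b := by ext <;> simp [mul_add]
  add_smul r r' a := by ext <;> simp [add_mul]
  zero_smul a := by ext <;> simp

instance : Algebra R (BlockMat R) := Algebra.ofModule
  (fun r a b => by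
    ext <;> simp [Matrix.smul_mulVec, Matrix.smul_vecMul] <;> ring)
  (fun r a b => by
    ext <;> simp [Matrix.mulVec_smul, Matrix.vecMul_smul] <;> ring)

end BlockMat

/-- The subalgebra of block matrices cut out by the congruences
`2 w - 2 z₁ ≡₈ z₂ ≡₄ z₃ ≡₄ 0`, `x ≡₄ 0`, `y ≡₂ 0`, `t ≡₂ 0`, `v ≡₂ 0`. -/
def orderLambda (R : Type) [CommRing R] : Subalgebra R (BlockMat R) where
  carrier := {a | (8 : R) ∣ 2 * a.w - 2 * a.z₁ - a.z₂ ∧ (4 : R) ∣ a.z₂ - a.z₃ ∧ (4 : R) ∣ a.z₃ ∧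
    (∀ i, (4 : R) ∣ a.x i) ∧ (2 : R) ∣ a.y ∧ (∀ i, (2 : R) ∣ a.t i) ∧ (2 : R) ∣ a.v}
  add_mem' := by
    rintro a b ⟨h1, h2, h3, h4, h5, h6, h7⟩ ⟨k1, k2, k3, k4, k5, k6, k7⟩
    refine ⟨?_, ?_, dvd_add h3 k3, fun i => dvd_add (h4 i) (k4 i), dvd_add h5 k5,
      fun i => dvd_add (h6 i) (k6 i), dvd_add h7 k7⟩
    · have := dvd_add h1 k1
      simp only [BlockMat.add_w, BlockMat.add_z₁, BlockMat.add_z₂]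
      convert this using 1
      ring
    · have := dvd_add h2 k2
      simp only [BlockMat.add_z₃, BlockMat.add_z₂]
      convert this using 1
      ring
  mul_mem' := by
    rintro a b ⟨⟨a1, h1⟩, ⟨a2, h2⟩, ⟨a3, h3⟩, h4, ⟨a5, h5⟩, h6, ⟨a7, h7⟩⟩
      ⟨⟨b1, k1⟩, ⟨b2, k2⟩, ⟨b3, k3⟩, k4, ⟨b5, k5⟩, k6, ⟨b7, k7⟩⟩
    choose a4 h4 using h4
    choose a6 h6 using h6
    choose b4 k4 using k4
    choose b6 k6 using k6
    have ha : a.z₂ = 4 * (a2 + a3) := by linear_combination h2 + h3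
    have hb : b.z₂ = 4 * (b2 + b3) := by linear_combination k2 + k3
    have hw : 2 * a.w = 2 * a.z₁ + 4 * (a2 + a3) + 8 * a1 := by linear_combination h1 + ha
    have kw : 2 * b.w = 2 * b.z₁ + 4 * (b2 + b3) + 8 * b1 := by linear_combination k1 + hb
    have hd : a.x ⬝ᵥ b.t = 8 * ∑ i, a4 i * b6 i := by
      simp only [dotProduct, Finset.mul_sum]
      refine Finset.sum_congr rfl fun i _ => ?_
      rw [h4, k6]
      ring
    refine ⟨?_, ?_, ?_, fun i => ?_, ?_, fun i => ?_, ?_⟩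
    · refine ⟨a1 * b.w + a.z₁ * b1 + (a2 + a3) * (b2 + b3 + 2 * b1) - (∑ i, a4 i * b6 i) +
        6 * (a5 * b7), ?_⟩
      simp only [BlockMat.mul_w, BlockMat.mul_z₁, BlockMat.mul_z₂, hd, ha, hb, h5, k7]
      linear_combination b.w * hw + (a.z₁ + 2 * (a2 + a3)) * kw
    · refine ⟨a.z₁ * b2 + a2 * b.z₁ + 2 * (∑ i, a4 i * b6 i) - 13 * (a5 * b7), ?_⟩
      simp only [BlockMat.mul_z₃, BlockMat.mul_z₂, hd, h5, k7]
      linear_combination a.z₁ * k2 + b.z₁ * h2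
    · refine ⟨a.z₁ * b3 + a3 * b.z₁ + a5 * b7, ?_⟩
      simp only [BlockMat.mul_z₃, h5, k7, h3, k3]
      ring
    · simp only [BlockMat.mul_x, Pi.add_apply, Matrix.vecMul, dotProduct, Pi.smul_apply,
        smul_eq_mul]
      exact dvd_add (Finset.dvd_sum fun j _ => Dvd.dvd.mul_right ⟨_, h4 j⟩ _)
        (Dvd.dvd.mul_left ⟨_, k4 i⟩ _)
    · exact dvd_add (Dvd.dvd.mul_right ⟨_, h5⟩ _) (Dvd.dvd.mul_left ⟨_, k5⟩ _)
    · simp only [BlockMat.mul_t, Pi.add_apply, Matrix.mulVec, dotProduct, Pi.smul_apply,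
        smul_eq_mul]
      exact dvd_add (Finset.dvd_sum fun j _ => Dvd.dvd.mul_left ⟨_, k6 j⟩ _)
        (Dvd.dvd.mul_left ⟨_, h6 i⟩ _)
    · exact dvd_add (Dvd.dvd.mul_left ⟨_, k7⟩ _) (Dvd.dvd.mul_right ⟨_, h7⟩ _)
  algebraMap_mem' := fun r => by
    simp [Algebra.algebraMap_eq_smul_one]

/-- The localisation `ℤ₍₂₎` of the integers at the prime ideal `(2)`. -/
abbrev ZLoc2 : Type :=
  haveI : (Ideal.span {(2 : ℤ)}).IsPrime :=
    (Ideal.span_singleton_prime two_ne_zero).2 Int.prime_two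
  Localization.AtPrime (Ideal.span {(2 : ℤ)})

/-- The `ℤ₍₂₎`-order `Λ₍₂₎`. -/
abbrev Lambda2 : Type := orderLambda ZLoc2

/-- The element `e₃ + e₄ + e₅` of `Λ₍₂₎`: the diagonal matrix with entries `0, 0, 1, 1, 1, 1`. -/
def cornerIdem : Lambda2 where
  val :=
    { s := Matrix.diagonal ![0, 0, 1]
      t := 0
      u := 1
      v := 0
      w := 1
      x := 0
      y := 0
      z₁ := 1
      z₂ := 0
      z₃ := 0 }
  property := by
    refine ⟨?_, ?_, ?_, fun i => ?_, ?_, fun i => ?_, ?_⟩ <;> simp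

lemma cornerIdem_isIdempotentElem : IsIdempotentElem cornerIdem := by
  refine Subtype.ext (BlockMat.ext ?_ ?_ ?_ ?_ ?_ ?_ ?_ ?_ ?_ ?_) <;> simp [cornerIdem]
  intro i
  fin_cases i <;> simp

/-- The corner ring `Λ'₍₂₎ = (e₃ + e₄ + e₅) Λ₍₂₎ (e₃ + e₄ + e₅)`. -/
abbrev Lambda2' : Type := cornerIdem_isIdempotentElem.Corner

instance {A : Type} [Ring A] : (Ideal.span {(2 : A)}).IsTwoSided where
  mul_mem_of_left {a} b h := by
    obtain ⟨c, rfl⟩ := Ideal.mem_span_singleton'.1 h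
    refine Ideal.mem_span_singleton'.2 ⟨c * b, ?_⟩
    rw [mul_assoc, mul_assoc, mul_two, two_mul]

/-- The ring `A / 2A`. -/
abbrev ModTwo (A : Type) [Ring A] : Type := A ⧸ Ideal.span {(2 : A)}

instance {A : Type} [Ring A] : Module (ZMod 2) (ModTwo A) :=
  AddCommGroup.zmodModule fun x => by
    obtain ⟨a, rfl⟩ := Ideal.Quotient.mk_surjective x
    rw [← map_nsmul, Ideal.Quotient.eq_zero_iff_mem, Ideal.mem_span_singleton']
    exact ⟨a, by rw [mul_two, two_nsmul]⟩

/-- `A / 2A` as an `𝔽₂`-algebra. -/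
instance {A : Type} [Ring A] : Algebra (ZMod 2) (ModTwo A) := Algebra.ofModule
  (fun r x y => by
    obtain ⟨n, rfl⟩ := ZMod.natCast_zmod_surjective r
    simp only [Nat.cast_smul_eq_nsmul, smul_mul_assoc])
  (fun r x y => by
    obtain ⟨n, rfl⟩ := ZMod.natCast_zmod_surjective r
    simp only [Nat.cast_smul_eq_nsmul, mul_smul_comm])

/-! ### Path algebras -/

/-- The paths of a quiver, including one path of length `0` at every vertex. -/
abbrev AllPaths (V : Type) [Quiver.{0} V] : Type := Σ i j : V, Quiver.Path i j

/-- The path algebra `k[V]`: the free `k`-module on the paths of the quiver `V`. -/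
def PathAlgebra (k V : Type) [CommRing k] [Quiver.{0} V] : Type := AllPaths V →₀ k

namespace PathAlgebra

variable {k V : Type} [CommRing k] [Quiver.{0} V]

instance : AddCommGroup (PathAlgebra k V) := inferInstanceAs (AddCommGroup (AllPaths V →₀ k))
instance : Module k (PathAlgebra k V) := inferInstanceAs (Module k (AllPaths V →₀ k))

variable (k) in
/-- A path as an element of the path algebra. -/
def ofPath (p : AllPaths V) : PathAlgebra k V := Finsupp.single p (1 : k)

/-- The linear map on the path algebra with prescribed values on the paths. -/
def lift {M : Type*} [AddCommGroup M] [Module k M] (f : AllPaths V → M) :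
    PathAlgebra k V →ₗ[k] M :=
  Finsupp.linearCombination k f

lemma lift_ofPath {M : Type*} [AddCommGroup M] [Module k M] (f : AllPaths V → M)
    (p : AllPaths V) : lift f (ofPath k p) = f p :=
  (Finsupp.linearCombination_single k 1 p).trans (one_smul k (f p))

lemma induction {P : PathAlgebra k V → Prop} (a : PathAlgebra k V) (h0 : P 0)
    (hadd : ∀ a b, P a → P b → P (a + b)) (hp : ∀ (r : k) p, P (r • ofPath k p)) : P a := by
  refine Finsupp.induction_linear a h0 hadd fun p r => ?_
  have : (Finsupp.single p r : AllPaths V →₀ k) = r • Finsupp.single p (1 : k) := by simp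
  rw [this]
  exact hp r p

/-- The unit is the sum of the paths of length `0`. -/
instance [Fintype V] : One (PathAlgebra k V) := ⟨∑ i : V, ofPath k ⟨i, i, Quiver.Path.nil⟩⟩

lemma one_def [Fintype V] :
    (1 : PathAlgebra k V) = ∑ i : V, ofPath k ⟨i, i, Quiver.Path.nil⟩ := rfl

variable [DecidableEq V]

variable (k) in
/-- The product of two paths: the path `p` followed by `q` if `q` starts where `p` ends,
and `0` otherwise. -/
def pathMul (p q : AllPaths V) : PathAlgebra k V :=
  if h : q.1 = p.2.1 then ofPath k ⟨p.1, q.2.1, p.2.2.comp (q.2.2.cast h rfl)⟩ else 0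

/-- The bilinear extension of the product of paths. -/
instance : Mul (PathAlgebra k V) := ⟨fun a b => lift (fun p => lift (pathMul k p)) a b⟩

lemma mul_def (a b : PathAlgebra k V) : a * b = lift (fun p => lift (pathMul k p)) a b := rfl

lemma ofPath_mul_ofPath (p q : AllPaths V) : ofPath k p * ofPath k q = pathMul k p q := by
  rw [mul_def, lift_ofPath, lift_ofPath]

lemma ofPath_mul_of_eq {i j l : V} (p : Quiver.Path i j) (q : Quiver.Path j l) :
    ofPath k ⟨i, j, p⟩ * ofPath k ⟨j, l, q⟩ = ofPath k ⟨i, l, p.comp q⟩ := by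
  rw [ofPath_mul_ofPath, pathMul]
  exact dif_pos rfl

lemma ofPath_mul_of_ne (p q : AllPaths V) (h : q.1 ≠ p.2.1) : ofPath k p * ofPath k q = 0 := by
  rw [ofPath_mul_ofPath, pathMul, dif_neg h]

instance : NonUnitalNonAssocRing (PathAlgebra k V) where
  __ := (inferInstance : AddCommGroup (PathAlgebra k V))
  left_distrib a b c := by simp only [mul_def, map_add]
  right_distrib a b c := by simp only [mul_def, map_add, LinearMap.add_apply]
  zero_mul a := by simp only [mul_def, map_zero, LinearMap.zero_apply]
  mul_zero a := by simp only [mul_def, map_zero]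

protected lemma smul_mul (r : k) (a b : PathAlgebra k V) : r • a * b = r • (a * b) := by
  simp only [mul_def, map_smul, LinearMap.smul_apply]

protected lemma mul_smul (r : k) (a b : PathAlgebra k V) : a * r • b = r • (a * b) := by
  simp only [mul_def, map_smul]

lemma ofPath_mul_assoc (p q r : AllPaths V) :
    ofPath k p * ofPath k q * ofPath k r = ofPath k p * (ofPath k q * ofPath k r) := by
  obtain ⟨i, j, p⟩ := p
  obtain ⟨j', l, q⟩ := q
  obtain ⟨l', m, r⟩ := r
  by_cases h1 : j' = j
  · subst h1
    by_cases h2 : l' = l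
    · subst h2
      simp only [ofPath_mul_of_eq, Quiver.Path.comp_assoc]
    · rw [ofPath_mul_of_eq, ofPath_mul_of_ne _ _ h2, ofPath_mul_of_ne _ _ h2, mul_zero]
  · rw [ofPath_mul_of_ne _ _ h1, zero_mul]
    by_cases h2 : l' = l
    · subst h2
      rw [ofPath_mul_of_eq, ofPath_mul_of_ne _ _ h1]
    · rw [ofPath_mul_of_ne ⟨j', l, q⟩ _ h2, mul_zero]

instance [Fintype V] : Ring (PathAlgebra k V) where
  __ := (inferInstance : NonUnitalNonAssocRing (PathAlgebra k V))
  mul_assoc a b c := by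
    induction a using induction with
    | h0 => simp only [zero_mul]
    | hadd a a' h h' => simp only [add_mul, h, h']
    | hp r p =>
      induction b using induction with
      | h0 => simp only [zero_mul, mul_zero]
      | hadd a a' h h' => simp only [add_mul, mul_add, h, h']
      | hp s q =>
        induction c using induction with
        | h0 => simp only [mul_zero]
        | hadd a a' h h' => simp only [mul_add, h, h']
        | hp t w =>
          simp only [PathAlgebra.smul_mul, PathAlgebra.mul_smul, ofPath_mul_assoc]
  one_mul a := by
    induction a using induction with
    | h0 => simp only [mul_zero]
    | hadd a a' h h' => simp only [mul_add, h, h']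
    | hp r p =>
      obtain ⟨i, j, p⟩ := p
      rw [PathAlgebra.mul_smul, one_def, Finset.sum_mul, Finset.sum_eq_single i]
      · rw [ofPath_mul_of_eq, Quiver.Path.nil_comp]
      · intro l _ hl
        exact ofPath_mul_of_ne _ _ hl.symm
      · exact fun h => absurd (Finset.mem_univ i) h
  mul_one a := by
    induction a using induction with
    | h0 => simp only [zero_mul]
    | hadd a a' h h' => simp only [add_mul, h, h']
    | hp r p =>
      obtain ⟨i, j, p⟩ := p
      rw [PathAlgebra.smul_mul, one_def, Finset.mul_sum, Finset.sum_eq_single j]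
      · rw [ofPath_mul_of_eq, Quiver.Path.comp_nil]
      · intro l _ hl
        exact ofPath_mul_of_ne _ _ hl
      · exact fun h => absurd (Finset.mem_univ j) h

instance [Fintype V] : Algebra k (PathAlgebra k V) :=
  Algebra.ofModule PathAlgebra.smul_mul PathAlgebra.mul_smul

variable (k) in
/-- An arrow as an element of the path algebra. -/
def ofArrow {i j : V} (e : i ⟶ j) : PathAlgebra k V := ofPath k ⟨i, j, e.toPath⟩

end PathAlgebra

/-! ### The quiver and its relations -/

/-- The vertices `3`, `4`, `5` of the quiver. -/
inductive Vertex : Type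
  | e3 | e4 | e5
  deriving DecidableEq

instance : Fintype Vertex := ⟨{.e3, .e4, .e5}, fun i => by cases i <;> decide⟩

/-- The arrows `τ₁ : 5 → 3`, `τ₂ : 3 → 5`, `τ₃ : 5 → 4`, `τ₄ : 4 → 5`, `τ₇ : 5 → 5`. -/
inductive Arrow : Vertex → Vertex → Type
  | τ₁ : Arrow .e5 .e3
  | τ₂ : Arrow .e3 .e5
  | τ₃ : Arrow .e5 .e4
  | τ₄ : Arrow .e4 .e5
  | τ₇ : Arrow .e5 .e5

instance : Quiver.{0} Vertex := ⟨Arrow⟩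

/-- The path algebra `𝔽₂[Ψ]` of this quiver `Ψ`. -/
abbrev F2Psi : Type := PathAlgebra (ZMod 2) Vertex

/-- The arrows as elements of the path algebra. -/
def τ₁ : F2Psi := PathAlgebra.ofArrow (ZMod 2) (i := Vertex.e5) (j := Vertex.e3) Arrow.τ₁
def τ₂ : F2Psi := PathAlgebra.ofArrow (ZMod 2) (i := Vertex.e3) (j := Vertex.e5) Arrow.τ₂
def τ₃ : F2Psi := PathAlgebra.ofArrow (ZMod 2) (i := Vertex.e5) (j := Vertex.e4) Arrow.τ₃
def τ₄ : F2Psi := PathAlgebra.ofArrow (ZMod 2) (i := Vertex.e4) (j := Vertex.e5) Arrow.τ₄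
def τ₇ : F2Psi := PathAlgebra.ofArrow (ZMod 2) (i := Vertex.e5) (j := Vertex.e5) Arrow.τ₇

/-- The relations of the quiver. -/
def relators : Set F2Psi :=
  {τ₂ * τ₁, τ₂ * τ₃, τ₂ * τ₇,
   τ₄ * τ₁, τ₄ * τ₃, τ₄ * τ₇,
   τ₇ * τ₁, τ₇ * τ₃, τ₇ ^ 2 - τ₁ * τ₂}

/-- The path algebra modulo the two-sided ideal generated by the relations. -/
abbrev QuiverAlgebra : Type := RingQuot fun a b : F2Psi => a ∈ relators ∧ b = 0

end BurnsideS3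
end

noncomputable section
namespace BurnsideS3
open scoped Matrix

/-! ### Algebra homomorphisms out of the quiver algebra -/

/-! The double Burnside algebra `A` of `S₃` over `𝔽₂` is spanned by the classes of the transitive
bisets `(G × G) / U`, with `U` running through the 22 conjugacy classes of subgroups of `G × G`. By
the Mackey formula the product of two such classes is a sum over double cosets. Attach an `8 × 8`
matrix over `𝔽₂` to every class of subgroups. Summing over orbits extends this to an additive
invariant of bisets, and it is multiplicative as soon as it respects the Mackey formula on the 22
representatives, which is a finite check (`thetaCode_mulCheck`). This gives the representation
`burnsideRep`; an explicit linear left inverse (`burnsideInv_burnsideRep`) shows that it is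
faithful. No isomorphism between `A` and `Λ₍₂₎ / 2 Λ₍₂₎` is used.

Number rows and columns from `0`. The image of `A` contains the matrix units on the indices `0, 1,
2`, so the idempotent `e = diag(0, 0, 1, 1, 1, 1, 1, 1)` is full: `A e A = A`. The corner `e A e` is
ten-dimensional and acts on the last six coordinates as `Q` acts by left multiplication on `Q e₅`,
in the basis `τ₂, τ₄, e₅, τ₇, τ₁τ₂, τ₃τ₄`. Hence `Q ≅ e A e` (`cornerMap`), and a full corner is
Morita equivalent to the whole algebra by `M ↦ e M` (`FullCorner.isMoritaEquivalent`).

Both comparisons with `Q` rest on one observation. The relations reduce every path to `0` or to one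
of ten monomials (`quiverRep_basis_span`), so a homomorphism out of `Q` is injective once the images
of these ten are linearly independent (`QuiverRep.hom_injective`). For `Λ'₍₂₎ / 2 Λ'₍₂₎` the
congruences are solved by ten free coordinates over `ℤ₍₂₎`. Reduced mod 2, the multiplication in
these coordinates satisfies the relations of the quiver, and the ten monomials become the coordinate
basis (`lambdaRep_basis`). -/

/-- The product along a path of elements attached to the arrows. -/
def pathVal {V X : Type*} [Quiver.{0} V] [Mul X] (E : V → X) (A : ∀ {i j : V}, (i ⟶ j) → X)
    {i : V} : ∀ {j : V}, Quiver.Path i j → X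
  | _, .nil => E i
  | _, .cons p e => pathVal E A p * A e

section Lift

variable {k V : Type} {X : Type*} [CommRing k] [Ring X] [Algebra k X] [Quiver.{0} V]
  {E : V → X} {A : ∀ {i j : V}, (i ⟶ j) → X}

lemma pathVal_mul_right (hE : ∀ i, E i * E i = E i) (hr : ∀ i j (e : i ⟶ j), A e * E j = A e)
    {i j : V} (p : Quiver.Path i j) : pathVal E A p * E j = pathVal E A p := by
  cases p with
  | nil => exact hE i
  | cons p e => rw [pathVal, mul_assoc, hr _ _ e]

lemma pathVal_mul_left (hE : ∀ i, E i * E i = E i) {i j : V} (p : Quiver.Path i j) :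
    E i * pathVal E A p = pathVal E A p := by
  induction p with
  | nil => exact hE i
  | cons p e ih => rw [pathVal, ← mul_assoc, ih]

/-- The idempotent at which `q` begins is absorbed by the value of `p`, because every arrow absorbs
the idempotent at its target. -/
lemma pathVal_comp (hE : ∀ i, E i * E i = E i) (hr : ∀ i j (e : i ⟶ j), A e * E j = A e)
    {i j l : V} (p : Quiver.Path i j) (q : Quiver.Path j l) :
    pathVal E A (p.comp q) = pathVal E A p * pathVal E A q := by
  induction q with
  | nil => exact (pathVal_mul_right hE hr p).symm
  | cons q e ih => rw [Quiver.Path.comp_cons, pathVal, pathVal, ih, mul_assoc]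

/-- The algebra homomorphism on a path algebra given by orthogonal idempotents attached to the
vertices and elements attached to the arrows. -/
def pathHom [Fintype V] [DecidableEq V] (hE : ∀ i, E i * E i = E i)
    (hne : ∀ i j, i ≠ j → E i * E j = 0) (h1 : ∑ i, E i = 1)
    (hr : ∀ i j (e : i ⟶ j), A e * E j = A e) :
    PathAlgebra k V →ₐ[k] X :=
  AlgHom.ofLinearMap (PathAlgebra.lift fun p => pathVal E A p.2.2)
    (by simp only [PathAlgebra.one_def, map_sum, PathAlgebra.lift_ofPath, pathVal, h1])
    (fun a b => by
      have key (p q : AllPaths V) : PathAlgebra.lift (fun p => pathVal E A p.2.2)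
          (PathAlgebra.ofPath k p * PathAlgebra.ofPath k q) =
          pathVal E A p.2.2 * pathVal E A q.2.2 := by
        obtain ⟨i, j, p⟩ := p
        obtain ⟨j', l, q⟩ := q
        by_cases h : j' = j
        · subst h
          rw [PathAlgebra.ofPath_mul_of_eq, PathAlgebra.lift_ofPath]
          exact pathVal_comp hE hr p q
        · rw [PathAlgebra.ofPath_mul_of_ne _ _ h, map_zero]
          dsimp only
          -- The idempotents at the end of `p` and at the start of `q` can be inserted between the
          -- factors; they are orthogonal.
          rw [← pathVal_mul_right hE hr p, ← pathVal_mul_left hE q, mul_assoc,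
            ← mul_assoc (E j), hne j j' (Ne.symm h), zero_mul, mul_zero]
      induction a using PathAlgebra.induction with
      | h0 => simp only [zero_mul, map_zero]
      | hadd a a' h h' => simp only [add_mul, map_add, h, h']
      | hp r p =>
        induction b using PathAlgebra.induction with
        | h0 => simp only [mul_zero, map_zero]
        | hadd b b' h h' => simp only [mul_add, map_add, h, h']
        | hp s q =>
          rw [PathAlgebra.smul_mul, PathAlgebra.mul_smul]
          simp only [map_smul, PathAlgebra.lift_ofPath, smul_mul_assoc, mul_smul_comm, key]
          rw [smul_comm])

lemma pathHom_ofPath [Fintype V] [DecidableEq V] (hE : ∀ i, E i * E i = E i)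
    (hne : ∀ i j, i ≠ j → E i * E j = 0) (h1 : ∑ i, E i = 1)
    (hr : ∀ i j (e : i ⟶ j), A e * E j = A e)
    {i j : V} (p : Quiver.Path i j) :
    pathHom (k := k) hE hne h1 hr (PathAlgebra.ofPath k ⟨i, j, p⟩) = pathVal E A p :=
  PathAlgebra.lift_ofPath _ _

end Lift

/-- Elements of a ring satisfying the relations of the quiver algebra. -/
structure QuiverRep (X : Type*) [Ring X] where
  e3 : X
  e4 : X
  e5 : X
  t1 : X
  t2 : X
  t3 : X
  t4 : X
  t7 : X
  one : e3 + e4 + e5 = 1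
  e3e3 : e3 * e3 = e3
  e4e4 : e4 * e4 = e4
  e5e5 : e5 * e5 = e5
  e3e4 : e3 * e4 = 0
  e4e3 : e4 * e3 = 0
  e3e5 : e3 * e5 = 0
  e5e3 : e5 * e3 = 0
  e4e5 : e4 * e5 = 0
  e5e4 : e5 * e4 = 0
  e5t1 : e5 * t1 = t1
  t1e3 : t1 * e3 = t1
  e3t2 : e3 * t2 = t2
  t2e5 : t2 * e5 = t2
  e5t3 : e5 * t3 = t3
  t3e4 : t3 * e4 = t3
  e4t4 : e4 * t4 = t4
  t4e5 : t4 * e5 = t4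
  e5t7 : e5 * t7 = t7
  t7e5 : t7 * e5 = t7
  t2t1 : t2 * t1 = 0
  t2t3 : t2 * t3 = 0
  t2t7 : t2 * t7 = 0
  t4t1 : t4 * t1 = 0
  t4t3 : t4 * t3 = 0
  t4t7 : t4 * t7 = 0
  t7t1 : t7 * t1 = 0
  t7t3 : t7 * t3 = 0
  t7t7 : t7 * t7 = t1 * t2

namespace QuiverRep

variable {X : Type*} [Ring X] (ρ : QuiverRep X)

/-- The idempotent at a vertex. -/
def vertex : Vertex → X
  | .e3 => ρ.e3
  | .e4 => ρ.e4
  | .e5 => ρ.e5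

/-- The element at an arrow. -/
def arrow : ∀ {i j : Vertex}, (i ⟶ j) → X
  | _, _, Arrow.τ₁ => ρ.t1
  | _, _, Arrow.τ₂ => ρ.t2
  | _, _, Arrow.τ₃ => ρ.t3
  | _, _, Arrow.τ₄ => ρ.t4
  | _, _, Arrow.τ₇ => ρ.t7

/-- The images of the basis of the quiver algebra. -/
def basis : Fin 10 → X :=
  ![ρ.e3, ρ.e4, ρ.e5, ρ.t1, ρ.t2, ρ.t3, ρ.t4, ρ.t7, ρ.t1 * ρ.t2, ρ.t3 * ρ.t4]

variable [Algebra (ZMod 2) X]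

/-- The homomorphism from the path algebra. -/
def preHom : F2Psi →ₐ[ZMod 2] X :=
  pathHom (E := ρ.vertex) (A := ρ.arrow)
    (by rintro (_ | _ | _) <;> simp [vertex, ρ.e3e3, ρ.e4e4, ρ.e5e5])
    (by rintro (_ | _ | _) (_ | _ | _) h <;> first | exact absurd rfl h |
          simp [vertex, ρ.e3e4, ρ.e3e5, ρ.e4e3, ρ.e4e5, ρ.e5e3, ρ.e5e4])
    (by
      rw [← ρ.one]
      show ∑ i ∈ ({.e3, .e4, .e5} : Finset Vertex), ρ.vertex i = _
      rw [Finset.sum_insert (by decide), Finset.sum_insert (by decide), Finset.sum_singleton,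
        add_assoc]
      rfl)
    (by rintro _ _ (_ | _ | _ | _ | _) <;>
          simp [vertex, arrow, ρ.t1e3, ρ.t2e5, ρ.t3e4, ρ.t4e5, ρ.t7e5])

lemma preHom_nil (i : Vertex) :
    ρ.preHom (PathAlgebra.ofPath (ZMod 2) ⟨i, i, .nil⟩) = ρ.vertex i :=
  pathHom_ofPath _ _ _ _ _

lemma preHom_ofArrow {i j : Vertex} (e : i ⟶ j) :
    ρ.preHom (PathAlgebra.ofArrow (ZMod 2) e) = ρ.arrow e := by
  refine (pathHom_ofPath _ _ _ _ _).trans ?_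
  obtain _ | _ | _ | _ | _ := e <;>
    simp [Quiver.Hom.toPath, pathVal, vertex, arrow, ρ.e5t1, ρ.e3t2, ρ.e5t3, ρ.e4t4, ρ.e5t7]

/-- The homomorphism from the quiver algebra. -/
def hom : QuiverAlgebra →ₐ[ZMod 2] X :=
  RingQuot.liftAlgHom (ZMod 2) ⟨ρ.preHom, by
    have h1 : ρ.preHom τ₁ = ρ.t1 := ρ.preHom_ofArrow _
    have h2 : ρ.preHom τ₂ = ρ.t2 := ρ.preHom_ofArrow _
    have h3 : ρ.preHom τ₃ = ρ.t3 := ρ.preHom_ofArrow _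
    have h4 : ρ.preHom τ₄ = ρ.t4 := ρ.preHom_ofArrow _
    have h7 : ρ.preHom τ₇ = ρ.t7 := ρ.preHom_ofArrow _
    rintro a _ ⟨ha, rfl⟩
    rw [map_zero]
    simp only [relators, Set.mem_insert_iff, Set.mem_singleton_iff] at ha
    rcases ha with rfl | rfl | rfl | rfl | rfl | rfl | rfl | rfl | rfl <;>
      simp [h1, h2, h3, h4, h7, pow_two, ρ.t2t1, ρ.t2t3, ρ.t2t7, ρ.t4t1, ρ.t4t3, ρ.t4t7,
        ρ.t7t1, ρ.t7t3, ρ.t7t7]⟩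

end QuiverRep

/-! ### Ten monomials spanning the quiver algebra -/

/-- The projection from the path algebra to the quiver algebra. -/
def toQuiverAlgebra : F2Psi →ₐ[ZMod 2] QuiverAlgebra :=
  RingQuot.mkAlgHom (ZMod 2) fun a b : F2Psi => a ∈ relators ∧ b = 0

lemma toQuiverAlgebra_surjective : Function.Surjective toQuiverAlgebra :=
  RingQuot.mkAlgHom_surjective _ _

lemma toQuiverAlgebra_eq_zero {a : F2Psi} (h : a ∈ relators) : toQuiverAlgebra a = 0 :=
  (RingQuot.mkAlgHom_rel (ZMod 2) (s := fun a b : F2Psi => a ∈ relators ∧ b = 0)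
    ⟨h, rfl⟩).trans (map_zero _)

lemma QuiverRep.hom_toQuiverAlgebra {X : Type*} [Ring X] [Algebra (ZMod 2) X] (ρ : QuiverRep X)
    (a : F2Psi) : ρ.hom (toQuiverAlgebra a) = ρ.preHom a :=
  RingQuot.liftAlgHom_mkAlgHom_apply _ _ _ _

open PathAlgebra in
/-- The generators of the quiver algebra. -/
def quiverRep : QuiverRep QuiverAlgebra where
  e3 := toQuiverAlgebra (ofPath (ZMod 2) ⟨.e3, .e3, .nil⟩)
  e4 := toQuiverAlgebra (ofPath (ZMod 2) ⟨.e4, .e4, .nil⟩)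
  e5 := toQuiverAlgebra (ofPath (ZMod 2) ⟨.e5, .e5, .nil⟩)
  t1 := toQuiverAlgebra τ₁
  t2 := toQuiverAlgebra τ₂
  t3 := toQuiverAlgebra τ₃
  t4 := toQuiverAlgebra τ₄
  t7 := toQuiverAlgebra τ₇
  one := by
    rw [← map_one toQuiverAlgebra, one_def, ← map_add, ← map_add]
    congr 1
    show _ = ∑ i ∈ ({.e3, .e4, .e5} : Finset Vertex), ofPath (ZMod 2) ⟨i, i, .nil⟩
    rw [Finset.sum_insert (by decide), Finset.sum_insert (by decide), Finset.sum_singleton,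
      add_assoc]
  e3e3 := by rw [← map_mul, ofPath_mul_of_eq]; rfl
  e4e4 := by rw [← map_mul, ofPath_mul_of_eq]; rfl
  e5e5 := by rw [← map_mul, ofPath_mul_of_eq]; rfl
  e3e4 := by rw [← map_mul, ofPath_mul_of_ne _ _ (by decide), map_zero]
  e4e3 := by rw [← map_mul, ofPath_mul_of_ne _ _ (by decide), map_zero]
  e3e5 := by rw [← map_mul, ofPath_mul_of_ne _ _ (by decide), map_zero]
  e5e3 := by rw [← map_mul, ofPath_mul_of_ne _ _ (by decide), map_zero]
  e4e5 := by rw [← map_mul, ofPath_mul_of_ne _ _ (by decide), map_zero]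
  e5e4 := by rw [← map_mul, ofPath_mul_of_ne _ _ (by decide), map_zero]
  e5t1 := by rw [← map_mul, τ₁, ofArrow, ofPath_mul_of_eq]; rfl
  t1e3 := by rw [← map_mul, τ₁, ofArrow, ofPath_mul_of_eq]; rfl
  e3t2 := by rw [← map_mul, τ₂, ofArrow, ofPath_mul_of_eq]; rfl
  t2e5 := by rw [← map_mul, τ₂, ofArrow, ofPath_mul_of_eq]; rfl
  e5t3 := by rw [← map_mul, τ₃, ofArrow, ofPath_mul_of_eq]; rfl
  t3e4 := by rw [← map_mul, τ₃, ofArrow, ofPath_mul_of_eq]; rfl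
  e4t4 := by rw [← map_mul, τ₄, ofArrow, ofPath_mul_of_eq]; rfl
  t4e5 := by rw [← map_mul, τ₄, ofArrow, ofPath_mul_of_eq]; rfl
  e5t7 := by rw [← map_mul, τ₇, ofArrow, ofPath_mul_of_eq]; rfl
  t7e5 := by rw [← map_mul, τ₇, ofArrow, ofPath_mul_of_eq]; rfl
  t2t1 := by rw [← map_mul]; exact toQuiverAlgebra_eq_zero (by simp [relators])
  t2t3 := by rw [← map_mul]; exact toQuiverAlgebra_eq_zero (by simp [relators])
  t2t7 := by rw [← map_mul]; exact toQuiverAlgebra_eq_zero (by simp [relators])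
  t4t1 := by rw [← map_mul]; exact toQuiverAlgebra_eq_zero (by simp [relators])
  t4t3 := by rw [← map_mul]; exact toQuiverAlgebra_eq_zero (by simp [relators])
  t4t7 := by rw [← map_mul]; exact toQuiverAlgebra_eq_zero (by simp [relators])
  t7t1 := by rw [← map_mul]; exact toQuiverAlgebra_eq_zero (by simp [relators])
  t7t3 := by rw [← map_mul]; exact toQuiverAlgebra_eq_zero (by simp [relators])
  t7t7 := by
    rw [← sub_eq_zero, ← map_mul, ← map_mul, ← map_sub, ← pow_two]
    exact toQuiverAlgebra_eq_zero (by simp [relators])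

/-- The images in the quiver algebra of the paths that end in a given vertex. -/
def pathImages : Vertex → List QuiverAlgebra
  | .e3 => [0, quiverRep.e3, quiverRep.t1]
  | .e4 => [0, quiverRep.e4, quiverRep.t3]
  | .e5 => [0, quiverRep.e5, quiverRep.t2, quiverRep.t4, quiverRep.t7,
      quiverRep.t1 * quiverRep.t2, quiverRep.t3 * quiverRep.t4]

/-- The relations kill every product of `τ₂` or `τ₄` with a further arrow and leave only `τ₇τ₇ =
τ₁τ₂` after `τ₇`. The lists contain `0` to absorb the products that vanish, so induction on the
length puts every path into them. -/
lemma arrow_mem_pathImages {i j : Vertex} (e : i ⟶ j) {x : QuiverAlgebra}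
    (hx : x ∈ pathImages i) : x * quiverRep.arrow e ∈ pathImages j := by
  have h := quiverRep
  obtain _ | _ | _ | _ | _ := e <;>
    simp only [pathImages, List.mem_cons, List.not_mem_nil, or_false] at hx <;>
    rcases hx with rfl | rfl | rfl | rfl | rfl | rfl | rfl <;>
    simp [QuiverRep.arrow, pathImages, quiverRep.e5t1, quiverRep.e3t2, quiverRep.e5t3,
      quiverRep.e4t4, quiverRep.e5t7, quiverRep.t2t1, quiverRep.t2t3, quiverRep.t2t7,
      quiverRep.t4t1, quiverRep.t4t3, quiverRep.t4t7, quiverRep.t7t1, quiverRep.t7t3,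
      quiverRep.t7t7, mul_assoc]

lemma toQuiverAlgebra_ofPath_mem {i j : Vertex} (p : Quiver.Path i j) :
    toQuiverAlgebra (PathAlgebra.ofPath (ZMod 2) ⟨i, j, p⟩) ∈ pathImages j := by
  induction p with
  | nil => cases i <;> simp [pathImages, quiverRep]
  | @cons j l p e ih =>
    have h : PathAlgebra.ofPath (ZMod 2) ⟨i, l, p.cons e⟩ =
        PathAlgebra.ofPath (ZMod 2) ⟨i, j, p⟩ * PathAlgebra.ofArrow (ZMod 2) e := by
      rw [PathAlgebra.ofArrow, PathAlgebra.ofPath_mul_of_eq]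
      rfl
    rw [h, map_mul]
    have := arrow_mem_pathImages e ih
    have he : toQuiverAlgebra (PathAlgebra.ofArrow (ZMod 2) e) = quiverRep.arrow e := by
      obtain _ | _ | _ | _ | _ := e <;> rfl
    rwa [he]

lemma pathImages_mem_span {i : Vertex} {x : QuiverAlgebra} (hx : x ∈ pathImages i) :
    x ∈ Submodule.span (ZMod 2) (Set.range quiverRep.basis) := by
  have hb : ∀ n, quiverRep.basis n ∈ Submodule.span (ZMod 2) (Set.range quiverRep.basis) :=
    fun n => Submodule.subset_span ⟨n, rfl⟩
  cases i <;> simp only [pathImages, List.mem_cons, List.not_mem_nil, or_false] at hx <;>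
    rcases hx with rfl | rfl | rfl | rfl | rfl | rfl | rfl
  · exact zero_mem _
  · exact hb 0
  · exact hb 3
  · exact zero_mem _
  · exact hb 1
  · exact hb 5
  · exact zero_mem _
  · exact hb 2
  · exact hb 4
  · exact hb 6
  · exact hb 7
  · exact hb 8
  · exact hb 9

lemma quiverRep_basis_span : ∀ x : QuiverAlgebra,
    x ∈ Submodule.span (ZMod 2) (Set.range quiverRep.basis) := by
  intro x
  obtain ⟨a, rfl⟩ := toQuiverAlgebra_surjective x
  induction a using PathAlgebra.induction with
  | h0 => rw [map_zero]; exact zero_mem _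
  | hadd a b ha hb => rw [map_add]; exact add_mem ha hb
  | hp r p =>
    rw [map_smul]
    exact Submodule.smul_mem _ _ (pathImages_mem_span (toQuiverAlgebra_ofPath_mem p.2.2))

lemma exists_quiverRep_basis (x : QuiverAlgebra) :
    ∃ c : Fin 10 → ZMod 2, ∑ i, c i • quiverRep.basis i = x :=
  (Submodule.mem_span_range_iff_exists_fun _).1 (quiverRep_basis_span x)

namespace QuiverRep

variable {X : Type*} [Ring X] [Algebra (ZMod 2) X] (ρ : QuiverRep X)

lemma hom_basis (i : Fin 10) : ρ.hom (quiverRep.basis i) = ρ.basis i := by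
  have h3 : ρ.hom quiverRep.e3 = ρ.e3 := (ρ.hom_toQuiverAlgebra _).trans (ρ.preHom_nil _)
  have h4 : ρ.hom quiverRep.e4 = ρ.e4 := (ρ.hom_toQuiverAlgebra _).trans (ρ.preHom_nil _)
  have h5 : ρ.hom quiverRep.e5 = ρ.e5 := (ρ.hom_toQuiverAlgebra _).trans (ρ.preHom_nil _)
  have k1 : ρ.hom quiverRep.t1 = ρ.t1 := (ρ.hom_toQuiverAlgebra _).trans (ρ.preHom_ofArrow _)
  have k2 : ρ.hom quiverRep.t2 = ρ.t2 := (ρ.hom_toQuiverAlgebra _).trans (ρ.preHom_ofArrow _)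
  have k3 : ρ.hom quiverRep.t3 = ρ.t3 := (ρ.hom_toQuiverAlgebra _).trans (ρ.preHom_ofArrow _)
  have k4 : ρ.hom quiverRep.t4 = ρ.t4 := (ρ.hom_toQuiverAlgebra _).trans (ρ.preHom_ofArrow _)
  have k7 : ρ.hom quiverRep.t7 = ρ.t7 := (ρ.hom_toQuiverAlgebra _).trans (ρ.preHom_ofArrow _)
  fin_cases i <;> simp [basis, h3, h4, h5, k1, k2, k3, k4, k7]

/-- The ten monomials are only known to span; independence of their images gives injectivity and,
with it, their own independence. No normal form theorem for `Q` is needed. -/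
lemma hom_injective (h : LinearIndependent (ZMod 2) ρ.basis) : Function.Injective ρ.hom := by
  rw [injective_iff_map_eq_zero]
  intro x hx
  obtain ⟨c, rfl⟩ := exists_quiverRep_basis x
  simp only [map_sum, map_smul, hom_basis] at hx
  have := Fintype.linearIndependent_iff.1 h c hx
  simp [this]

lemma hom_surjective (h : ∀ x, x ∈ Submodule.span (ZMod 2) (Set.range ρ.basis)) :
    Function.Surjective ρ.hom := by
  intro x
  obtain ⟨c, rfl⟩ := (Submodule.mem_span_range_iff_exists_fun _).1 (h x)
  exact ⟨∑ i, c i • quiverRep.basis i, by simp only [map_sum, map_smul, hom_basis]⟩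

end QuiverRep
end BurnsideS3
end

noncomputable section
namespace BurnsideS3
open scoped Matrix

/-! ### The ring `Λ'₍₂₎ / 2 Λ'₍₂₎` -/

section Coordinates

variable {R : Type} [CommRing R]

/-- The element of `Λ'` with given coordinates, listed in the order of `QuiverRep.basis`. -/
def block (d : Fin 10 → R) : BlockMat R where
  s := Matrix.diagonal ![0, 0, d 0]
  t := ![0, 0, 2 * d 4]
  u := d 1
  v := 2 * d 6
  w := d 2 + 2 * d 7 + 4 * d 8
  x := ![0, 0, 4 * d 3]
  y := 2 * d 5
  z₁ := d 2
  z₂ := 4 * d 7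
  z₃ := 4 * d 9

/-- The multiplication of `Λ'` in coordinates. -/
def coordMul (d d' : Fin 10 → R) : Fin 10 → R :=
  ![d 0 * d' 0, d 1 * d' 1, d 2 * d' 2, d 3 * d' 0 + d 2 * d' 3, d 0 * d' 4 + d 4 * d' 2,
    d 5 * d' 1 + d 2 * d' 5, d 1 * d' 6 + d 6 * d' 2,
    d 2 * d' 7 + d 7 * d' 2 + 2 * (d 3 * d' 4) - 12 * (d 5 * d' 6),
    d 2 * d' 8 + d 8 * d' 2 + d 7 * d' 7 + 2 * (d 7 * d' 8 + d 8 * d' 7) + 4 * (d 8 * d' 8)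
      - d 3 * d' 4 + 6 * (d 5 * d' 6),
    d 2 * d' 9 + d 9 * d' 2 + d 5 * d' 6]

lemma block_add (d d' : Fin 10 → R) : block (d + d') = block d + block d' := by
  refine BlockMat.ext ?_ ?_ ?_ ?_ ?_ ?_ ?_ ?_ ?_ ?_ <;> simp only [block, BlockMat.add_s,
    BlockMat.add_t, BlockMat.add_u, BlockMat.add_v, BlockMat.add_w, BlockMat.add_x,
    BlockMat.add_y, BlockMat.add_z₁, BlockMat.add_z₂, BlockMat.add_z₃, Pi.add_apply, mul_add]
  · rw [Matrix.diagonal_add]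
    congr 1
    ext i
    fin_cases i <;> simp
  · simp
  · ring
  · simp

/-- Coordinate `8` is what remains of the `w`-entry of a product after removing the contributions of
`z₁` and `z₂`. The cross term `2 d₇ · 2 d'₇` in `w` and the term `x · t` in `z₂` both leave a trace
there, namely `d₇ d'₇` and `-d₃ d'₄`. This is the source of `τ₇² = τ₁τ₂` mod 2. -/
lemma block_mul (d d' : Fin 10 → R) : block d * block d' = block (coordMul d d') := by
  refine BlockMat.ext ?_ ?_ ?_ ?_ ?_ ?_ ?_ ?_ ?_ ?_ <;> simp only [block, BlockMat.mul_s,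
    BlockMat.mul_t, BlockMat.mul_u, BlockMat.mul_v, BlockMat.mul_w, BlockMat.mul_x,
    BlockMat.mul_y, BlockMat.mul_z₁, BlockMat.mul_z₂, BlockMat.mul_z₃]
  · rw [Matrix.diagonal_mul_diagonal]
    congr 1
    ext i
    fin_cases i <;> simp [coordMul]
  · ext i
    fin_cases i <;> simp [coordMul, Matrix.mulVec_diagonal]
    ring
  · simp [coordMul]
  · simp [coordMul]
    ring
  · simp [coordMul]
    ring
  · ext i
    fin_cases i <;> simp [coordMul, Matrix.vecMul_diagonal]
    ring
  · simp [coordMul]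
    ring
  · simp [coordMul]
  · simp [coordMul, dotProduct, Fin.sum_univ_three]
    ring
  · simp [coordMul]
    ring

lemma block_mem (d : Fin 10 → R) : block d ∈ orderLambda R := by
  refine ⟨⟨d 8, ?_⟩, ⟨d 7 - d 9, ?_⟩, ⟨d 9, rfl⟩, fun i => ?_, ⟨d 5, rfl⟩, fun i => ?_,
    ⟨d 6, rfl⟩⟩
  · simp only [block]
    ring
  · simp only [block]
    ring
  · fin_cases i <;> simp [block]
  · fin_cases i <;> simp [block]

lemma block_injective [IsDomain R] (h2 : (2 : R) ≠ 0) :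
    Function.Injective (block : (Fin 10 → R) → BlockMat R) := by
  intro d d' h
  have h4 : (4 : R) ≠ 0 := by
    rw [show (4 : R) = 2 * 2 by norm_num]
    exact mul_ne_zero h2 h2
  have h0 := congrFun (congrFun (congrArg BlockMat.s h) 2) 2
  have ht := congrFun (congrArg BlockMat.t h) 2
  have hx := congrFun (congrArg BlockMat.x h) 2
  have hu := congrArg BlockMat.u h
  have hv := congrArg BlockMat.v h
  have hw := congrArg BlockMat.w h
  have hy := congrArg BlockMat.y h
  have hz₁ := congrArg BlockMat.z₁ h
  have hz₂ := congrArg BlockMat.z₂ h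
  have hz₃ := congrArg BlockMat.z₃ h
  simp [block, h2, h4] at h0 ht hx hu hv hw hy hz₁ hz₂ hz₃
  have ha : d 8 = d' 8 := by
    refine mul_left_cancel₀ h4 ?_
    linear_combination hw - hz₁ - 2 * hz₂
  ext i
  fin_cases i <;> assumption

/-- The coordinates of the unit of `Λ'`. -/
def coordOne : Fin 10 → R := ![1, 1, 1, 0, 0, 0, 0, 0, 0, 0]

end Coordinates

lemma cornerIdem_eq_block : (cornerIdem : BlockMat ZLoc2) = block coordOne := by
  refine BlockMat.ext ?_ ?_ ?_ ?_ ?_ ?_ ?_ ?_ ?_ ?_ <;> simp [cornerIdem, block, coordOne]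
  · ext i
    fin_cases i <;> simp
  · ext i
    fin_cases i <;> simp

lemma coordOne_mul {R : Type} [CommRing R] (d : Fin 10 → R) : coordMul coordOne d = d := by
  ext i
  fin_cases i <;> simp [coordMul, coordOne]

/-- The structure constants are integers, so products of integral elements can be evaluated over
`ℤ`, where divisibility by 2 is decidable. -/
lemma coordMul_intCast {R : Type} [CommRing R] (a b : Fin 10 → ℤ) :
    coordMul (fun i => (a i : R)) (fun i => (b i : R)) = fun i => ((coordMul a b i : ℤ) : R) := by
  ext i
  fin_cases i <;> simp [coordMul]

lemma mul_coordOne {R : Type} [CommRing R] (d : Fin 10 → R) : coordMul d coordOne = d := by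
  ext i
  fin_cases i <;> simp [coordMul, coordOne]

/-! ### Coordinates on `Λ'₍₂₎` and reduction mod 2 -/

/-- The element of `Λ'₍₂₎` with given coordinates. -/
def ofCoords (d : Fin 10 → ZLoc2) : Lambda2' :=
  ⟨⟨block d, block_mem d⟩, ⟨block d, block_mem d⟩, by
    refine Subtype.ext ?_
    show (cornerIdem : BlockMat ZLoc2) * block d * (cornerIdem : BlockMat ZLoc2) = block d
    rw [cornerIdem_eq_block, block_mul, block_mul, coordOne_mul, mul_coordOne]⟩

/-- The block matrix of an element of `Λ'₍₂₎`. -/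
def Lambda2'.mat (x : Lambda2') : BlockMat ZLoc2 := (show Lambda2 from x.1)

lemma mat_injective {x y : Lambda2'} (h : x.mat = y.mat) : x = y := Subtype.ext (Subtype.ext h)

lemma mat_ofCoords (d : Fin 10 → ZLoc2) : (ofCoords d).mat = block d := rfl

lemma ofCoords_add (d d' : Fin 10 → ZLoc2) : ofCoords (d + d') = ofCoords d + ofCoords d' :=
  mat_injective (block_add d d')

lemma ofCoords_mul (d d' : Fin 10 → ZLoc2) :
    ofCoords d * ofCoords d' = ofCoords (coordMul d d') :=
  mat_injective (block_mul d d')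

lemma ofCoords_one : ofCoords coordOne = 1 := mat_injective cornerIdem_eq_block.symm

lemma two_ne_zero_ZLoc2 : (2 : ZLoc2) ≠ 0 := by
  have : (Ideal.span {(2 : ℤ)}).IsPrime :=
    (Ideal.span_singleton_prime two_ne_zero).2 Int.prime_two
  have : CharZero ZLoc2 := by
    refine charZero_of_injective_algebraMap (R := ℤ) ?_
    exact IsLocalization.injective ZLoc2 (M := (Ideal.span {(2 : ℤ)}).primeCompl)
      (Ideal.primeCompl_le_nonZeroDivisors _)
  exact two_ne_zero

instance : IsDomain ZLoc2 :=
  haveI : (Ideal.span {(2 : ℤ)}).IsPrime :=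
    (Ideal.span_singleton_prime two_ne_zero).2 Int.prime_two
  IsLocalization.isDomain_of_atPrime ZLoc2 (Ideal.span {(2 : ℤ)})

/-- The equation `ε x ε = x` kills all entries of `s`, `t` and `x` outside the third index, and the
congruences supply the quotients that serve as coordinates. -/
lemma ofCoords_surjective : Function.Surjective ofCoords := by
  intro x
  obtain ⟨⟨h1, ⟨b', h2⟩, ⟨c, h3⟩, h4, ⟨y, h5⟩, h6, ⟨v, h7⟩⟩, hx⟩ :
      x.mat ∈ orderLambda ZLoc2 ∧ block coordOne * x.mat * block coordOne = x.mat := by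
    refine ⟨x.1.2, ?_⟩
    obtain ⟨hl, hr⟩ := (Subsemigroup.mem_corner_iff cornerIdem_isIdempotentElem).1 x.2
    have hl' := congrArg (fun a : Lambda2 => (a : BlockMat ZLoc2)) hl
    have hr' := congrArg (fun a : Lambda2 => (a : BlockMat ZLoc2)) hr
    rw [← cornerIdem_eq_block]
    exact (congrArg (· * (cornerIdem : BlockMat ZLoc2)) hl').trans hr'
  obtain ⟨a, ha⟩ := h1
  obtain ⟨x2, h4⟩ := h4 2
  obtain ⟨t2, h6⟩ := h6 2
  -- The entry `b' + c` is `z₂ / 4`: the congruences give `z₂ - z₃ = 4 b'` and `z₃ = 4 c`.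
  refine ⟨![x.mat.s 2 2, x.mat.u, x.mat.z₁, x2, t2, y, v, b' + c, a, c], mat_injective ?_⟩
  rw [mat_ofCoords]
  have hs := congrArg BlockMat.s hx
  have ht := congrArg BlockMat.t hx
  have hx' := congrArg BlockMat.x hx
  have hz : x.mat.z₂ = 4 * (b' + c) := by linear_combination h2 + h3
  refine BlockMat.ext ?_ ?_ ?_ ?_ ?_ ?_ ?_ ?_ ?_ ?_
  · rw [← hs]
    ext i j
    fin_cases i <;> fin_cases j <;> simp [block, coordOne]
  · rw [← ht]
    ext i
    fin_cases i <;> simp [block, coordOne, h6, Matrix.mulVec, dotProduct, Fin.sum_univ_three,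
      Matrix.vecHead, Matrix.vecTail, Matrix.diagonal_apply]
  · simp [block]
  · simp [block, h7]
  -- The congruence mod 8 constrains `2 w` rather than `w`, so a factor 2 has to be cancelled.
  · refine mul_left_cancel₀ two_ne_zero_ZLoc2 ?_
    show 2 * (x.mat.z₁ + 2 * (b' + c) + 4 * a) = 2 * x.mat.w
    linear_combination -ha - hz
  · rw [← hx']
    ext i
    fin_cases i <;> simp [block, coordOne, h4, Matrix.vecMul, dotProduct, Fin.sum_univ_three]
  · simp [block, h5]
  · simp [block]
  · simp [block, hz]
  · simp [block, h3]

/-- The residue field is `𝔽₂`: for `r = m / s` with `s` odd, the parity of `m` decides, since `r - 1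
= (m - s) / s`. -/
lemma two_dvd_or (r : ZLoc2) : 2 ∣ r ∨ 2 ∣ r - 1 := by
  have : (Ideal.span {(2 : ℤ)}).IsPrime :=
    (Ideal.span_singleton_prime two_ne_zero).2 Int.prime_two
  obtain ⟨m, s, rfl⟩ := IsLocalization.exists_mk'_eq (Ideal.span {(2 : ℤ)}).primeCompl r
  have hs : ¬ (2 : ℤ) ∣ s := fun h => s.2 (Ideal.mem_span_singleton.2 h)
  have hu : IsUnit (algebraMap ℤ ZLoc2 s) := IsLocalization.map_units ZLoc2 s
  have hr := IsLocalization.mk'_spec ZLoc2 m s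
  rcases Int.even_or_odd' m with ⟨a, rfl | rfl⟩
  · refine Or.inl (hu.dvd_mul_right.1 ⟨algebraMap ℤ ZLoc2 a, ?_⟩)
    rw [hr]
    simp
  · obtain ⟨b, hb⟩ : ∃ b, (s : ℤ) = 2 * b + 1 := ⟨s / 2, by omega⟩
    refine Or.inr (hu.dvd_mul_right.1 ⟨algebraMap ℤ ZLoc2 (a - b), ?_⟩)
    rw [sub_mul, hr, one_mul, hb]
    simp
    ring

lemma not_two_dvd_one : ¬ (2 : ZLoc2) ∣ 1 := by
  have : (Ideal.span {(2 : ℤ)}).IsPrime :=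
    (Ideal.span_singleton_prime two_ne_zero).2 Int.prime_two
  intro h
  have h1 : algebraMap ℤ ZLoc2 2 ∈ IsLocalRing.maximalIdeal ZLoc2 := by
    rw [IsLocalization.AtPrime.to_map_mem_maximal_iff ZLoc2 (Ideal.span {(2 : ℤ)})]
    exact Ideal.mem_span_singleton_self 2
  rw [map_ofNat, IsLocalRing.mem_maximalIdeal] at h1
  exact h1 (isUnit_of_dvd_one h)

/-- The class in `Λ'₍₂₎ / 2 Λ'₍₂₎` of the element with given coordinates. -/
def classOf (d : Fin 10 → ZLoc2) : ModTwo Lambda2' := Ideal.Quotient.mk _ (ofCoords d)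

lemma classOf_mul (d d' : Fin 10 → ZLoc2) : classOf d * classOf d' = classOf (coordMul d d') := by
  rw [classOf, classOf, classOf, ← RingHom.map_mul, ofCoords_mul]

lemma classOf_add (d d' : Fin 10 → ZLoc2) : classOf (d + d') = classOf d + classOf d' := by
  rw [classOf, ofCoords_add, RingHom.map_add]
  rfl

/-- Coordinates are additive and unique, so the ideal generated by 2 consists of the elements with
even coordinates. -/
lemma classOf_eq_zero_iff (d : Fin 10 → ZLoc2) : classOf d = 0 ↔ ∀ i, 2 ∣ d i := by
  rw [classOf, Ideal.Quotient.eq_zero_iff_mem, Ideal.mem_span_singleton']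
  constructor
  · rintro ⟨x, hx⟩
    obtain ⟨d', rfl⟩ := ofCoords_surjective x
    rw [mul_two, ← ofCoords_add] at hx
    have h := block_injective two_ne_zero_ZLoc2 (congrArg Lambda2'.mat hx)
    exact fun i => ⟨d' i, by rw [← h, two_mul]; rfl⟩
  · intro h
    choose d' hd' using h
    refine ⟨ofCoords d', ?_⟩
    rw [mul_two, ← ofCoords_add]
    congr 1
    ext i
    rw [hd', two_mul]
    rfl

lemma classOf_eq_iff (d d' : Fin 10 → ZLoc2) : classOf d = classOf d' ↔ ∀ i, 2 ∣ d i - d' i := by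
  have h : classOf d = classOf (d - d') + classOf d' := by rw [← classOf_add, sub_add_cancel]
  rw [h, add_eq_right, classOf_eq_zero_iff]
  rfl

/-- The class in `Λ'₍₂₎ / 2 Λ'₍₂₎` of the element with given integral coordinates. -/
def intClass : (Fin 10 → ℤ) →+ ModTwo Lambda2' where
  toFun a := classOf fun i => (a i : ZLoc2)
  map_zero' := (classOf_eq_zero_iff _).2 fun i => by simp
  map_add' a b := by
    rw [← classOf_add]
    congr 1
    ext i
    simp

lemma intClass_apply (a : Fin 10 → ℤ) : intClass a = classOf fun i => (a i : ZLoc2) := rfl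

lemma intClass_mul (a b : Fin 10 → ℤ) : intClass a * intClass b = intClass (coordMul a b) := by
  rw [intClass_apply, intClass_apply, intClass_apply, classOf_mul, coordMul_intCast]

lemma classOf_eq_intClass {d : Fin 10 → ZLoc2} {a : Fin 10 → ℤ}
    (h : ∀ i, 2 ∣ d i - (a i : ZLoc2)) : classOf d = intClass a :=
  (classOf_eq_iff _ _).2 h

lemma intClass_eq {a b : Fin 10 → ℤ} (h : ∀ i, (2 : ℤ) ∣ a i - b i) :
    intClass a = intClass b := by
  refine classOf_eq_intClass fun i => ?_
  obtain ⟨c, hc⟩ := h i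
  exact ⟨c, by exact_mod_cast congrArg (Int.cast : ℤ → ZLoc2) hc⟩

lemma intClass_mul_eq {a b c : Fin 10 → ℤ} (h : ∀ i, (2 : ℤ) ∣ coordMul a b i - c i) :
    intClass a * intClass b = intClass c := by
  rw [intClass_mul, intClass_eq h]

lemma intClass_mul_eq_zero {a b : Fin 10 → ℤ} (h : ∀ i, (2 : ℤ) ∣ coordMul a b i) :
    intClass a * intClass b = 0 := by
  rw [← map_zero intClass]
  exact intClass_mul_eq fun i => by simpa using h i

/-- The class of an element of the coordinate basis of `Λ'₍₂₎`. -/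
def unitClass (i : Fin 10) : ModTwo Lambda2' := intClass (Pi.single i 1)

/-- The relations of the quiver algebra hold in `Λ'₍₂₎ / 2 Λ'₍₂₎`. -/
def lambdaRep : QuiverRep (ModTwo Lambda2') where
  e3 := unitClass 0
  e4 := unitClass 1
  e5 := unitClass 2
  t1 := unitClass 3
  t2 := unitClass 4
  t3 := unitClass 5
  t4 := unitClass 6
  t7 := unitClass 7
  one := by
    have h : (1 : ModTwo Lambda2') = intClass ![1, 1, 1, 0, 0, 0, 0, 0, 0, 0] := by
      rw [← classOf_eq_intClass (d := coordOne), classOf, ofCoords_one, map_one]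
      intro i
      fin_cases i <;> simp [coordOne]
    rw [h, unitClass, unitClass, unitClass, ← map_add, ← map_add]
    exact intClass_eq (by decide)
  e3e3 := intClass_mul_eq (by decide)
  e4e4 := intClass_mul_eq (by decide)
  e5e5 := intClass_mul_eq (by decide)
  e3e4 := intClass_mul_eq_zero (by decide)
  e4e3 := intClass_mul_eq_zero (by decide)
  e3e5 := intClass_mul_eq_zero (by decide)
  e5e3 := intClass_mul_eq_zero (by decide)
  e4e5 := intClass_mul_eq_zero (by decide)
  e5e4 := intClass_mul_eq_zero (by decide)
  e5t1 := intClass_mul_eq (by decide)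
  t1e3 := intClass_mul_eq (by decide)
  e3t2 := intClass_mul_eq (by decide)
  t2e5 := intClass_mul_eq (by decide)
  e5t3 := intClass_mul_eq (by decide)
  t3e4 := intClass_mul_eq (by decide)
  e4t4 := intClass_mul_eq (by decide)
  t4e5 := intClass_mul_eq (by decide)
  e5t7 := intClass_mul_eq (by decide)
  t7e5 := intClass_mul_eq (by decide)
  t2t1 := intClass_mul_eq_zero (by decide)
  t2t3 := intClass_mul_eq_zero (by decide)
  t2t7 := intClass_mul_eq_zero (by decide)
  t4t1 := intClass_mul_eq_zero (by decide)
  t4t3 := intClass_mul_eq_zero (by decide)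
  t4t7 := intClass_mul_eq_zero (by decide)
  t7t1 := intClass_mul_eq_zero (by decide)
  t7t3 := intClass_mul_eq_zero (by decide)
  t7t7 := by
    rw [unitClass, unitClass, unitClass, intClass_mul, intClass_mul]
    exact intClass_eq (by decide)

/-- Only the last two cases have content. Over `ℤ₍₂₎` the product `τ₁τ₂` has coordinate `2` at `7`
and `-1` at `8`, while `τ₃τ₄` has `-12` at `7`, `6` at `8` and `1` at `9`; mod 2 a single basis
vector survives in each. -/
lemma lambdaRep_basis (i : Fin 10) : lambdaRep.basis i = unitClass i := by
  fin_cases i <;> first | rfl | exact intClass_mul_eq (by decide)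

lemma sum_smul_lambdaRep_basis (c : Fin 10 → ZMod 2) :
    ∑ i, c i • lambdaRep.basis i = intClass fun i => ((c i).val : ℤ) := by
  have h (r : ZMod 2) (x : ModTwo Lambda2') : r • x = (r.val : ℤ) • x := by
    conv_lhs => rw [← ZMod.natCast_zmod_val r]
    rw [Nat.cast_smul_eq_nsmul, natCast_zsmul]
  conv_rhs => rw [pi_eq_sum_univ' (fun i => ((c i).val : ℤ)), map_sum]
  refine Finset.sum_congr rfl fun i _ => ?_
  rw [lambdaRep_basis, h, unitClass, ← map_zsmul]

lemma lambdaRep_linearIndependent : LinearIndependent (ZMod 2) lambdaRep.basis := by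
  rw [Fintype.linearIndependent_iff]
  intro c hc i
  rw [sum_smul_lambdaRep_basis, intClass_apply, classOf_eq_zero_iff] at hc
  have h := hc i
  obtain h0 | h1 : c i = 0 ∨ c i = 1 := by
    generalize c i = r
    revert r
    decide
  · exact h0
  · rw [h1] at h
    refine absurd ?_ not_two_dvd_one
    simpa [ZMod.val_one] using h

lemma lambdaRep_span (x : ModTwo Lambda2') :
    x ∈ Submodule.span (ZMod 2) (Set.range lambdaRep.basis) := by
  classical
  obtain ⟨y, rfl⟩ := Ideal.Quotient.mk_surjective x
  obtain ⟨d, rfl⟩ := ofCoords_surjective y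
  rw [Submodule.mem_span_range_iff_exists_fun]
  refine ⟨fun i => if 2 ∣ d i then 0 else 1, ?_⟩
  rw [sum_smul_lambdaRep_basis]
  refine (classOf_eq_intClass fun i => ?_).symm
  by_cases h : 2 ∣ d i
  · simp [h]
  · simpa [h, ZMod.val_one] using (two_dvd_or (d i)).resolve_left h

/-- `Λ'₍₂₎ / 2 Λ'₍₂₎` is isomorphic to the quiver algebra. -/
def lambdaEquiv : QuiverAlgebra ≃ₐ[ZMod 2] ModTwo Lambda2' :=
  AlgEquiv.ofBijective lambdaRep.hom
    ⟨lambdaRep.hom_injective lambdaRep_linearIndependent,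
      lambdaRep.hom_surjective lambdaRep_span⟩

end BurnsideS3
end

noncomputable section
namespace BurnsideS3

namespace FinBiset

variable {G : Type} [Group G]

/-! ### Bisets as sets with an action of `G × G` -/

/-- The action `(g, k) x = g x k⁻¹` of `G × G` on a biset. -/
instance prodAction (M : FinBiset G) : MulAction (G × G) M.carrier where
  smul p x := p.1 • MulOpposite.op p.2⁻¹ • x
  one_smul x := by
    show (1 : G) • MulOpposite.op (1 : G)⁻¹ • x = x
    simp
  mul_smul p q x := by
    show (p.1 * q.1) • MulOpposite.op (p.2 * q.2)⁻¹ • x =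
      p.1 • MulOpposite.op p.2⁻¹ • q.1 • MulOpposite.op q.2⁻¹ • x
    rw [mul_inv_rev, MulOpposite.op_mul, mul_smul, mul_smul,
      smul_comm q.1 (MulOpposite.op p.2⁻¹)]

lemma prod_smul_def {M : FinBiset G} (p : G × G) (x : M.carrier) :
    p • x = p.1 • MulOpposite.op p.2⁻¹ • x := rfl

lemma left_smul_eq {M : FinBiset G} (g : G) (x : M.carrier) : g • x = (g, (1 : G)) • x := by
  simp [prod_smul_def]

lemma right_smul_eq {M : FinBiset G} (g : G) (x : M.carrier) :
    MulOpposite.op g • x = ((1 : G), g⁻¹) • x := by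
  simp [prod_smul_def]

/-- A bijection compatible with the actions of `G × G` is an isomorphism of bisets. -/
def Iso.ofEquiv {M N : FinBiset G} (e : M.carrier ≃ N.carrier)
    (h : ∀ (p : G × G) x, e (p • x) = p • e x) : Iso M N where
  toEquiv := e
  map_left g x := by rw [left_smul_eq, left_smul_eq, h]
  map_right g x := by rw [right_smul_eq, right_smul_eq, h]

lemma Iso.map_smul {M N : FinBiset G} (e : Iso M N) (p : G × G) (x : M.carrier) :
    e.toEquiv (p • x) = p • e.toEquiv x := by
  rw [prod_smul_def, prod_smul_def, e.map_left, e.map_right]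

/-- A finite set with an action of `G × G` as a biset. -/
def ofAction (X : Type) [Finite X] [MulAction (G × G) X] : FinBiset G :=
  letI left : MulAction G X := MulAction.compHom X (MonoidHom.inl G G)
  letI right : MulAction Gᵐᵒᵖ X :=
    { smul := fun k x => ((1 : G), k.unop⁻¹) • x
      one_smul := fun x => by
        show ((1 : G), (MulOpposite.unop (1 : Gᵐᵒᵖ))⁻¹) • x = x
        rw [MulOpposite.unop_one, inv_one]
        exact one_smul (G × G) x
      mul_smul := fun k l x => by
        show ((1 : G), (k * l).unop⁻¹) • x = ((1 : G), k.unop⁻¹) • ((1 : G), l.unop⁻¹) • x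
        rw [smul_smul, Prod.mk_mul_mk, one_mul, MulOpposite.unop_mul, mul_inv_rev] }
  { carrier := X
    comm := ⟨fun g k x => by
      show ((g, (1 : G)) : G × G) • ((1 : G), k.unop⁻¹) • x =
        ((1 : G), k.unop⁻¹) • ((g, (1 : G)) : G × G) • x
      rw [smul_smul, smul_smul]
      simp⟩ }

lemma ofAction_smul (X : Type) [Finite X] [MulAction (G × G) X] (p : G × G)
    (x : (ofAction (G := G) X).carrier) : p • x = (p • (show X from x) : X) := by
  show ((p.1, (1 : G)) : G × G) • ((1 : G), (p.2⁻¹)⁻¹) • (show X from x) = _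
  rw [smul_smul]
  simp

/-- The transitive biset `(G × G) / U`. -/
def coset [Finite G] (U : Subgroup (G × G)) : FinBiset G := ofAction ((G × G) ⧸ U)

/-- A coset as an element of the biset `(G × G) / U`. -/
def coset.mk [Finite G] (U : Subgroup (G × G)) (p : G × G) : (coset U).carrier :=
  (QuotientGroup.mk p : (G × G) ⧸ U)

section coset

variable [Finite G] {U : Subgroup (G × G)}

lemma coset.smul_mk (p q : G × G) : p • coset.mk U q = coset.mk U (p * q) :=
  ofAction_smul ((G × G) ⧸ U) p _

lemma coset.left_smul_mk (g : G) (q : G × G) : g • coset.mk U q = coset.mk U (g * q.1, q.2) := by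
  rw [left_smul_eq, coset.smul_mk]
  congr 1
  exact Prod.ext rfl (one_mul _)

lemma coset.right_smul_mk (g : G) (q : G × G) :
    MulOpposite.op g • coset.mk U q = coset.mk U (q.1, g⁻¹ * q.2) := by
  rw [right_smul_eq, coset.smul_mk]
  congr 1
  exact Prod.ext (one_mul _) rfl

lemma coset.mk_eq_iff {p q : G × G} : coset.mk U p = coset.mk U q ↔ p⁻¹ * q ∈ U :=
  QuotientGroup.eq

lemma coset.exists_mk (x : (coset U).carrier) : ∃ p, x = coset.mk U p := by
  obtain ⟨p, hp⟩ := QuotientGroup.mk_surjective (show (G × G) ⧸ U from x)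
  exact ⟨p, hp.symm⟩

lemma coset.stabilizer_mk_one : MulAction.stabilizer (G × G) (coset.mk U 1) = U := by
  ext p
  rw [MulAction.mem_stabilizer_iff, coset.smul_mk, eq_comm, coset.mk_eq_iff]
  simp

/-- Conjugate subgroups have isomorphic transitive bisets. -/
def cosetConj (c : G × G) (U : Subgroup (G × G)) :
    Iso (coset (U.map (MulAut.conj c).toMonoidHom)) (coset U) := by
  have h (p q : G × G) : coset.mk (U.map (MulAut.conj c).toMonoidHom) p = coset.mk _ q ↔
      coset.mk U (p * c) = coset.mk U (q * c) := by
    rw [coset.mk_eq_iff, coset.mk_eq_iff]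
    constructor
    · rintro ⟨u, hu, he⟩
      have he : c * u * c⁻¹ = p⁻¹ * q := he
      have : (p * c)⁻¹ * (q * c) = u := by
        rw [mul_inv_rev, mul_assoc, ← mul_assoc p⁻¹, ← he]
        group
      rwa [this]
    · intro hu
      refine ⟨_, hu, ?_⟩
      show c * ((p * c)⁻¹ * (q * c)) * c⁻¹ = p⁻¹ * q
      group
  -- Right translation by `c` carries cosets of `c U c⁻¹` to cosets of `U` and commutes with left
  -- multiplication.
  let f : (coset (U.map (MulAut.conj c).toMonoidHom)).carrier → (coset U).carrier :=
    Quotient.lift (fun p : G × G => coset.mk U (p * c))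
      (fun p q hpq => (h p q).1 (Quotient.sound hpq))
  have hf (p : G × G) : f (coset.mk _ p) = coset.mk U (p * c) := rfl
  refine Iso.ofEquiv (Equiv.ofBijective f ⟨?_, ?_⟩) ?_
  · intro x y hxy
    obtain ⟨p, rfl⟩ := coset.exists_mk x
    obtain ⟨q, rfl⟩ := coset.exists_mk y
    exact (h p q).2 hxy
  · intro y
    obtain ⟨q, rfl⟩ := coset.exists_mk y
    exact ⟨coset.mk _ (q * c⁻¹), by rw [hf, inv_mul_cancel_right]⟩
  · intro p x
    obtain ⟨q, rfl⟩ := coset.exists_mk x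
    show f (p • coset.mk _ q) = p • f (coset.mk _ q)
    rw [coset.smul_mk, hf, hf, coset.smul_mk, mul_assoc]

end coset

/-! ### Decomposition into transitive bisets -/

/-- A biset is the disjoint union of an invariant subset and its complement. -/
def sumIso (M : FinBiset G) (S T : SubMulAction (G × G) M.carrier)
    (h : ∀ x, x ∈ T ↔ x ∉ S) : Iso ((ofAction (G := G) S).disjointUnion (ofAction T)) M := by
  let f : ((ofAction (G := G) S).disjointUnion (ofAction T)).carrier → M.carrier :=
    Sum.elim (fun x : S => (x : M.carrier)) (fun x : T => (x : M.carrier))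
  refine Iso.ofEquiv (Equiv.ofBijective f ⟨?_, ?_⟩) ?_
  · rintro (x | x) (y | y) hxy
    · exact congrArg Sum.inl (Subtype.ext hxy)
    · exact absurd ((show (x : S).1 = (y : T).1 from hxy) ▸ (x : S).2) ((h _).1 (y : T).2)
    · exact absurd ((show (x : T).1 = (y : S).1 from hxy) ▸ (y : S).2) ((h _).1 (x : T).2)
    · exact congrArg Sum.inr (Subtype.ext hxy)
  · intro x
    by_cases hx : x ∈ S
    · exact ⟨Sum.inl (⟨x, hx⟩ : S), rfl⟩
    · exact ⟨Sum.inr (⟨x, (h x).2 hx⟩ : T), rfl⟩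
  · rintro p (x | x)
    · exact congrArg Subtype.val (ofAction_smul S p x)
    · exact congrArg Subtype.val (ofAction_smul T p x)

/-- The orbit of a point as an invariant subset. -/
def orbitSub (M : FinBiset G) (x : M.carrier) : SubMulAction (G × G) M.carrier where
  carrier := MulAction.orbit (G × G) x
  smul_mem' p _ hy := MulAction.mem_orbit_of_mem_orbit p hy

/-- The complement of the orbit of a point as an invariant subset. -/
def orbitCompl (M : FinBiset G) (x : M.carrier) : SubMulAction (G × G) M.carrier where
  carrier := (MulAction.orbit (G × G) x)ᶜ
  smul_mem' p y hy h := hy (by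
    have := MulAction.mem_orbit_of_mem_orbit p⁻¹ h
    rwa [inv_smul_smul] at this)

/-- An orbit is isomorphic to the cosets of the stabilizer. -/
def orbitIso [Finite G] (M : FinBiset G) (x : M.carrier) :
    Iso (coset (MulAction.stabilizer (G × G) x)) (ofAction (G := G) (orbitSub M x)) := by
  let f : (coset (MulAction.stabilizer (G × G) x)).carrier →
      (ofAction (G := G) (orbitSub M x)).carrier :=
    fun q => (⟨MulAction.ofQuotientStabilizer (G × G) x q,
      MulAction.ofQuotientStabilizer_mem_orbit (G × G) x q⟩ : orbitSub M x)
  refine Iso.ofEquiv (Equiv.ofBijective f ⟨?_, ?_⟩) ?_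
  · intro p q h
    exact MulAction.injective_ofQuotientStabilizer (G × G) x (congrArg Subtype.val h)
  · rintro ⟨_, p, rfl⟩
    exact ⟨coset.mk _ p, rfl⟩
  · intro p y
    obtain ⟨q, rfl⟩ := coset.exists_mk y
    refine Subtype.ext ?_
    show (f _).1 = _
    rw [coset.smul_mk, ofAction_smul]
    exact mul_smul p q x

/-- Every finite biset is built from transitive ones by disjoint unions. -/
theorem induction [Finite G] {P : FinBiset G → Prop} (iso : ∀ M N, Iso M N → P M → P N)
    (empty : ∀ M : FinBiset G, IsEmpty M.carrier → P M)
    (union : ∀ M N, P M → P N → P (M.disjointUnion N)) (trans : ∀ U, P (coset U))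
    (M : FinBiset G) : P M := by
  induction hn : Nat.card M.carrier using Nat.strong_induction_on generalizing M with
  | _ n ih =>
    rcases isEmpty_or_nonempty M.carrier with h | ⟨⟨x⟩⟩
    · exact empty M h
    · refine iso _ _ (sumIso M (orbitSub M x) (orbitCompl M x) fun _ => Iff.rfl)
        (union _ _ (iso _ _ (orbitIso M x) (trans _)) (ih _ ?_ _ rfl))
      -- The complement of the orbit of `x` misses `x`, so it has fewer points.
      rw [← hn]
      exact Finite.card_subtype_lt (p := fun y => y ∈ orbitCompl M x) (x := x)
        (fun h => h (MulAction.mem_orbit_self x))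

/-! ### The tensor product -/

lemma tmul_eq_iff {M N : FinBiset G} {m m' : M.carrier} {n n' : N.carrier} :
    (tmul m n : (tensor M N).carrier) = tmul m' n' ↔
      ∃ g : G, m' = MulOpposite.op g⁻¹ • m ∧ n' = g • n := by
  refine (Quotient.eq (r := tensorSetoid M N)).trans ?_
  exact exists_congr fun g => Prod.ext_iff

lemma prod_smul_tmul {M N : FinBiset G} (p : G × G) (m : M.carrier) (n : N.carrier) :
    p • (tmul m n : (tensor M N).carrier) = tmul (p.1 • m) (MulOpposite.op p.2⁻¹ • n) := by
  rw [prod_smul_def, op_smul_tmul, smul_tmul]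

/-- `(M ⊔ N) ×_G L ≅ M ×_G L ⊔ N ×_G L`. -/
def unionTensor (M N L : FinBiset G) :
    Iso (tensor (M.disjointUnion N) L) ((tensor M L).disjointUnion (tensor N L)) where
  toEquiv :=
    { toFun := tensorLift (M := M.disjointUnion N) (fun (x : M.carrier ⊕ N.carrier) l => match x with
        | Sum.inl m => Sum.inl (tmul m l : (tensor M L).carrier)
        | Sum.inr n => Sum.inr (tmul n l : (tensor N L).carrier)) (by
        rintro g (m | n) l
        · exact congrArg Sum.inl (tmul_balanced g m l)
        · exact congrArg Sum.inr (tmul_balanced g n l))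
      invFun := fun x : (tensor M L).carrier ⊕ (tensor N L).carrier => Sum.elim
        (tensorLift (fun m l => tmul (M := M.disjointUnion N) (Sum.inl m) l)
          (fun g m l => tmul_balanced (M := M.disjointUnion N) g (Sum.inl m) l))
        (tensorLift (fun n l => tmul (M := M.disjointUnion N) (Sum.inr n) l)
          (fun g n l => tmul_balanced (M := M.disjointUnion N) g (Sum.inr n) l)) x
      left_inv := fun x => by
        obtain ⟨m | n, l, rfl⟩ := exists_tmul x <;> rfl
      right_inv := by
        rintro (x | x)
        · obtain ⟨m, l, rfl⟩ := exists_tmul x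
          rfl
        · obtain ⟨n, l, rfl⟩ := exists_tmul x
          rfl }
  map_left := fun g x => by
    obtain ⟨m | n, l, rfl⟩ := exists_tmul x <;> rfl
  map_right := fun g x => by
    obtain ⟨m | n, l, rfl⟩ := exists_tmul x <;> rfl

/-- `L ×_G (M ⊔ N) ≅ L ×_G M ⊔ L ×_G N`. -/
def tensorUnion (L M N : FinBiset G) :
    Iso (tensor L (M.disjointUnion N)) ((tensor L M).disjointUnion (tensor L N)) where
  toEquiv :=
    { toFun := tensorLift (N := M.disjointUnion N) (fun l (x : M.carrier ⊕ N.carrier) => match x with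
        | Sum.inl m => Sum.inl (tmul l m : (tensor L M).carrier)
        | Sum.inr n => Sum.inr (tmul l n : (tensor L N).carrier)) (by
        rintro g l (m | n)
        · exact congrArg Sum.inl (tmul_balanced g l m)
        · exact congrArg Sum.inr (tmul_balanced g l n))
      invFun := fun x : (tensor L M).carrier ⊕ (tensor L N).carrier => Sum.elim
        (tensorLift (fun l m => tmul (N := M.disjointUnion N) l (Sum.inl m))
          (fun g l m => tmul_balanced (N := M.disjointUnion N) g l (Sum.inl m)))
        (tensorLift (fun l n => tmul (N := M.disjointUnion N) l (Sum.inr n))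
          (fun g l n => tmul_balanced (N := M.disjointUnion N) g l (Sum.inr n))) x
      left_inv := fun x => by
        obtain ⟨l, m | n, rfl⟩ := exists_tmul x <;> rfl
      right_inv := by
        rintro (x | x)
        · obtain ⟨l, m, rfl⟩ := exists_tmul x
          rfl
        · obtain ⟨l, n, rfl⟩ := exists_tmul x
          rfl }
  map_left := fun g x => by
    obtain ⟨l, m | n, rfl⟩ := exists_tmul x <;> rfl
  map_right := fun g x => by
    obtain ⟨l, m | n, rfl⟩ := exists_tmul x <;> rfl

end FinBiset

/-! ### Additive invariants of bisets -/

/-- A function on the subgroups of a group that is invariant under conjugation. -/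
structure ConjInvariant (Γ C : Type*) [Group Γ] where
  toFun : Subgroup Γ → C
  map_conj : ∀ c U, toFun (U.map (MulAut.conj c).toMonoidHom) = toFun U

namespace ConjInvariant

open FinBiset

variable {G : Type} [Group G] {C : Type*} (θ : ConjInvariant (G × G) C)

/-- The value at the stabilizers of the points in an orbit. -/
def onOrbit (M : FinBiset G) : MulAction.orbitRel.Quotient (G × G) M.carrier → C :=
  Quotient.lift (fun x => θ.toFun (MulAction.stabilizer (G × G) x)) (by
    rintro _ y ⟨p, rfl⟩
    dsimp only
    rw [MulAction.stabilizer_smul_eq_stabilizer_map_conj, θ.map_conj])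

variable [AddCommMonoid C]

/-- The sum of the values at the stabilizers over the orbits of a biset. -/
def orbitSum (M : FinBiset G) : C := ∑ᶠ ω, θ.onOrbit M ω

lemma orbitSum_eq_of_iso {M N : FinBiset G} (e : Iso M N) : θ.orbitSum M = θ.orbitSum N := by
  have h (x y : M.carrier) : MulAction.orbitRel (G × G) M.carrier x y ↔
      MulAction.orbitRel (G × G) N.carrier (e.toEquiv x) (e.toEquiv y) := by
    simp only [MulAction.orbitRel_apply, MulAction.mem_orbit_iff, ← e.map_smul,
      EmbeddingLike.apply_eq_iff_eq]
  let E : MulAction.orbitRel.Quotient (G × G) M.carrier ≃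
      MulAction.orbitRel.Quotient (G × G) N.carrier := Quotient.congr e.toEquiv h
  rw [orbitSum, orbitSum, ← finsum_comp_equiv E]
  refine finsum_congr fun ω => ?_
  obtain ⟨x, rfl⟩ := Quotient.exists_rep ω
  show θ.toFun _ = θ.toFun _
  congr 1
  ext p
  rw [MulAction.mem_stabilizer_iff, MulAction.mem_stabilizer_iff, ← e.map_smul,
    EmbeddingLike.apply_eq_iff_eq]

/-- Evaluates the sum over orbits on a transversal: `hs` says that the points `f i` meet every
orbit, `hi` that they meet it only once. -/
lemma orbitSum_eq_sum {M : FinBiset G} {ι : Type*} (s : Finset ι) (f : ι → M.carrier)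
    (hs : ∀ x, ∃ i ∈ s, x ∈ MulAction.orbit (G × G) (f i))
    (hi : ∀ i ∈ s, ∀ j ∈ s, f j ∈ MulAction.orbit (G × G) (f i) → i = j) :
    θ.orbitSum M = ∑ i ∈ s, θ.toFun (MulAction.stabilizer (G × G) (f i)) := by
  rw [← Finset.sum_coe_sort, ← finsum_eq_sum_of_fintype]
  refine (finsum_eq_of_bijective
    (fun i : s => (Quotient.mk _ (f i) : MulAction.orbitRel.Quotient (G × G) M.carrier))
    ⟨?_, ?_⟩ fun i => rfl).symm
  · intro i j h
    exact Subtype.ext (hi j j.2 i i.2 (MulAction.orbitRel_apply.1 (Quotient.exact h))).symm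
  · intro ω
    obtain ⟨x, rfl⟩ := Quotient.exists_rep ω
    obtain ⟨i, hi, hx⟩ := hs x
    exact ⟨⟨i, hi⟩, (Quotient.sound (MulAction.orbitRel_apply.2 hx)).symm⟩

lemma orbitSum_of_isEmpty {M : FinBiset G} (h : IsEmpty M.carrier) : θ.orbitSum M = 0 :=
  θ.orbitSum_eq_sum (∅ : Finset Empty) Empty.elim (fun x => h.elim x) (by simp)

lemma orbitSum_of_transitive {M : FinBiset G} (x : M.carrier)
    (h : ∀ y, y ∈ MulAction.orbit (G × G) x) :
    θ.orbitSum M = θ.toFun (MulAction.stabilizer (G × G) x) := by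
  rw [θ.orbitSum_eq_sum {()} (fun _ => x) (fun y => ⟨(), by simp, h y⟩) (by simp)]
  simp

lemma orbitSum_coset [Finite G] (U : Subgroup (G × G)) : θ.orbitSum (coset U) = θ.toFun U := by
  rw [θ.orbitSum_of_transitive (coset.mk U 1), coset.stabilizer_mk_one]
  intro y
  obtain ⟨p, rfl⟩ := coset.exists_mk y
  exact ⟨p, by show p • coset.mk U 1 = _; rw [coset.smul_mk, mul_one]⟩

/-- Transversals for the orbits of `M` and of `N` together form one for the union, and stabilizers
are unchanged under the inclusions. -/
lemma orbitSum_disjointUnion (M N : FinBiset G) :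
    θ.orbitSum (M.disjointUnion N) = θ.orbitSum M + θ.orbitSum N := by
  classical
  let i : MulAction.orbitRel.Quotient (G × G) M.carrier → M.carrier := Quotient.out
  let j : MulAction.orbitRel.Quotient (G × G) N.carrier → N.carrier := Quotient.out
  have hi (x : M.carrier) : x ∈ MulAction.orbit (G × G) (i (Quotient.mk (MulAction.orbitRel (G × G) M.carrier) x)) :=
    MulAction.orbitRel_apply.1
      ((MulAction.orbitRel (G × G) M.carrier).symm (Quotient.mk_out x))
  have hj (x : N.carrier) : x ∈ MulAction.orbit (G × G) (j (Quotient.mk (MulAction.orbitRel (G × G) N.carrier) x)) :=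
    MulAction.orbitRel_apply.1
      ((MulAction.orbitRel (G × G) N.carrier).symm (Quotient.mk_out x))
  let _ := Fintype.ofFinite (MulAction.orbitRel.Quotient (G × G) M.carrier)
  let _ := Fintype.ofFinite (MulAction.orbitRel.Quotient (G × G) N.carrier)
  have hii (a b) (h : i b ∈ MulAction.orbit (G × G) (i a)) : a = b := by
    have := Quotient.sound (s := MulAction.orbitRel (G × G) M.carrier)
      (MulAction.orbitRel_apply.2 h)
    rw [Quotient.out_eq, Quotient.out_eq] at this
    exact this.symm
  have hM := θ.orbitSum_eq_sum (M := M) Finset.univ i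
    (fun x => ⟨Quotient.mk _ x, Finset.mem_univ _, hi x⟩) (fun a _ b _ h => hii a b h)
  have hjj (a b) (h : j b ∈ MulAction.orbit (G × G) (j a)) : a = b := by
    have := Quotient.sound (s := MulAction.orbitRel (G × G) N.carrier)
      (MulAction.orbitRel_apply.2 h)
    rw [Quotient.out_eq, Quotient.out_eq] at this
    exact this.symm
  have hN := θ.orbitSum_eq_sum (M := N) Finset.univ j
    (fun x => ⟨Quotient.mk _ x, Finset.mem_univ _, hj x⟩) (fun a _ b _ h => hjj a b h)
  rw [hM, hN, θ.orbitSum_eq_sum (M := M.disjointUnion N) Finset.univ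
    (Sum.map i j : _ → M.carrier ⊕ N.carrier), Fintype.sum_sum_type]
  · refine congrArg₂ _ (Finset.sum_congr rfl fun a _ => congrArg θ.toFun ?_)
      (Finset.sum_congr rfl fun a _ => congrArg θ.toFun ?_)
    · ext p
      exact Sum.inl_injective.eq_iff
    · ext p
      exact Sum.inr_injective.eq_iff
  · rintro (x | x)
    · obtain ⟨p, hp⟩ := hi x
      exact ⟨Sum.inl (Quotient.mk _ x), Finset.mem_univ _, p, congrArg Sum.inl hp⟩
    · obtain ⟨p, hp⟩ := hj x
      exact ⟨Sum.inr (Quotient.mk _ x), Finset.mem_univ _, p, congrArg Sum.inr hp⟩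
  · rintro (a | a) - (b | b) - ⟨p, hp⟩
    · exact congrArg Sum.inl (hii a b ⟨p, Sum.inl_injective hp⟩)
    · exact absurd hp Sum.inl_ne_inr
    · exact absurd hp Sum.inr_ne_inl
    · exact congrArg Sum.inr (hjj a b ⟨p, Sum.inr_injective hp⟩)

/-- The invariant of a product of transitive bisets is a sum over double cosets. -/
lemma orbitSum_tensor_coset [Finite G] (U V : Subgroup (G × G)) (s : Finset G)
    (K : G → Subgroup (G × G))
    (hK : ∀ h ∈ s, ∀ p : G × G, p ∈ K h ↔ ∃ x, (p.1, x) ∈ U ∧ (h⁻¹ * x * h, p.2) ∈ V)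
    (hs : ∀ g, ∃ h ∈ s, ∃ u ∈ U, ∃ v ∈ V, u.2 * h = g * v.1)
    (hi : ∀ h ∈ s, ∀ h' ∈ s, (∃ u ∈ U, ∃ v ∈ V, u.2 * h = h' * v.1) → h = h') :
    θ.orbitSum (tensor (coset U) (coset V)) = ∑ h ∈ s, θ.toFun (K h) := by
  -- For `h = h'` this describes the stabilizer of a point; for different `h` and `h'` it decides
  -- whether two points lie in one orbit.
  have key (g k h h' : G) : ((g, k) : G × G) • (tmul (coset.mk U 1) (coset.mk V (h, 1)) :
      (tensor (coset U) (coset V)).carrier) = tmul (coset.mk U 1) (coset.mk V (h', 1)) ↔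
      ∃ x, (g, x) ∈ U ∧ (h'⁻¹ * x * h, k) ∈ V := by
    rw [prod_smul_tmul, tmul_eq_iff]
    refine exists_congr fun x => ?_
    simp only [coset.left_smul_mk, coset.right_smul_mk, inv_inv, coset.mk_eq_iff, Prod.fst_one,
      Prod.snd_one, mul_one, inv_one, one_mul, Prod.inv_mk, Prod.mk_mul_mk, mul_assoc]
  rw [θ.orbitSum_eq_sum s fun h => tmul (coset.mk U 1) (coset.mk V (h, 1))]
  · refine Finset.sum_congr rfl fun h hh => congrArg θ.toFun ?_
    ext ⟨g, k⟩
    rw [MulAction.mem_stabilizer_iff, key, hK h hh]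
  · intro x
    obtain ⟨m, n, rfl⟩ := exists_tmul x
    obtain ⟨⟨a, b⟩, rfl⟩ := coset.exists_mk m
    obtain ⟨⟨c, d⟩, rfl⟩ := coset.exists_mk n
    obtain ⟨h, hh, ⟨u₁, u₂⟩, hu, ⟨v₁, v₂⟩, hv, huv⟩ := hs (b⁻¹ * c)
    refine ⟨h, hh, (a * u₁, d * v₂), ?_⟩
    show ((a * u₁, d * v₂) : G × G) • (tmul (coset.mk U 1) (coset.mk V (h, 1)) :
      (tensor (coset U) (coset V)).carrier) = _
    rw [prod_smul_tmul, tmul_eq_iff]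
    dsimp only at huv ⊢
    -- Moving `b u₂` across the tensor sign normalises the left factor, and `u₂ h = b⁻¹ c v₁` then
    -- normalises the right one.
    refine ⟨b * u₂, ?_, ?_⟩
    · rw [coset.left_smul_mk, coset.right_smul_mk, eq_comm, coset.mk_eq_iff]
      have := U.inv_mem hu
      simpa [mul_assoc] using this
    · rw [coset.right_smul_mk, coset.left_smul_mk, eq_comm, coset.mk_eq_iff]
      have h2 : b * u₂ * h = c * v₁ := by rw [mul_assoc, huv]; group
      dsimp only
      rw [h2]
      have := V.inv_mem hv
      simpa [mul_assoc] using this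
  · rintro h hh h' hh' ⟨⟨g, k⟩, hp⟩
    obtain ⟨x, hx, hv⟩ := (key g k h h').1 hp
    exact hi h hh h' hh' ⟨(g, x), hx, _, hv, by group⟩

end ConjInvariant

end BurnsideS3
end

noncomputable section
namespace BurnsideS3

/-! ### Coding of `S₃ × S₃` by natural numbers -/

/-- The symmetric group on three letters. -/
abbrev S3 : Type := Equiv.Perm (Fin 3)

/-- The position of a permutation in the lexicographic order. -/
def code (g : S3) : ℕ := 2 * (g 0 : ℕ) + if g 1 < g 2 then 0 else 1

/-- Multiplication of permutations on codes, read off from a packed multiplication table. -/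
def mulCode (a b : ℕ) : ℕ := (6622109294235548718800921085576 >>> (3 * (6 * a + b))) % 8

/-- Inversion of permutations on codes. -/
def invCode (a : ℕ) : ℕ := (178312 >>> (3 * a)) % 8

/-- The coding is an isomorphism onto the packed table; all later searches run on natural numbers,
on which the kernel computes quickly. -/
lemma code_lt : ∀ g, code g < 6 := by decide +kernel
lemma code_injective : ∀ g h, code g = code h → g = h := by decide +kernel
lemma code_surjective : ∀ n < 6, ∃ g, code g = n := by decide +kernel
lemma code_mul : ∀ g h, code (g * h) = mulCode (code g) (code h) := by decide +kernel
lemma code_inv : ∀ g, code g⁻¹ = invCode (code g) := by decide +kernel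

/-- The code of a pair of permutations. -/
def pairCode (p : S3 × S3) : ℕ := 6 * code p.1 + code p.2

/-- Multiplication of pairs on codes. -/
def pairMul (a b : ℕ) : ℕ := 6 * mulCode (a / 6) (b / 6) + mulCode (a % 6) (b % 6)

/-- Inversion of pairs on codes. -/
def pairInv (a : ℕ) : ℕ := 6 * invCode (a / 6) + invCode (a % 6)

/-- Conjugation of `y` by `c` on codes. -/
def pairConj (c y : ℕ) : ℕ := pairMul (pairMul c y) (pairInv c)

lemma pairCode_div (p : S3 × S3) : pairCode p / 6 = code p.1 := by
  have := code_lt p.2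
  rw [pairCode]
  omega

lemma pairCode_mod (p : S3 × S3) : pairCode p % 6 = code p.2 := by
  have := code_lt p.2
  rw [pairCode]
  omega

lemma pairCode_lt (p : S3 × S3) : pairCode p < 36 := by
  have := code_lt p.1
  have := code_lt p.2
  rw [pairCode]
  omega

lemma pairCode_injective : Function.Injective pairCode := by
  intro p q h
  refine Prod.ext (code_injective _ _ ?_) (code_injective _ _ ?_)
  · rw [← pairCode_div, h, pairCode_div]
  · rw [← pairCode_mod, h, pairCode_mod]

lemma pairCode_surjective {n : ℕ} (hn : n < 36) : ∃ p, pairCode p = n := by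
  obtain ⟨g, hg⟩ := code_surjective (n / 6) (by omega)
  obtain ⟨h, hh⟩ := code_surjective (n % 6) (by omega)
  exact ⟨(g, h), by rw [pairCode, hg, hh]; omega⟩

lemma pairCode_mul (p q : S3 × S3) : pairCode (p * q) = pairMul (pairCode p) (pairCode q) := by
  rw [pairMul, pairCode_div, pairCode_div, pairCode_mod, pairCode_mod, ← code_mul, ← code_mul]
  rfl

lemma pairCode_inv (p : S3 × S3) : pairCode p⁻¹ = pairInv (pairCode p) := by
  rw [pairInv, pairCode_div, pairCode_mod, ← code_inv, ← code_inv]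
  rfl

lemma pairCode_one : pairCode 1 = 0 := by decide +kernel

lemma pairCode_conj (c y : S3 × S3) :
    pairCode (c * y * c⁻¹) = pairConj (pairCode c) (pairCode y) := by
  rw [pairConj, pairCode_mul, pairCode_mul, pairCode_inv]

/-- The sum of the values of a function at `0, …, n - 1`. -/
def sumTo (f : ℕ → ℕ) : ℕ → ℕ
  | 0 => 0
  | n + 1 => sumTo f n + f n

lemma sumTo_eq (f : ℕ → ℕ) (n : ℕ) : sumTo f n = ∑ i ∈ Finset.range n, f i := by
  induction n with
  | zero => rfl
  | succ n ih => rw [sumTo, ih, Finset.sum_range_succ]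

lemma sum_code {M : Type*} [AddCommMonoid M] (f : ℕ → M) :
    ∑ g : S3, f (code g) = ∑ n ∈ Finset.range 6, f n :=
  Finset.sum_bij (fun g _ => code g) (fun g _ => Finset.mem_range.2 (code_lt g))
    (fun g _ h _ e => code_injective g h e)
    (fun n hn => by
      obtain ⟨g, hg⟩ := code_surjective n (Finset.mem_range.1 hn)
      exact ⟨g, Finset.mem_univ _, hg⟩) fun _ _ => rfl

lemma sum_pairCode {M : Type*} [AddCommMonoid M] (f : ℕ → M) :
    ∑ p : S3 × S3, f (pairCode p) = ∑ n ∈ Finset.range 36, f n :=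
  Finset.sum_bij (fun g _ => pairCode g) (fun g _ => Finset.mem_range.2 (pairCode_lt g))
    (fun _ _ _ _ e => pairCode_injective e)
    (fun n hn => by
      obtain ⟨g, hg⟩ := pairCode_surjective (Finset.mem_range.1 hn)
      exact ⟨g, Finset.mem_univ _, hg⟩) fun _ _ => rfl

/-! ### Representatives of the conjugacy classes of subgroups of `S₃ × S₃` -/

/-- Generators of the representatives. -/
def gens (i : ℕ) : List ℕ :=
  [[], [1], [6], [7], [3], [18], [21], [1, 6], [1, 2], [19], [9], [3, 7], [6, 12], [7, 13],
    [7, 14], [3, 18], [1, 8], [6, 13], [1, 20], [6, 15], [3, 7, 13], [7, 15]].getD i []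

/-- The representatives as bit masks. -/
def mask (i : ℕ) : ℕ :=
  [1, 3, 65, 129, 25, 17039361, 270532609, 195, 63, 51118083, 1625, 2457, 1090785345, 2164531329,
    34630287489, 425984025, 4095, 3272356035, 1073479743, 27269633625, 41228331417,
    68719476735].getD i 0

/-- The representatives of the conjugacy classes of subgroups of `S₃ × S₃`. -/
def repSub (i : ℕ) : Subgroup (S3 × S3) := Subgroup.closure {p | pairCode p ∈ gens i}

/-- The mask with the bits `i < n` for which `f i` holds. -/
def bits (f : ℕ → Bool) : ℕ → ℕ
  | 0 => 0
  | n + 1 => cond (f n) (bits f n ||| 2 ^ n) (bits f n)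

lemma of_testBit_bits {f : ℕ → Bool} {n i : ℕ} (h : (bits f n).testBit i = true) :
    f i = true := by
  induction n with
  | zero => simp [bits] at h
  | succ n ih =>
    rw [bits] at h
    cases hf : f n with
    | false =>
      rw [hf] at h
      exact ih h
    | true =>
      rw [hf, cond_true, Nat.testBit_or, Bool.or_eq_true] at h
      rcases h with h | h
      · exact ih h
      · rw [Nat.testBit_two_pow, decide_eq_true_eq] at h
        rwa [← h]

/-- The union of a set of pairs and its right translate by `y`. -/
def addTranslate (S y : ℕ) : ℕ :=
  S ||| bits (fun z => S.testBit (pairMul z (pairInv y))) 36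

/-- Repeated translation of a set of pairs by a list of elements, until nothing is added. -/
def reach (l : List ℕ) : ℕ → ℕ → ℕ
  | 0, S => S
  | n + 1, S => cond (l.foldl addTranslate S == S) S (reach l n (l.foldl addTranslate S))

/-- Only this inclusion is needed: a computed set never leaves `W`. That the iteration reaches
enough elements is tested wherever it is used. -/
lemma addTranslate_subset {W : Subgroup (S3 × S3)} {S : ℕ} {q : S3 × S3} (hq : q ∈ W)
    (hS : ∀ p, S.testBit (pairCode p) = true → p ∈ W) (p : S3 × S3)
    (hp : (addTranslate S (pairCode q)).testBit (pairCode p) = true) : p ∈ W := by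
  rw [addTranslate, Nat.testBit_or, Bool.or_eq_true] at hp
  rcases hp with hp | hp
  · exact hS p hp
  · have h := of_testBit_bits hp
    rw [← pairCode_inv, ← pairCode_mul] at h
    exact (Subgroup.mul_mem_cancel_right W (W.inv_mem hq)).1 (hS _ h)

lemma foldl_addTranslate_subset {W : Subgroup (S3 × S3)} (l : List ℕ)
    (hl : ∀ y ∈ l, ∃ q ∈ W, pairCode q = y) {S : ℕ}
    (hS : ∀ p, S.testBit (pairCode p) = true → p ∈ W) (p : S3 × S3)
    (hp : (l.foldl addTranslate S).testBit (pairCode p) = true) : p ∈ W := by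
  induction l generalizing S with
  | nil => exact hS p hp
  | cons y l ih =>
    obtain ⟨q, hq, rfl⟩ := hl _ (List.mem_cons_self ..)
    exact ih (fun y hy => hl y (List.mem_cons_of_mem _ hy)) (addTranslate_subset hq hS) hp

lemma reach_subset {W : Subgroup (S3 × S3)} (l : List ℕ)
    (hl : ∀ y ∈ l, ∃ q ∈ W, pairCode q = y) (n : ℕ) {S : ℕ}
    (hS : ∀ p, S.testBit (pairCode p) = true → p ∈ W) (p : S3 × S3)
    (hp : (reach l n S).testBit (pairCode p) = true) : p ∈ W := by
  induction n generalizing S with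
  | zero => exact hS p hp
  | succ n ih =>
    rw [reach] at hp
    cases h : l.foldl addTranslate S == S with
    | true =>
      rw [h] at hp
      exact hS p hp
    | false =>
      rw [h] at hp
      exact ih (foldl_addTranslate_subset l hl hS) hp

lemma gens_lt : ∀ i < 22, ∀ y ∈ gens i, y < 36 := by decide +kernel

/-- The mask is closed under multiplication and inversion, and contains the generators. -/
def maskCheck (i : ℕ) : Bool :=
  ((mask i).testBit 0 && (gens i).all fun y => (mask i).testBit y) &&
    (List.range 36).all fun x => !(mask i).testBit x ||
      ((mask i).testBit (pairInv x) &&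
        (List.range 36).all fun y => !(mask i).testBit y || (mask i).testBit (pairMul x y))

lemma maskCheck_eq : (List.range 22).all maskCheck = true := by decide +kernel

lemma reach_gens : ∀ i < 22, reach (gens i) 5 1 = mask i := by decide +kernel

/-- The mask is a subgroup containing the generators, hence contains the closure; conversely,
translating the identity by the generators already produces the whole mask. -/
lemma mem_repSub {i : ℕ} (hi : i < 22) (p : S3 × S3) :
    p ∈ repSub i ↔ (mask i).testBit (pairCode p) = true := by
  constructor
  · have h := List.all_eq_true.1 maskCheck_eq i (List.mem_range.2 hi)
    simp only [maskCheck, Bool.and_eq_true, Bool.or_eq_true, Bool.not_eq_true', List.all_eq_true,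
      List.mem_range] at h
    obtain ⟨⟨h1, hg⟩, hm⟩ := h
    intro hp
    induction hp using Subgroup.closure_induction with
    | mem p hp => exact hg _ hp
    | one => rwa [pairCode_one]
    | mul p q _ _ hp hq =>
      rw [pairCode_mul]
      have := ((hm _ (pairCode_lt p)).resolve_left (by simp [hp])).2 _ (pairCode_lt q)
      exact this.resolve_left (by simp [hq])
    | inv p _ hp =>
      rw [pairCode_inv]
      exact ((hm _ (pairCode_lt p)).resolve_left (by simp [hp])).1
  · intro hp
    rw [← reach_gens i hi] at hp
    -- The starting mask `1` has bit `0` alone, the code of the identity.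
    refine reach_subset (gens i) (fun y hy => ?_) 5 (S := 1) (fun p hp => ?_) p hp
    · obtain ⟨q, rfl⟩ := pairCode_surjective (gens_lt i hi y hy)
      exact ⟨q, Subgroup.subset_closure hy, rfl⟩
    · have : pairCode p = 0 := by
        rw [← pow_zero 2, Nat.testBit_two_pow, decide_eq_true_eq] at hp
        exact hp.symm
      rw [← pairCode_one] at this
      rw [pairCode_injective this]
      exact one_mem _

/-! ### A numerical invariant of conjugacy classes -/

/-- A class function on `S₃ × S₃`. -/
def classWeight (n : ℕ) : ℕ :=
  [1, 1, 1, 3, 3, 1, 3, 4, 4, 1, 1, 4, 3, 4, 4, 1, 1, 4, 5, 1, 1, 1, 1, 1, 5, 1, 1, 1, 1, 1, 3, 4,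
    4, 1, 1, 4].getD n 0

/-- The number of the representative with a given weight. -/
def classIdx (w : ℕ) : ℕ :=
  [1, 2, 4, 5, 7, 11, 3, 9, 10, 14, 12, 19, 20, 23, 15, 21, 27, 35, 30, 36, 57, 81].idxOf w

/-- The weight of a set of pairs. -/
def setWeight (f : ℕ → Bool) : ℕ := sumTo (fun n => cond (f n) (classWeight n) 0) 36

open Classical in
/-- The weight of a subgroup. -/
def weight (U : Subgroup (S3 × S3)) : ℕ :=
  ∑ p : S3 × S3, if p ∈ U then classWeight (pairCode p) else 0

lemma weight_eq {U : Subgroup (S3 × S3)} {f : ℕ → Bool}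
    (h : ∀ p, p ∈ U ↔ f (pairCode p) = true) : weight U = setWeight f := by
  rw [setWeight, sumTo_eq, ← sum_pairCode, weight]
  refine Finset.sum_congr rfl fun p _ => ?_
  by_cases hp : p ∈ U
  · rw [if_pos hp, (h p).1 hp, cond_true]
  · rw [if_neg hp, Bool.eq_false_iff.2 (mt (h p).2 hp), cond_false]

lemma classWeight_conj : ∀ c < 36, ∀ y < 36, classWeight (pairConj c y) = classWeight y := by
  decide +kernel

lemma weight_map_conj (c : S3 × S3) (U : Subgroup (S3 × S3)) :
    weight (U.map (MulAut.conj c).toMonoidHom) = weight U := by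
  rw [weight, weight, ← Equiv.sum_comp (MulAut.conj c).toEquiv]
  refine Finset.sum_congr rfl fun p _ => ?_
  have h : (MulAut.conj c).toEquiv p ∈ U.map (MulAut.conj c).toMonoidHom ↔ p ∈ U :=
    Subgroup.mem_map_iff_mem (MulAut.conj c).injective
  have hw : classWeight (pairCode ((MulAut.conj c).toEquiv p)) = classWeight (pairCode p) := by
    show classWeight (pairCode (c * p * c⁻¹)) = _
    rw [pairCode_conj, classWeight_conj _ (pairCode_lt c) _ (pairCode_lt p)]
  rw [hw]
  by_cases hp : p ∈ U
  · rw [if_pos hp, if_pos (h.2 hp)]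
  · rw [if_neg hp, if_neg (mt h.1 hp)]

/-- The class function has pairwise different sums over the 22 representatives, so the weight of a
subgroup determines which of them it is conjugate to. -/
lemma classIdx_mask : ∀ i < 22, classIdx (setWeight (mask i).testBit) = i := by decide +kernel

lemma classIdx_repSub {i : ℕ} (hi : i < 22) : classIdx (weight (repSub i)) = i := by
  rw [weight_eq (mem_repSub hi), classIdx_mask i hi]

/-! ### The classification of the subgroups -/

/-- The subgroup generated by `S` of the class `j` is conjugate to the representative. -/
def joinCheckAux (l : List ℕ) (S j : ℕ) : Bool :=
  decide (j < 22) && (List.range 36).any fun c =>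
    (gens j).all (fun y => S.testBit (pairConj c y)) &&
      l.all fun y => (mask j).testBit (pairConj (pairInv c) y)

/-- Adjoining an element to a representative gives a conjugate of a representative. -/
def joinCheck (i g : ℕ) : Bool :=
  joinCheckAux (g :: gens i) (reach (g :: gens i) 5 (mask i))
    (classIdx (setWeight (reach (g :: gens i) 5 (mask i)).testBit))

set_option maxRecDepth 100000 in
lemma joinCheck_eq : ((List.range 22).all fun i => (List.range 36).all (joinCheck i)) = true := by
  decide +kernel

end BurnsideS3
end

noncomputable section
namespace BurnsideS3

/-! ### Homomorphisms out of the double Burnside algebra -/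

/-- The diagonal subgroup. -/
def diagonalSubgroup (G : Type) [Group G] : Subgroup (G × G) :=
  (MonoidHom.prod (MonoidHom.id G) (MonoidHom.id G)).range

lemma mem_diagonalSubgroup {G : Type} [Group G] {p : G × G} :
    p ∈ diagonalSubgroup G ↔ p.1 = p.2 := by
  constructor
  · rintro ⟨g, rfl⟩
    rfl
  · exact fun h => ⟨p.1, Prod.ext rfl h⟩

namespace ConjInvariant

open FinBiset

variable {G : Type} [Group G] [Finite G] {C : Type*} [Ring C] (θ : ConjInvariant (G × G) C)

/-- Both sides are biadditive for disjoint unions, so decomposing each factor into orbits reduces to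
transitive bisets. -/
lemma orbitSum_tensor
    (h : ∀ U V, θ.orbitSum (tensor (coset U) (coset V)) = θ.toFun U * θ.toFun V)
    (M N : FinBiset G) : θ.orbitSum (tensor M N) = θ.orbitSum M * θ.orbitSum N := by
  induction M using FinBiset.induction generalizing N with
  | iso M M' e ih =>
    rw [← θ.orbitSum_eq_of_iso (tensorCongr e ⟨Equiv.refl N.carrier, fun _ _ => rfl,
      fun _ _ => rfl⟩), ← θ.orbitSum_eq_of_iso e, ih]
  | empty M hM =>
    rw [θ.orbitSum_of_isEmpty hM, zero_mul]
    refine θ.orbitSum_of_isEmpty ⟨fun x => ?_⟩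
    obtain ⟨m, -, -⟩ := exists_tmul x
    exact hM.elim m
  | union M M' ih ih' =>
    rw [θ.orbitSum_eq_of_iso (unionTensor M M' N), θ.orbitSum_disjointUnion,
      θ.orbitSum_disjointUnion, ih, ih', add_mul]
  | trans U =>
    induction N using FinBiset.induction with
    | iso N N' e ih =>
      rw [← θ.orbitSum_eq_of_iso (tensorCongr ⟨Equiv.refl (coset U).carrier, fun _ _ => rfl,
        fun _ _ => rfl⟩ e), ← θ.orbitSum_eq_of_iso e, ih]
    | empty N hN =>
      rw [θ.orbitSum_of_isEmpty hN, mul_zero]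
      refine θ.orbitSum_of_isEmpty ⟨fun x => ?_⟩
      obtain ⟨-, n, -⟩ := exists_tmul x
      exact hN.elim n
    | union N N' ih ih' =>
      rw [θ.orbitSum_eq_of_iso (tensorUnion (coset U) N N'), θ.orbitSum_disjointUnion,
        θ.orbitSum_disjointUnion, ih, ih', mul_add]
    | trans V => rw [h, θ.orbitSum_coset, θ.orbitSum_coset]

/-- `G` is a single orbit under `G × G`, and the stabilizer of `1` is the diagonal. -/
lemma orbitSum_regular : θ.orbitSum (regular G) = θ.toFun (diagonalSubgroup G) := by
  have key (p : G × G) (g : G) :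
      p • (show (regular G).carrier from g) = (show (regular G).carrier from p.1 * g * p.2⁻¹) :=
    (mul_assoc p.1 g p.2⁻¹).symm
  rw [θ.orbitSum_of_transitive (show (regular G).carrier from (1 : G))]
  · congr 1
    ext p
    rw [MulAction.mem_stabilizer_iff, key, mem_diagonalSubgroup, mul_one]
    exact mul_inv_eq_one (G := G)
  · intro g
    refine ⟨((show G from g), 1), ?_⟩
    show ((show G from g), (1 : G)) • (show (regular G).carrier from (1 : G)) = g
    rw [key]
    show (show G from g) * (1 : G) * (1 : G)⁻¹ = (show G from g)
    rw [inv_one, mul_one, mul_one]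

variable {R : Type} [CommRing R] [Algebra R C]

/-- A multiplicative invariant of bisets as a homomorphism on the double Burnside algebra. -/
def burnsideHom (h1 : θ.toFun (diagonalSubgroup G) = 1)
    (h : ∀ U V, θ.orbitSum (tensor (coset U) (coset V)) = θ.toFun U * θ.toFun V) :
    DoubleBurnside R G →ₐ[R] C :=
  RingQuot.liftAlgHom R ⟨MonoidAlgebra.lift R C (BisetClass G)
    { toFun := Quotient.lift θ.orbitSum fun _ _ ⟨e⟩ => θ.orbitSum_eq_of_iso e
      map_one' := θ.orbitSum_regular.trans h1
      map_mul' := by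
        rintro ⟨M⟩ ⟨N⟩
        exact θ.orbitSum_tensor h M N }, by
    rintro _ _ ⟨M, N⟩
    rw [map_add, MonoidAlgebra.lift_of, MonoidAlgebra.lift_of, MonoidAlgebra.lift_of]
    exact θ.orbitSum_disjointUnion M N⟩

end ConjInvariant

section Class

open FinBiset

variable (R : Type) {G : Type} [CommRing R] [Group G] [Finite G]

/-- The class of a biset in the double Burnside algebra. -/
def burnsideClass (M : FinBiset G) : DoubleBurnside R G :=
  RingQuot.mkAlgHom R (BurnsideRel R G) (MonoidAlgebra.of R _ (BisetClass.mk M))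

lemma burnsideClass_eq_of_iso {M N : FinBiset G} (e : Iso M N) :
    burnsideClass R M = burnsideClass R N := by
  have : BisetClass.mk M = BisetClass.mk N := Quotient.sound ⟨e⟩
  rw [burnsideClass, this]
  rfl

lemma burnsideClass_disjointUnion (M N : FinBiset G) :
    burnsideClass R (M.disjointUnion N) = burnsideClass R M + burnsideClass R N := by
  rw [burnsideClass, RingQuot.mkAlgHom_rel R (BurnsideRel.disjointUnion M N), map_add]
  rfl

/-- The union of two empty bisets is empty, so the class equals twice itself. -/
lemma burnsideClass_of_isEmpty {M : FinBiset G} (h : IsEmpty M.carrier) :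
    burnsideClass R M = 0 := by
  have : IsEmpty (M.disjointUnion M).carrier :=
    inferInstanceAs (IsEmpty (M.carrier ⊕ M.carrier))
  have e := burnsideClass_eq_of_iso R (M := M.disjointUnion M) (N := M)
    ⟨Equiv.equivOfIsEmpty _ _, fun _ x => this.elim x, fun _ x => this.elim x⟩
  rwa [burnsideClass_disjointUnion, add_eq_right] at e

lemma burnsideHom_burnsideClass {C : Type*} [Ring C] [Algebra R C] (θ : ConjInvariant (G × G) C)
    (h1 : θ.toFun (diagonalSubgroup G) = 1)
    (h : ∀ U V, θ.orbitSum (tensor (coset U) (coset V)) = θ.toFun U * θ.toFun V)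
    (M : FinBiset G) : θ.burnsideHom h1 h (burnsideClass R M) = θ.orbitSum M := by
  rw [burnsideClass, ConjInvariant.burnsideHom, RingQuot.liftAlgHom_mkAlgHom_apply,
    MonoidAlgebra.lift_of]
  rfl

/-- The double Burnside algebra is spanned by the classes of the transitive bisets. -/
lemma mem_span_burnsideClass {ι : Type*} (U : ι → Subgroup (G × G))
    (hU : ∀ V : Subgroup (G × G), ∃ i c, V = (U i).map (MulAut.conj c).toMonoidHom)
    (x : DoubleBurnside R G) :
    x ∈ Submodule.span R (Set.range fun i => burnsideClass R (coset (U i))) := by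
  obtain ⟨a, rfl⟩ := RingQuot.mkAlgHom_surjective R (BurnsideRel R G) x
  induction a using MonoidAlgebra.induction_on with
  | of m =>
    obtain ⟨M⟩ := m
    show burnsideClass R M ∈ _
    induction M using FinBiset.induction with
    | iso M N e ih => rwa [← burnsideClass_eq_of_iso R e]
    | empty M h => rw [burnsideClass_of_isEmpty R h]; exact zero_mem _
    | union M N hM hN => rw [burnsideClass_disjointUnion]; exact add_mem hM hN
    | trans V =>
      obtain ⟨i, c, rfl⟩ := hU V
      rw [burnsideClass_eq_of_iso R (cosetConj c (U i))]
      exact Submodule.subset_span ⟨i, rfl⟩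
  | add a b ha hb => rw [map_add]; exact add_mem ha hb
  | smul r a ha => rw [map_smul]; exact Submodule.smul_mem _ _ ha

end Class

/-- The subgroup `U * ʰV` of the pairs `(g, k)` with `(g, x) ∈ U` and `(h⁻¹ x h, k) ∈ V`
for some `x`. -/
def mackeySubgroup {G : Type} [Group G] (U V : Subgroup (G × G)) (h : G) : Subgroup (G × G) where
  carrier := {p | ∃ x, (p.1, x) ∈ U ∧ (h⁻¹ * x * h, p.2) ∈ V}
  one_mem' := ⟨1, U.one_mem, by
    have : (h⁻¹ * 1 * h, (1 : G)) = 1 := Prod.ext (by simp) rfl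
    show (h⁻¹ * 1 * h, (1 : G)) ∈ V
    rw [this]
    exact V.one_mem⟩
  mul_mem' := by
    rintro p q ⟨x, hx, hx'⟩ ⟨y, hy, hy'⟩
    refine ⟨x * y, U.mul_mem hx hy, ?_⟩
    convert V.mul_mem hx' hy' using 1
    exact Prod.ext (by simp [mul_assoc]) rfl
  inv_mem' := by
    rintro p ⟨x, hx, hx'⟩
    refine ⟨x⁻¹, U.inv_mem hx, ?_⟩
    convert V.inv_mem hx' using 1
    exact Prod.ext (by simp [mul_assoc]) rfl

/-! ### The classification of the subgroups of `S₃ × S₃` -/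

/-- This is the inductive step of the classification: adjoining one element to a representative
never leads outside the 22 classes. -/
lemma exists_map_conj_sup {i : ℕ} (hi : i < 22) (q : S3 × S3) :
    ∃ j < 22, ∃ c : S3 × S3, Subgroup.closure {q} ⊔ repSub i =
      (repSub j).map (MulAut.conj c).toMonoidHom := by
  have h := List.all_eq_true.1 joinCheck_eq i (List.mem_range.2 hi)
  have h := List.all_eq_true.1 h (pairCode q) (List.mem_range.2 (pairCode_lt q))
  rw [joinCheck] at h
  -- The weight only suggests the index `j`; the test then certifies it, so how it was found is
  -- irrelevant.
  generalize classIdx _ = j at h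
  simp only [joinCheckAux, Bool.and_eq_true, decide_eq_true_eq, List.any_eq_true, List.mem_range,
    List.all_eq_true] at h
  obtain ⟨hj, n, hn, h1, h2⟩ := h
  obtain ⟨c, rfl⟩ := pairCode_surjective hn
  refine ⟨j, hj, c, le_antisymm ?_ ?_⟩
  · have key (p : S3 × S3) (hp : pairCode p ∈ pairCode q :: gens i) :
        p ∈ (repSub j).map (MulAut.conj c).toMonoidHom := by
      refine ⟨c⁻¹ * p * c, ?_, ?_⟩
      · have := h2 _ hp
        rw [← pairCode_inv, ← pairCode_conj, inv_inv] at this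
        exact (mem_repSub hj _).2 this
      · show c * (c⁻¹ * p * c) * c⁻¹ = p
        group
    refine sup_le ?_ ?_
    · rw [Subgroup.closure_le, Set.singleton_subset_iff]
      exact key q (List.mem_cons_self ..)
    · rw [repSub, Subgroup.closure_le]
      exact fun p hp => key p (List.mem_cons_of_mem _ hp)
  -- For the reverse inclusion, the conjugated generators of the representative `j` lie in the set
  -- computed from `q` and `repSub i`, which stays inside the join.
  · rw [Subgroup.map_le_iff_le_comap, repSub, Subgroup.closure_le]
    intro y hy
    have := h1 _ hy
    rw [← pairCode_conj] at this
    show c * y * c⁻¹ ∈ Subgroup.closure {q} ⊔ repSub i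
    refine reach_subset _ (fun z hz => ?_) _ (fun p hp => ?_) _ this
    · rcases List.mem_cons.1 hz with rfl | hz
      · exact ⟨q, Subgroup.mem_sup_left (Subgroup.subset_closure rfl), rfl⟩
      · obtain ⟨p, rfl⟩ := pairCode_surjective (gens_lt i hi z hz)
        exact ⟨p, Subgroup.mem_sup_right (Subgroup.subset_closure hz), rfl⟩
    · exact Subgroup.mem_sup_right ((mem_repSub hi p).2 hp)

lemma map_conj_map_conj {Γ : Type*} [Group Γ] (c d : Γ) (U : Subgroup Γ) :
    (U.map (MulAut.conj d).toMonoidHom).map (MulAut.conj c).toMonoidHom =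
      U.map (MulAut.conj (c * d)).toMonoidHom := by
  rw [Subgroup.map_map]
  congr 1
  ext x
  simp [mul_assoc]

/-- Every subgroup of `S₃ × S₃` is conjugate to one of the representatives. -/
theorem exists_eq_map_conj (U : Subgroup (S3 × S3)) :
    ∃ (i : Fin 22) (c : S3 × S3), U = (repSub i).map (MulAut.conj c).toMonoidHom := by
  suffices h : ∀ s : Set (S3 × S3), s.Finite → ∃ j < 22, ∃ c : S3 × S3,
      Subgroup.closure s = (repSub j).map (MulAut.conj c).toMonoidHom by
    obtain ⟨j, hj, c, hc⟩ := h U (Set.toFinite _)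
    exact ⟨⟨j, hj⟩, c, by rw [← hc, Subgroup.closure_eq]⟩
  intro s hs
  induction s, hs using Set.Finite.induction_on with
  | empty =>
    refine ⟨0, by norm_num, 1, ?_⟩
    have : repSub 0 = ⊥ := by
      rw [repSub, Subgroup.closure_eq_bot_iff]
      intro p hp
      simp [gens] at hp
    rw [this, Subgroup.closure_empty, Subgroup.map_bot]
  | @insert a s _ _ ih =>
    obtain ⟨i, hi, c, hc⟩ := ih
    -- The induction hypothesis gives a conjugate by `c`, so the new element is first conjugated
    -- back by `c⁻¹`.
    obtain ⟨j, hj, d, hd⟩ := exists_map_conj_sup hi (c⁻¹ * a * c)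
    refine ⟨j, hj, c * d, ?_⟩
    rw [← map_conj_map_conj, ← hd, Subgroup.map_sup, ← hc, Set.insert_eq, Subgroup.closure_union,
      MonoidHom.map_closure, Set.image_singleton]
    congr 3
    show a = c * (c⁻¹ * a * c) * c⁻¹
    group

end BurnsideS3
end

noncomputable section
namespace BurnsideS3

/-! ### Matrices over `𝔽₂` as bit masks -/

/-- A bit as an element of `𝔽₂`. -/
def bit2 (b : Bool) : ZMod 2 := cond b 1 0

lemma bit2_xor (a b : Bool) : bit2 (a ^^ b) = bit2 a + bit2 b := by
  cases a <;> cases b <;> decide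

lemma bit2_and (a b : Bool) : bit2 (a && b) = bit2 a * bit2 b := by
  cases a <;> cases b <;> decide

/-- The `m × n`-matrix whose entry at `(i, j)` is the bit `8 i + j` of `a`. -/
def bitMat (m n a : ℕ) : Matrix (Fin m) (Fin n) (ZMod 2) :=
  Matrix.of fun i j => bit2 (a.testBit (8 * i + j))

lemma bitMat_apply {m n a : ℕ} (i : Fin m) (j : Fin n) :
    bitMat m n a i j = bit2 (a.testBit (8 * i + j)) := rfl

lemma bitMat_zero (m n : ℕ) : bitMat m n 0 = 0 := by
  ext i j
  rw [bitMat_apply, Nat.zero_testBit]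
  rfl

lemma bitMat_xor (m n a b : ℕ) : bitMat m n (a ^^^ b) = bitMat m n a + bitMat m n b := by
  ext i j
  rw [Matrix.add_apply, bitMat_apply, bitMat_apply, bitMat_apply, Nat.testBit_xor, bit2_xor]

lemma bitMat_cond (m n a : ℕ) (b : Bool) : bitMat m n (cond b a 0) = bit2 b • bitMat m n a := by
  cases b
  · rw [cond_false, bitMat_zero, bit2, cond_false, zero_smul]
  · rw [cond_true, bit2, cond_true, one_smul]

/-- The bitwise sum of the values of a function at `0, …, n - 1`. -/
def xorTo (f : ℕ → ℕ) : ℕ → ℕ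
  | 0 => 0
  | n + 1 => xorTo f n ^^^ f n

lemma bitMat_xorTo (m n : ℕ) (f : ℕ → ℕ) (l : ℕ) :
    bitMat m n (xorTo f l) = ∑ k ∈ Finset.range l, bitMat m n (f k) := by
  induction l with
  | zero => exact bitMat_zero m n
  | succ l ih => rw [xorTo, bitMat_xor, ih, Finset.sum_range_succ]

lemma bit2_testBit_xorTo (f : ℕ → ℕ) (n l : ℕ) :
    bit2 ((xorTo f n).testBit l) = ∑ k ∈ Finset.range n, bit2 ((f k).testBit l) := by
  induction n with
  | zero => rw [xorTo, Nat.zero_testBit]; rfl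
  | succ n ih => rw [xorTo, Nat.testBit_xor, bit2_xor, ih, Finset.sum_range_succ]

/-- Rows are stored with stride 8 whatever the size of the matrix; reduction mod `2 ^ n` discards
the bits beyond the last column. -/
lemma testBit_eq_of_row {a b i j n : ℕ} (hj : j < n)
    (h : a % 2 ^ n = (b >>> (8 * i)) % 2 ^ n) : b.testBit (8 * i + j) = a.testBit j := by
  have := congrArg (fun x => x.testBit j) h
  simpa [Nat.testBit_mod_two_pow, hj, Nat.testBit_shiftRight] using this.symm

lemma bitMat_congr {m n a b : ℕ}
    (h : ∀ i < m, (a >>> (8 * i)) % 2 ^ n = (b >>> (8 * i)) % 2 ^ n) :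
    bitMat m n a = bitMat m n b := by
  ext i j
  rw [bitMat_apply, bitMat_apply, testBit_eq_of_row j.2 (h i i.2), Nat.testBit_shiftRight]

/-- The row `i` of a product of matrices. -/
def rowMul (l a b i : ℕ) : ℕ := xorTo (fun k => cond (a.testBit (8 * i + k)) (b >>> (8 * k)) 0) l

/-- The matrix `c` is the product of the matrices `a` and `b`. -/
def mulCheck (m l n a b c : ℕ) : Bool :=
  (List.range m).all fun i => rowMul l a b i % 2 ^ n == (c >>> (8 * i)) % 2 ^ n

lemma bitMat_mul {m l n a b c : ℕ} (h : mulCheck m l n a b c = true) :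
    bitMat m l a * bitMat l n b = bitMat m n c := by
  ext i j
  have hi := beq_iff_eq.1 (List.all_eq_true.1 h i (List.mem_range.2 i.2))
  rw [Matrix.mul_apply, bitMat_apply, testBit_eq_of_row j.2 hi, rowMul, bit2_testBit_xorTo,
    Finset.sum_range]
  refine Finset.sum_congr rfl fun k _ => ?_
  rw [bitMat_apply, bitMat_apply, ← bit2_and]
  cases a.testBit (8 * i + k)
  · rw [cond_false, Nat.zero_testBit, Bool.false_and]
  · rw [cond_true, Nat.testBit_shiftRight, Bool.true_and]

/-! ### The mod 2 representation of the double Burnside algebra -/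

/-- The matrices attached to the representatives of the classes of subgroups. -/
def thetaCode (i : ℕ) : ℕ :=
  [1024, 4864, 262144, 402921216, 5120, 1125899906843648, 1162227771024348176, 1245184, 5632,
    5348024557507328, 1310720, 135528960, 262148, 1735856181777536772, 9241421688590303745,
    5629499534218240, 1441792, 1245203, 6192449487640064, 1310740, 577023702392373780,
    1441814].getD i 0

/-- The matrix of a subgroup as a conjugation invariant. -/
def theta : ConjInvariant (S3 × S3) (Matrix (Fin 8) (Fin 8) (ZMod 2)) where
  toFun U := bitMat 8 8 (thetaCode (classIdx (weight U)))
  map_conj c U := by rw [weight_map_conj]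

lemma theta_repSub {i : ℕ} (hi : i < 22) : theta.toFun (repSub i) = bitMat 8 8 (thetaCode i) := by
  show bitMat 8 8 (thetaCode (classIdx (weight (repSub i)))) = _
  rw [classIdx_repSub hi]

lemma bitMat_one : bitMat 8 8 (thetaCode 14) = 1 := by
  ext i j
  rw [bitMat_apply, Matrix.one_apply]
  revert i j
  decide +kernel

/-- The weight identifies the diagonal as class 14, and the matrix attached to this class is the
identity. -/
lemma theta_diagonal : theta.toFun (diagonalSubgroup S3) = 1 := by
  have h : ∀ p, p ∈ diagonalSubgroup S3 ↔
      (fun n => n / 6 == n % 6) (pairCode p) = true := by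
    intro p
    rw [mem_diagonalSubgroup, beq_iff_eq, pairCode_div, pairCode_mod]
    exact ⟨fun h => congrArg code h, code_injective _ _⟩
  show bitMat 8 8 (thetaCode (classIdx (weight _))) = 1
  rw [weight_eq (f := fun n => n / 6 == n % 6) h, show classIdx (setWeight fun n => n / 6 == n % 6) = 14 by decide +kernel]
  exact bitMat_one

/-- The double cosets are the classes of an equivalence relation, and the elements minimising the
injective function `f` within their class form a transversal that can be computed. -/
lemma ConjInvariant.orbitSum_tensor_coset_of_min {G : Type} [Group G] [Finite G]
    {C : Type*} [AddCommMonoid C] (θ : ConjInvariant (G × G) C) (U V : Subgroup (G × G))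
    (f : G → ℕ) (hf : Function.Injective f) (s : Finset G)
    (hs : ∀ h, h ∈ s ↔ ∀ g, (∃ u ∈ U, ∃ v ∈ V, u.2 * h = g * v.1) → f h ≤ f g) :
    θ.orbitSum (FinBiset.tensor (FinBiset.coset U) (FinBiset.coset V)) =
      ∑ h ∈ s, θ.toFun (mackeySubgroup U V h) := by
  have refl (h : G) : ∃ u ∈ U, ∃ v ∈ V, u.2 * h = h * v.1 :=
    ⟨1, U.one_mem, 1, V.one_mem, by rw [Prod.fst_one, Prod.snd_one, one_mul, mul_one]⟩
  have symm {h g : G} : (∃ u ∈ U, ∃ v ∈ V, u.2 * h = g * v.1) →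
      ∃ u ∈ U, ∃ v ∈ V, u.2 * g = h * v.1 := by
    rintro ⟨u, hu, v, hv, e⟩
    refine ⟨u⁻¹, U.inv_mem hu, v⁻¹, V.inv_mem hv, ?_⟩
    rw [Prod.snd_inv, Prod.fst_inv, inv_mul_eq_iff_eq_mul, ← mul_assoc, e, mul_inv_cancel_right]
  have trans {h g k : G} : (∃ u ∈ U, ∃ v ∈ V, u.2 * h = g * v.1) →
      (∃ u ∈ U, ∃ v ∈ V, u.2 * g = k * v.1) → ∃ u ∈ U, ∃ v ∈ V, u.2 * h = k * v.1 := by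
    rintro ⟨u, hu, v, hv, e⟩ ⟨u', hu', v', hv', e'⟩
    refine ⟨u' * u, U.mul_mem hu' hu, v' * v, V.mul_mem hv' hv, ?_⟩
    rw [Prod.snd_mul, Prod.fst_mul, mul_assoc, e, ← mul_assoc, e', mul_assoc]
  refine θ.orbitSum_tensor_coset U V s _ (fun h _ p => Iff.rfl) (fun g => ?_) ?_
  · obtain ⟨h, hh, hmin⟩ := Set.exists_min_image
      {h | ∃ u ∈ U, ∃ v ∈ V, u.2 * h = g * v.1} f (Set.toFinite _) ⟨g, refl g⟩
    exact ⟨h, (hs h).2 fun k hk => hmin k (trans (symm hk) hh), hh⟩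
  · intro h hh h' hh' e
    exact hf (le_antisymm ((hs h).1 hh h' e) ((hs h').1 hh' h (symm e)))

/-! ### The Mackey formula on codes -/

/-- The projections of the representatives to the first factor. -/
def fstMask (i : ℕ) : ℕ :=
  [1, 1, 3, 3, 1, 25, 25, 3, 1, 25, 3, 3, 63, 63, 63, 25, 3, 63, 25, 63, 63, 63].getD i 0

/-- The projections of the representatives to the second factor. -/
def sndMask (i : ℕ) : ℕ :=
  [1, 3, 1, 3, 25, 1, 25, 3, 63, 3, 25, 63, 1, 3, 63, 25, 63, 3, 63, 25, 63, 63].getD i 0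

lemma fstMask_spec : ∀ i < 22, ∀ x < 6, (fstMask i).testBit x =
    (List.range 6).any fun y => (mask i).testBit (6 * x + y) := by decide +kernel

lemma sndMask_spec : ∀ i < 22, ∀ x < 6, (sndMask i).testBit x =
    (List.range 6).any fun y => (mask i).testBit (6 * y + x) := by decide +kernel

lemma fstMask_iff {i : ℕ} (hi : i < 22) (g : S3) :
    (fstMask i).testBit (code g) = true ↔ ∃ p ∈ repSub i, p.1 = g := by
  rw [fstMask_spec i hi _ (code_lt g), List.any_eq_true]
  constructor
  · rintro ⟨y, hy, h⟩
    obtain ⟨k, rfl⟩ := code_surjective y (List.mem_range.1 hy)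
    exact ⟨(g, k), (mem_repSub hi _).2 h, rfl⟩
  · rintro ⟨p, hp, rfl⟩
    exact ⟨code p.2, List.mem_range.2 (code_lt _), (mem_repSub hi _).1 hp⟩

lemma sndMask_iff {i : ℕ} (hi : i < 22) (g : S3) :
    (sndMask i).testBit (code g) = true ↔ ∃ p ∈ repSub i, p.2 = g := by
  rw [sndMask_spec i hi _ (code_lt g), List.any_eq_true]
  constructor
  · rintro ⟨y, hy, h⟩
    obtain ⟨k, rfl⟩ := code_surjective y (List.mem_range.1 hy)
    exact ⟨(k, g), (mem_repSub hi _).2 h, rfl⟩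
  · rintro ⟨p, hp, rfl⟩
    exact ⟨code p.1, List.mem_range.2 (code_lt _), (mem_repSub hi _).1 hp⟩

/-- The elements `h` and `g` lie in the same double coset of the projections `S` and `T`. -/
def relTest (S T h g : ℕ) : Bool :=
  (List.range 6).any fun x => S.testBit x && T.testBit (mulCode (mulCode (invCode g) x) h)

lemma relTest_iff {i j : ℕ} (hi : i < 22) (hj : j < 22) (h g : S3) :
    relTest (sndMask i) (fstMask j) (code h) (code g) = true ↔
      ∃ u ∈ repSub i, ∃ v ∈ repSub j, u.2 * h = g * v.1 := by
  simp only [relTest, List.any_eq_true, Bool.and_eq_true, List.mem_range]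
  constructor
  · rintro ⟨x, hx, hS, hT⟩
    obtain ⟨x, rfl⟩ := code_surjective x hx
    rw [← code_inv, ← code_mul, ← code_mul, fstMask_iff hj] at hT
    obtain ⟨u, hu, rfl⟩ := (sndMask_iff hi x).1 hS
    obtain ⟨v, hv, e⟩ := hT
    exact ⟨u, hu, v, hv, by rw [e, mul_assoc, mul_inv_cancel_left]⟩
  · rintro ⟨u, hu, v, hv, e⟩
    refine ⟨code u.2, code_lt _, (sndMask_iff hi _).2 ⟨u, hu, rfl⟩, ?_⟩
    rw [← code_inv, ← code_mul, ← code_mul, fstMask_iff hj]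
    exact ⟨v, hv, by rw [mul_assoc, e, inv_mul_cancel_left]⟩

lemma mk_mem_repSub {i : ℕ} (hi : i < 22) (g k : S3) :
    (g, k) ∈ repSub i ↔ (mask i).testBit (6 * code g + code k) = true :=
  mem_repSub hi (g, k)

/-- Membership in the subgroup `U * ʰV` on codes. -/
def mackeyTest (S T h n : ℕ) : Bool :=
  (List.range 6).any fun x => S.testBit (6 * (n / 6) + x) &&
    T.testBit (6 * mulCode (mulCode (invCode h) x) h + n % 6)

lemma mackeyTest_iff {i j : ℕ} (hi : i < 22) (hj : j < 22) (h : S3) (p : S3 × S3) :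
    p ∈ mackeySubgroup (repSub i) (repSub j) h ↔
      mackeyTest (mask i) (mask j) (code h) (pairCode p) = true := by
  simp only [mackeyTest, List.any_eq_true, Bool.and_eq_true, List.mem_range, pairCode_div,
    pairCode_mod]
  constructor
  · rintro ⟨x, hx, hx'⟩
    refine ⟨code x, code_lt x, (mk_mem_repSub hi _ _).1 hx, ?_⟩
    rw [← code_inv, ← code_mul, ← code_mul, ← mk_mem_repSub hj]
    exact hx'
  · rintro ⟨x, hx, h1, h2⟩
    obtain ⟨x, rfl⟩ := code_surjective x hx
    rw [← code_inv, ← code_mul, ← code_mul, ← mk_mem_repSub hj] at h2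
    exact ⟨x, (mk_mem_repSub hi _ _).2 h1, h2⟩

/-- The matrix attached to the product of two transitive bisets. -/
def tensorCode (i j : ℕ) : ℕ :=
  xorTo (fun h => cond ((List.range h).any (relTest (sndMask i) (fstMask j) h)) 0
    (thetaCode (classIdx (setWeight (mackeyTest (mask i) (mask j) h))))) 6

lemma orbitSum_tensor_repSub {i j : ℕ} (hi : i < 22) (hj : j < 22) :
    theta.orbitSum (FinBiset.tensor (FinBiset.coset (repSub i)) (FinBiset.coset (repSub j))) =
      bitMat 8 8 (tensorCode i j) := by
  -- An element represents its double coset if no element of smaller code is related to it; the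
  -- others contribute `0` to the sum.
  rw [theta.orbitSum_tensor_coset_of_min _ _ code (fun g h => code_injective g h)
    (Finset.univ.filter fun h =>
      (List.range (code h)).any (relTest (sndMask i) (fstMask j) (code h)) = false) ?_]
  · rw [tensorCode, bitMat_xorTo, ← sum_code, Finset.sum_filter]
    refine Finset.sum_congr rfl fun h _ => ?_
    cases (List.range (code h)).any (relTest (sndMask i) (fstMask j) (code h))
    · rw [if_pos rfl, cond_false, ← weight_eq (mackeyTest_iff hi hj h)]
      rfl
    · rw [if_neg (by simp), cond_true, bitMat_zero]
  · intro h
    rw [Finset.mem_filter, List.any_eq_false]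
    simp only [Finset.mem_univ, true_and, List.mem_range]
    constructor
    · intro H g hg
      by_contra! hlt
      exact H _ hlt ((relTest_iff hi hj h g).2 hg)
    · intro H n hn hr
      obtain ⟨g, rfl⟩ := code_surjective n (hn.trans (code_lt h))
      exact absurd (H g ((relTest_iff hi hj h g).1 hr)) (not_le.2 hn)

/-- The whole multiplication table: all 484 products of two representatives are compared with the
products of their matrices. -/
lemma thetaCode_mulCheck : ((List.range 22).all fun i => (List.range 22).all fun j =>
    mulCheck 8 8 8 (thetaCode i) (thetaCode j) (tensorCode i j)) = true := by
  decide +kernel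

theorem orbitSum_tensor_coset_theta (U V : Subgroup (S3 × S3)) :
    theta.orbitSum (FinBiset.tensor (FinBiset.coset U) (FinBiset.coset V)) =
      theta.toFun U * theta.toFun V := by
  obtain ⟨i, c, rfl⟩ := exists_eq_map_conj U
  obtain ⟨j, d, rfl⟩ := exists_eq_map_conj V
  rw [theta.map_conj, theta.map_conj, theta_repSub i.2, theta_repSub j.2,
    bitMat_mul (List.all_eq_true.1 (List.all_eq_true.1 thetaCode_mulCheck i (List.mem_range.2 i.2))
      j (List.mem_range.2 j.2)), ← orbitSum_tensor_repSub i.2 j.2]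
  exact theta.orbitSum_eq_of_iso
    (FinBiset.tensorCongr (FinBiset.cosetConj c _) (FinBiset.cosetConj d _))

end BurnsideS3
end


/-! ### Morita equivalence of an algebra with a full corner -/

section MoritaCorner

open CategoryTheory
open scoped ModuleCat.Algebra

universe u₀ u₁ u₂ v

/-- A full corner embedding of algebras: a multiplicative linear injection `B → A` whose image
is `e A e` for the idempotent `e = φ 1`, where `A e A = A`. -/
structure FullCorner (k : Type u₀) [CommRing k] (A : Type u₁) [Ring A] [Algebra k A]
    (B : Type u₂) [Ring B] [Algebra k B] where
  φ : B →ₗ[k] A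
  map_mul : ∀ x y, φ (x * y) = φ x * φ y
  injective : Function.Injective φ
  exists_eq : ∀ a, ∃ b, φ b = φ 1 * a * φ 1
  n : ℕ
  left : Fin n → A
  right : Fin n → A
  sum_eq : ∑ i, left i * φ 1 * right i = 1

namespace FullCorner

variable {k : Type u₀} [CommRing k] {A : Type u₁} [Ring A] [Algebra k A]
  {B : Type u₂} [Ring B] [Algebra k B] (c : FullCorner k A B)

lemma one_mul_φ (b : B) : c.φ 1 * c.φ b = c.φ b := by rw [← c.map_mul, one_mul]

lemma φ_mul_one (b : B) : c.φ b * c.φ 1 = c.φ b := by rw [← c.map_mul, mul_one]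

lemma one_smul_φ_smul {M : Type v} [AddCommGroup M] [Module A M] (b : B) (m : M) :
    c.φ 1 • c.φ b • m = c.φ b • m := by rw [smul_smul, c.one_mul_φ]

/-- The subgroup `e M` of an `A`-module `M`. -/
def part (M : Type v) [AddCommGroup M] [Module A M] : AddSubgroup M where
  carrier := {m | c.φ 1 • m = m}
  add_mem' {x y} hx hy := by
    show c.φ 1 • (x + y) = x + y
    rw [smul_add, show c.φ 1 • x = x from hx, show c.φ 1 • y = y from hy]
  zero_mem' := smul_zero _
  neg_mem' {x} hx := by
    show c.φ 1 • (-x) = -x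
    rw [smul_neg, show c.φ 1 • x = x from hx]

variable {M : Type v} [AddCommGroup M] [Module A M]

lemma one_smul_part (m : c.part M) : c.φ 1 • (m : M) = m := m.2

instance : SMul B (c.part M) := ⟨fun b m => ⟨c.φ b • (m : M), c.one_smul_φ_smul b _⟩⟩

lemma coe_smul (b : B) (m : c.part M) : ((b • m : c.part M) : M) = c.φ b • (m : M) := rfl

instance : Module B (c.part M) where
  one_smul m := Subtype.ext m.2
  mul_smul x y m := Subtype.ext (by simp only [coe_smul, c.map_mul, mul_smul])
  smul_zero b := Subtype.ext (by simp only [coe_smul, AddSubgroup.coe_zero, smul_zero])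
  smul_add b x y := Subtype.ext (by simp only [coe_smul, AddSubgroup.coe_add, smul_add])
  add_smul x y m := Subtype.ext (by
    simp only [coe_smul, AddSubgroup.coe_add, map_add, add_smul])
  zero_smul m := Subtype.ext (by simp only [coe_smul, map_zero, zero_smul, AddSubgroup.coe_zero])

/-- The element `e a m` of `e M`. -/
def toPart (a : A) (m : M) : c.part M :=
  ⟨(c.φ 1 * a) • m, by
    show c.φ 1 • _ = _
    rw [smul_smul, ← mul_assoc, c.one_mul_φ]⟩

lemma coe_toPart (a : A) (m : M) : (c.toPart a m : M) = (c.φ 1 * a) • m := rfl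

/-- Fullness of the idempotent `e = φ 1` says that `e M` generates `M` over `A`, here with explicit
coefficients. -/
lemma sum_toPart (m : M) : ∑ i, c.left i • (c.toPart (c.right i) m : M) = m := by
  simp only [coe_toPart, smul_smul, ← mul_assoc, ← Finset.sum_smul, c.sum_eq, one_smul]

/-- An `A`-linear map restricts to the corner parts. -/
def partMap {N : Type*} [AddCommGroup N] [Module A N] (f : M →ₗ[A] N) :
    c.part M →ₗ[B] c.part N where
  toFun m := ⟨f m, by
    show c.φ 1 • f m = f m
    rw [← map_smul, c.one_smul_part]⟩
  map_add' x y := Subtype.ext (by simp)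
  map_smul' b x := Subtype.ext (by simp [coe_smul])

/-- A `B`-linear map of corner parts extends to an `A`-linear map. -/
def extend {N : Type*} [AddCommGroup N] [Module A N] (g : c.part M →ₗ[B] c.part N) :
    M →ₗ[A] N where
  toFun m := ∑ i, c.left i • (g (c.toPart (c.right i) m) : N)
  map_add' x y := by
    rw [← Finset.sum_add_distrib]
    refine Finset.sum_congr rfl fun i _ => ?_
    have : c.toPart (c.right i) (x + y) = c.toPart (c.right i) x + c.toPart (c.right i) y :=
      Subtype.ext (by simp [coe_toPart])
    rw [this, map_add, AddSubgroup.coe_add, smul_add]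
  map_smul' a x := by
    -- The elements `e rᵢ a lⱼ e` lie in the corner, so `g` commutes with the corresponding `d i j`.
    -- Inserting `1 = ∑ lⱼ e rⱼ` then moves `a` past the sum.
    choose d hd using fun i j => c.exists_eq (c.right i * a * c.left j)
    have key : ∀ i, c.toPart (c.right i) (a • x) = ∑ j, d i j • c.toPart (c.right j) x := by
      intro i
      refine Subtype.ext ?_
      rw [AddSubgroup.val_finsetSum]
      simp only [coe_smul, coe_toPart, smul_smul, ← Finset.sum_smul, hd]
      congr 1
      calc c.φ 1 * c.right i * a
          = c.φ 1 * c.right i * a * ∑ j, c.left j * c.φ 1 * c.right j := by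
            rw [c.sum_eq, mul_one]
        _ = _ := by
            rw [Finset.mul_sum]
            refine Finset.sum_congr rfl fun j _ => ?_
            have h1 : c.φ 1 * c.φ 1 = c.φ 1 := c.one_mul_φ 1
            simp only [mul_assoc]
            rw [← mul_assoc (c.φ 1) (c.φ 1) (c.right j), h1]
    simp only [key, map_sum, map_smul, AddSubgroup.val_finsetSum, coe_smul, RingHom.id_apply,
      Finset.smul_sum, hd, smul_smul]
    rw [Finset.sum_comm]
    refine Finset.sum_congr rfl fun j _ => ?_
    have h2 : c.φ 1 • (g (c.toPart (c.right j) x) : N) = g (c.toPart (c.right j) x) :=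
      c.one_smul_part _
    conv_rhs => rw [← h2, smul_smul]
    rw [← Finset.sum_smul]
    congr 1
    calc ∑ i, c.left i * (c.φ 1 * (c.right i * a * c.left j) * c.φ 1)
        = (∑ i, c.left i * c.φ 1 * c.right i) * (a * c.left j * c.φ 1) := by
          rw [Finset.sum_mul]
          exact Finset.sum_congr rfl fun i _ => by simp only [mul_assoc]
      _ = _ := by rw [c.sum_eq, one_mul]

/-- On `e M` the element `e rᵢ m` equals `(e rᵢ e) m`, so `g` can be pulled out and the sum
collapses by fullness. -/
lemma partMap_extend {N : Type*} [AddCommGroup N] [Module A N] (g : c.part M →ₗ[B] c.part N) :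
    c.partMap (c.extend g) = g := by
  ext m
  show ∑ i, c.left i • (g (c.toPart (c.right i) (m : M)) : N) = g m
  choose d hd using fun i => c.exists_eq (c.right i)
  have key : ∀ i, c.toPart (c.right i) (m : M) = d i • m := fun i => Subtype.ext (by
    rw [coe_toPart, coe_smul, hd, mul_smul _ (c.φ 1), c.one_smul_part])
  simp only [key, map_smul, coe_smul, hd, smul_smul, ← Finset.sum_smul]
  calc (∑ i, c.left i * (c.φ 1 * c.right i * c.φ 1)) • (g m : N)
      = ((∑ i, c.left i * c.φ 1 * c.right i) * c.φ 1) • (g m : N) := by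
        rw [Finset.sum_mul]
        simp only [mul_assoc]
    _ = g m := by rw [c.sum_eq, one_mul, c.one_smul_part]

lemma partMap_injective {N : Type*} [AddCommGroup N] [Module A N] {f g : M →ₗ[A] N}
    (h : c.partMap f = c.partMap g) : f = g := by
  ext m
  rw [← c.sum_toPart m, map_sum, map_sum]
  refine Finset.sum_congr rfl fun i _ => ?_
  rw [map_smul, map_smul]
  exact congrArg (fun x : N => c.left i • x)
    (congrArg Subtype.val (LinearMap.congr_fun h (c.toPart (c.right i) m)))

/-- The `A`-module of `B`-linear maps from `e A` to a `B`-module. -/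
def Coind (_c : FullCorner k A B) (N : Type v) [AddCommGroup N] [Module B N] :
    Type (max u₁ v) := _c.part A →ₗ[B] N

variable (N : Type v) [AddCommGroup N] [Module B N]

instance : AddCommGroup (c.Coind N) := inferInstanceAs (AddCommGroup (c.part A →ₗ[B] N))

/-- Right multiplication on `e A`. -/
def rightMul (a : A) : c.part A →ₗ[B] c.part A where
  toFun x := ⟨x * a, by
    show c.φ 1 * (x * a) = x * a
    rw [← mul_assoc]
    exact congrArg (· * a) x.2⟩
  map_add' x y := Subtype.ext (add_mul _ _ _)
  map_smul' b x := Subtype.ext (mul_assoc _ _ _)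

instance : SMul A (c.Coind N) := ⟨fun a f => (show c.part A →ₗ[B] N from f).comp (c.rightMul a)⟩

/-- The value of a map in `Coind`. -/
def Coind.eval {c : FullCorner k A B} {N : Type v} [AddCommGroup N] [Module B N]
    (f : c.Coind N) (x : c.part A) : N :=
  (show c.part A →ₗ[B] N from f) x

variable {N} in
lemma Coind.ext {f g : c.Coind N} (h : ∀ x, f.eval x = g.eval x) : f = g := LinearMap.ext h

lemma Coind.eval_smul (a : A) (f : c.Coind N) (x : c.part A) :
    (a • f).eval x = f.eval (c.rightMul a x) := rfl

lemma Coind.eval_map_add (f : c.Coind N) (x y : c.part A) :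
    f.eval (x + y) = f.eval x + f.eval y := LinearMap.map_add _ x y

lemma Coind.eval_map_smul (f : c.Coind N) (b : B) (x : c.part A) :
    f.eval (b • x) = b • f.eval x := LinearMap.map_smul _ b x

instance : Module A (c.Coind N) where
  one_smul f := Coind.ext c fun _ => congrArg f.eval (Subtype.ext (mul_one _))
  mul_smul a b f := Coind.ext c fun x =>
    congrArg f.eval (Subtype.ext (mul_assoc (x : A) a b).symm)
  smul_zero _ := rfl
  smul_add _ _ _ := rfl
  add_smul a b f := Coind.ext c fun x =>
    (congrArg f.eval (Subtype.ext (mul_add (x : A) a b))).trans (Coind.eval_map_add c N f _ _)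
  zero_smul f := Coind.ext c fun x =>
    (congrArg f.eval (Subtype.ext (mul_zero (x : A)))).trans
      (LinearMap.map_zero (show c.part A →ₗ[B] N from f))

/-- The element `e` of `e A`. -/
def unit : c.part A := ⟨c.φ 1, c.one_mul_φ 1⟩

lemma smul_unit (b : B) : b • c.unit = c.rightMul (c.φ b) c.unit :=
  Subtype.ext ((c.φ_mul_one b).trans (c.one_mul_φ b).symm)

/-- The corner part of `Coind N` is `N`. -/
def coindPart : c.part (c.Coind N) →ₗ[B] N where
  toFun f := (f : c.Coind N).eval c.unit
  map_add' f g := rfl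
  map_smul' b f := by
    rw [coe_smul, Coind.eval_smul, ← smul_unit, Coind.eval_map_smul, RingHom.id_apply]

/-- A map `f` fixed by `e` satisfies `f x = f (x e)`, and `x e ∈ e A e` is the image of some `ψ x`
in `B`. Thus `f x = ψ x • f e`: the value at `e` determines `f`, and any value in `N` defines such
an `f`. -/
lemma coindPart_bijective : Function.Bijective (c.coindPart N) := by
  choose ψ hψ using fun x : c.part A => c.exists_eq (x : A)
  have hψ' : ∀ x : c.part A, c.φ (ψ x) = x * c.φ 1 := fun x => by
    rw [hψ, show c.φ 1 * (x : A) = x from x.2]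
  constructor
  · intro f g h
    refine Subtype.ext (Coind.ext c fun x => ?_)
    have key : ∀ f : c.part (c.Coind N), (f : c.Coind N).eval x = ψ x • c.coindPart N f := by
      intro f
      have h1 : (f : c.Coind N).eval x = (f : c.Coind N).eval (c.rightMul (c.φ 1) x) := by
        rw [← Coind.eval_smul, c.one_smul_part]
      have h2 : c.rightMul (c.φ 1) x = ψ x • c.unit := Subtype.ext (by
        rw [coe_smul, hψ']
        show (x : A) * c.φ 1 = x * c.φ 1 * c.φ 1
        rw [mul_assoc, c.one_mul_φ])
      rw [h1, h2, Coind.eval_map_smul]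
      rfl
    rw [key f, key g, h]
  · intro n
    let f : c.Coind N := show c.part A →ₗ[B] N from
      { toFun := fun x => ψ x • n
        map_add' := fun x y => by
          rw [← add_smul]
          congr 1
          apply c.injective
          rw [map_add, hψ', hψ', hψ', AddSubgroup.coe_add, add_mul]
        map_smul' := fun b x => by
          rw [RingHom.id_apply, smul_smul]
          congr 1
          apply c.injective
          rw [c.map_mul, hψ', hψ', coe_smul, smul_eq_mul, mul_assoc] }
    have hf : ∀ x, f.eval x = ψ x • n := fun x => rfl
    refine ⟨⟨f, ?_⟩, ?_⟩
    · refine Coind.ext c fun x => ?_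
      rw [Coind.eval_smul, hf, hf]
      congr 1
      apply c.injective
      rw [hψ', hψ']
      show (x : A) * c.φ 1 * c.φ 1 = x * c.φ 1
      rw [mul_assoc, c.one_mul_φ]
    · show f.eval c.unit = n
      have : ψ c.unit = 1 := by
        apply c.injective
        rw [hψ']
        exact c.one_mul_φ 1
      rw [hf, this, one_smul]

/-- The functor `M ↦ e M`. -/
def functor : ModuleCat.{max u₁ u₂} A ⥤ ModuleCat.{max u₁ u₂} B where
  obj M := ModuleCat.of B (c.part M)
  map f := ModuleCat.ofHom (c.partMap f.hom)
  map_id _ := rfl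
  map_comp _ _ := rfl

instance : c.functor.Faithful where
  map_injective h :=
    ModuleCat.hom_ext (c.partMap_injective (ModuleCat.hom_ext_iff.1 h))

instance : c.functor.Full where
  map_surjective {M N} g :=
    ⟨ModuleCat.ofHom (c.extend (M := M) (N := N) g.hom),
      ModuleCat.hom_ext (c.partMap_extend (M := M) (N := N) g.hom)⟩

/-- The coinduced module is a preimage; it remains in the same category because the universe `max u₁
u₂` already contains that of `A`. -/
instance : c.functor.EssSurj where
  mem_essImage N := ⟨ModuleCat.of A (c.Coind N),
    ⟨(LinearEquiv.ofBijective (c.coindPart N) (c.coindPart_bijective N)).toModuleIso⟩⟩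

instance : c.functor.IsEquivalence where

lemma φ_smul_one (r : k) (b : B) : c.φ (r • b) = algebraMap k A r * c.φ b := by
  rw [map_smul, Algebra.smul_def]

theorem isMoritaEquivalent (c : FullCorner k A B) : IsMoritaEquivalent k A B where
  cond := ⟨{
    eqv := c.functor.asEquivalence
    linear :=
      { map_smul := fun {M _} f r => by
          refine ModuleCat.hom_ext (LinearMap.ext fun (m : c.part M) => Subtype.ext ?_)
          -- A scalar acts on `e M` through `φ (r • 1) = r e`, and `e` fixes `f m`.
          show algebraMap k A r • f.hom (m : M) = c.φ (algebraMap k B r) • f.hom (m : M)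
          rw [Algebra.algebraMap_eq_smul_one (A := B) r, c.φ_smul_one, mul_smul,
            ← map_smul f.hom (c.φ 1), c.one_smul_part] } }⟩

end FullCorner

end MoritaCorner

noncomputable section
namespace BurnsideS3

/-! ### The quiver algebra as a corner of the double Burnside algebra -/

/-- The double Burnside algebra of `S₃` over `𝔽₂`. -/
abbrev BurnsideAlg : Type 1 := DoubleBurnside (ZMod 2) S3

/-- The representation of the double Burnside algebra by matrices. -/
def burnsideRep : BurnsideAlg →ₐ[ZMod 2] Matrix (Fin 8) (Fin 8) (ZMod 2) :=
  theta.burnsideHom theta_diagonal orbitSum_tensor_coset_theta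

/-- The sum of the classes of the transitive bisets attached to the bits of `m`. -/
def classSum (m : ℕ) : BurnsideAlg :=
  ∑ i ∈ Finset.range 22, bit2 (m.testBit i) •
    burnsideClass (ZMod 2) (FinBiset.coset (repSub i))

/-- The matrix attached to the sum `classSum m`. -/
def sumCode (m : ℕ) : ℕ := xorTo (fun i => cond (m.testBit i) (thetaCode i) 0) 22

lemma burnsideRep_classSum (m : ℕ) : burnsideRep (classSum m) = bitMat 8 8 (sumCode m) := by
  rw [classSum, map_sum, sumCode, bitMat_xorTo]
  refine Finset.sum_congr rfl fun i hi => ?_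
  rw [map_smul, burnsideRep, burnsideHom_burnsideClass, theta.orbitSum_coset,
    theta_repSub (Finset.mem_range.1 hi), bitMat_cond]

lemma classSum_xorTo (f : ℕ → ℕ) (l : ℕ) :
    classSum (xorTo f l) = ∑ k ∈ Finset.range l, classSum (f k) := by
  simp only [classSum, bit2_testBit_xorTo, Finset.sum_smul]
  rw [Finset.sum_comm]

lemma classSum_cond (m : ℕ) (b : Bool) : classSum (cond b m 0) = bit2 b • classSum m := by
  cases b
  · rw [cond_false, bit2, cond_false, zero_smul, classSum]
    refine Finset.sum_eq_zero fun i _ => ?_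
    rw [Nat.zero_testBit, bit2, cond_false, zero_smul]
  · rw [cond_true, bit2, cond_true, one_smul]

lemma classSum_two_pow {i : ℕ} (hi : i < 22) :
    classSum (2 ^ i) = burnsideClass (ZMod 2) (FinBiset.coset (repSub i)) := by
  rw [classSum, Finset.sum_eq_single_of_mem i (Finset.mem_range.2 hi)]
  · rw [Nat.testBit_two_pow_self, bit2, cond_true, one_smul]
  · intro j _ hj
    rw [Nat.testBit_two_pow_of_ne (Ne.symm hj), bit2, cond_false, zero_smul]

lemma mem_span_classSum (x : BurnsideAlg) :
    x ∈ Submodule.span (ZMod 2) (Set.range fun i : Fin 22 => classSum (2 ^ (i : ℕ))) := by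
  simp only [classSum_two_pow (Fin.is_lt _)]
  exact mem_span_burnsideClass (ZMod 2) (fun i : Fin 22 => repSub i) exists_eq_map_conj x

/-! ### Faithfulness of the matrix representation -/

/-- Positions in a matrix that determine an element of the image of `burnsideRep`. -/
def pos (k : ℕ) : ℕ :=
  [18, 27, 36, 50, 20, 59, 28, 44, 52, 60, 0, 1, 2, 8, 9, 10, 16, 17, 4, 12, 48, 49].getD k 0

/-- The basis of the double Burnside algebra dual to the positions. -/
def dual (k : ℕ) : ℕ :=
  [4, 3344, 2317440, 33, 1028, 1871120, 3359, 1091656, 32817, 1883967, 2297988, 2688000, 4100,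
    259, 272, 1, 65668, 66560, 529412, 17, 262947, 295184].getD k 0

/-- The linear left inverse of `burnsideRep`. -/
def burnsideInv : Matrix (Fin 8) (Fin 8) (ZMod 2) →ₗ[ZMod 2] BurnsideAlg where
  toFun M := ∑ k ∈ Finset.range 22,
    M (Fin.ofNat 8 (pos k / 8)) (Fin.ofNat 8 (pos k % 8)) • classSum (dual k)
  map_add' M N := by simp only [Matrix.add_apply, add_smul, Finset.sum_add_distrib]
  map_smul' r M := by
    simp only [Matrix.smul_apply, smul_assoc, Finset.smul_sum, RingHom.id_apply]

lemma pos_lt : ∀ k < 22, pos k < 64 := by decide +kernel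

lemma burnsideInv_bitMat (a : ℕ) : burnsideInv (bitMat 8 8 a) =
    classSum (xorTo (fun k => cond (a.testBit (pos k)) (dual k) 0) 22) := by
  rw [classSum_xorTo]
  show ∑ k ∈ Finset.range 22, bitMat 8 8 a (Fin.ofNat 8 (pos k / 8)) (Fin.ofNat 8 (pos k % 8)) •
    classSum (dual k) = _
  refine Finset.sum_congr rfl fun k hk => ?_
  have := pos_lt k (Finset.mem_range.1 hk)
  rw [classSum_cond, bitMat_apply, Fin.val_ofNat, Fin.val_ofNat]
  congr 4
  omega

/-- Reading the matrix of the `i`-th class at the 22 positions and recombining the dual elements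
returns that class: the two `22 × 22` matrices over `𝔽₂` are inverse to each other. -/
lemma dual_spec : ∀ i < 22,
    xorTo (fun k => cond ((sumCode (2 ^ i)).testBit (pos k)) (dual k) 0) 22 = 2 ^ i := by
  decide +kernel

lemma burnsideInv_burnsideRep (x : BurnsideAlg) : burnsideInv (burnsideRep x) = x := by
  have h : burnsideInv ∘ₗ burnsideRep.toLinearMap = LinearMap.id :=
    LinearMap.ext_on_range (v := fun i : Fin 22 => classSum (2 ^ (i : ℕ)))
      (Submodule.eq_top_iff'.2 mem_span_classSum) fun i => by
        show burnsideInv (burnsideRep (classSum _)) = classSum _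
        rw [burnsideRep_classSum, burnsideInv_bitMat, dual_spec i i.2]
  exact LinearMap.congr_fun h x

lemma burnsideRep_injective : Function.Injective burnsideRep :=
  Function.LeftInverse.injective burnsideInv_burnsideRep

/-- The matrices of the elements dual to the positions. -/
def dualCode (k : ℕ) : ℕ := sumCode (dual k)

/-- The `6 × 6`-matrices of the first ten elements dual to the positions. -/
def cornerCode (k : ℕ) : ℕ := dualCode k >>> 18

/-- The stride is 8 for every size, so the code of the `8 × 8` identity also codes the smaller one.
-/
lemma bitMat_one_six : bitMat 6 6 (thetaCode 14) = 1 := by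
  ext i j
  rw [bitMat_apply, Matrix.one_apply]
  revert i j
  decide +kernel

lemma bitMat_mul_eq_zero {m l n a b : ℕ} (h : mulCheck m l n a b 0 = true) :
    bitMat m l a * bitMat l n b = 0 := by
  rw [bitMat_mul h, bitMat_zero]

/-- The representation of the quiver algebra by `6 × 6`-matrices. -/
def matrixRep : QuiverRep (Matrix (Fin 6) (Fin 6) (ZMod 2)) where
  -- These are the left multiplications on `Q e₅` in the basis `τ₂, τ₄, e₅, τ₇, τ₁τ₂, τ₃τ₄`. For
  -- example, `τ₇` sends `e₅` to `τ₇` and `τ₇` to `τ₁τ₂`.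
  e3 := bitMat 6 6 (cornerCode 0)
  e4 := bitMat 6 6 (cornerCode 1)
  e5 := bitMat 6 6 (cornerCode 2)
  t1 := bitMat 6 6 (cornerCode 3)
  t2 := bitMat 6 6 (cornerCode 4)
  t3 := bitMat 6 6 (cornerCode 5)
  t4 := bitMat 6 6 (cornerCode 6)
  t7 := bitMat 6 6 (cornerCode 7)
  one := by
    rw [← bitMat_xor, ← bitMat_xor, ← bitMat_one_six]
    exact bitMat_congr (by decide +kernel)
  e3e3 := bitMat_mul (by decide +kernel)
  e4e4 := bitMat_mul (by decide +kernel)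
  e5e5 := bitMat_mul (by decide +kernel)
  e3e4 := bitMat_mul_eq_zero (by decide +kernel)
  e4e3 := bitMat_mul_eq_zero (by decide +kernel)
  e3e5 := bitMat_mul_eq_zero (by decide +kernel)
  e5e3 := bitMat_mul_eq_zero (by decide +kernel)
  e4e5 := bitMat_mul_eq_zero (by decide +kernel)
  e5e4 := bitMat_mul_eq_zero (by decide +kernel)
  e5t1 := bitMat_mul (by decide +kernel)
  t1e3 := bitMat_mul (by decide +kernel)
  e3t2 := bitMat_mul (by decide +kernel)
  t2e5 := bitMat_mul (by decide +kernel)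
  e5t3 := bitMat_mul (by decide +kernel)
  t3e4 := bitMat_mul (by decide +kernel)
  e4t4 := bitMat_mul (by decide +kernel)
  t4e5 := bitMat_mul (by decide +kernel)
  e5t7 := bitMat_mul (by decide +kernel)
  t7e5 := bitMat_mul (by decide +kernel)
  t2t1 := bitMat_mul_eq_zero (by decide +kernel)
  t2t3 := bitMat_mul_eq_zero (by decide +kernel)
  t2t7 := bitMat_mul_eq_zero (by decide +kernel)
  t4t1 := bitMat_mul_eq_zero (by decide +kernel)
  t4t3 := bitMat_mul_eq_zero (by decide +kernel)
  t4t7 := bitMat_mul_eq_zero (by decide +kernel)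
  t7t1 := bitMat_mul_eq_zero (by decide +kernel)
  t7t3 := bitMat_mul_eq_zero (by decide +kernel)
  t7t7 := (bitMat_mul (c := cornerCode 8) (by decide +kernel)).trans
    (bitMat_mul (by decide +kernel)).symm

lemma matrixRep_basis (k : Fin 10) : matrixRep.basis k = bitMat 6 6 (cornerCode k) := by
  fin_cases k
  iterate 8 rfl
  · exact bitMat_mul (by decide +kernel)
  · exact bitMat_mul (by decide +kernel)

/-- The first ten positions avoid the first two rows and columns, so they survive in the `6 × 6`
block with both indices lowered by 2, and duality persists there. -/
lemma cornerCode_testBit : ∀ k l : Fin 10, bit2 ((cornerCode k).testBit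
    (8 * (Fin.ofNat 6 (pos l / 8 - 2)) + (Fin.ofNat 6 (pos l % 8 - 2)))) =
      if k = l then 1 else 0 := by
  decide +kernel

lemma matrixRep_linearIndependent : LinearIndependent (ZMod 2) matrixRep.basis := by
  rw [Fintype.linearIndependent_iff]
  intro c hc l
  have := congrFun (congrFun hc (Fin.ofNat 6 (pos l / 8 - 2))) (Fin.ofNat 6 (pos l % 8 - 2))
  simpa only [Matrix.sum_apply, Matrix.smul_apply, matrixRep_basis, bitMat_apply,
    cornerCode_testBit, smul_eq_mul, mul_ite, mul_one, mul_zero, Finset.sum_ite_eq',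
    Finset.mem_univ, if_true, Matrix.zero_apply] using this

/-! ### The full corner on the last six coordinates -/

/-- The inclusion of the last six coordinates. -/
def lastSix : Fin 6 → Fin 8 := Fin.natAdd 2

/-- The extension of a `6 × 6`-matrix by zero. -/
def extend : Matrix (Fin 6) (Fin 6) (ZMod 2) →ₗ[ZMod 2] Matrix (Fin 8) (Fin 8) (ZMod 2) where
  toFun M := (1 : Matrix (Fin 8) (Fin 8) (ZMod 2)).submatrix id lastSix * M *
    (1 : Matrix (Fin 8) (Fin 8) (ZMod 2)).submatrix lastSix id
  map_add' M N := by rw [Matrix.mul_add, Matrix.add_mul]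
  map_smul' r M := by rw [Matrix.mul_smul, Matrix.smul_mul, RingHom.id_apply]

lemma extend_apply (M : Matrix (Fin 6) (Fin 6) (ZMod 2)) :
    extend M = (1 : Matrix (Fin 8) (Fin 8) (ZMod 2)).submatrix id lastSix * M *
      (1 : Matrix (Fin 8) (Fin 8) (ZMod 2)).submatrix lastSix id := rfl

lemma submatrix_mul_extend :
    (1 : Matrix (Fin 8) (Fin 8) (ZMod 2)).submatrix lastSix id *
      (1 : Matrix (Fin 8) (Fin 8) (ZMod 2)).submatrix id lastSix = 1 := by
  rw [← Matrix.submatrix_mul _ _ _ _ _ Function.bijective_id, one_mul]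
  exact Matrix.submatrix_one _ (Fin.natAdd_injective 6 2)

/-- The inner factors `Pᵀ P` of the inclusion `P` cancel to `1`. The map is not unital: `1` goes to
the idempotent `P Pᵀ`. -/
lemma extend_mul (M N : Matrix (Fin 6) (Fin 6) (ZMod 2)) :
    extend (M * N) = extend M * extend N := by
  simp only [extend_apply, Matrix.mul_assoc]
  rw [← Matrix.mul_assoc (Matrix.submatrix _ lastSix id) (Matrix.submatrix _ id lastSix),
    submatrix_mul_extend, Matrix.one_mul]

lemma submatrix_extend (M : Matrix (Fin 6) (Fin 6) (ZMod 2)) :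
    (extend M).submatrix lastSix lastSix = M := by
  have h : (extend M).submatrix lastSix lastSix =
      (1 : Matrix (Fin 8) (Fin 8) (ZMod 2)).submatrix lastSix id * extend M *
        (1 : Matrix (Fin 8) (Fin 8) (ZMod 2)).submatrix id lastSix := by
    conv_lhs => rw [← Matrix.one_mul (extend M), ← Matrix.mul_one (1 * extend M)]
    rw [Matrix.submatrix_mul _ _ _ id _ Function.bijective_id,
      Matrix.submatrix_mul _ _ _ id _ Function.bijective_id, Matrix.submatrix_id_id]
  rw [h, extend_apply]
  simp only [Matrix.mul_assoc]
  rw [submatrix_mul_extend, Matrix.mul_one, ← Matrix.mul_assoc, submatrix_mul_extend,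
    Matrix.one_mul]

lemma extend_injective : Function.Injective extend :=
  Function.LeftInverse.injective
    (g := fun M : Matrix (Fin 8) (Fin 8) (ZMod 2) => M.submatrix lastSix lastSix) submatrix_extend

lemma extend_submatrix (M : Matrix (Fin 8) (Fin 8) (ZMod 2)) :
    extend (M.submatrix lastSix lastSix) = extend 1 * M * extend 1 := by
  have h : M.submatrix lastSix lastSix =
      (1 : Matrix (Fin 8) (Fin 8) (ZMod 2)).submatrix lastSix id * M *
        (1 : Matrix (Fin 8) (Fin 8) (ZMod 2)).submatrix id lastSix := by
    conv_lhs => rw [← Matrix.one_mul M, ← Matrix.mul_one (1 * M)]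
    rw [Matrix.submatrix_mul _ _ _ id _ Function.bijective_id,
      Matrix.submatrix_mul _ _ _ id _ Function.bijective_id, Matrix.submatrix_id_id]
  rw [h]
  simp only [extend_apply, Matrix.mul_assoc, Matrix.one_mul]

/-- Dropping two rows and two columns shifts the bits by `8 · 2 + 2 = 18`. -/
lemma bitMat_submatrix (a : ℕ) :
    (bitMat 8 8 a).submatrix lastSix lastSix = bitMat 6 6 (a >>> 18) := by
  ext i j
  rw [Matrix.submatrix_apply, bitMat_apply, bitMat_apply, Nat.testBit_shiftRight]
  simp only [lastSix, Fin.val_natAdd]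
  congr 2
  omega

/-- The matrix of the idempotent that cuts out the corner. -/
def idemCode : ℕ := sumCode (dual 0 ^^^ dual 1 ^^^ dual 2)

lemma extend_one : extend 1 = bitMat 8 8 idemCode := by
  ext i j
  rw [extend_apply, Matrix.mul_one, Matrix.mul_apply, bitMat_apply]
  simp only [Matrix.submatrix_apply, Matrix.one_apply, id_eq]
  revert i j
  decide +kernel

/-- The first ten dual elements lie in `e A e`, so nothing is lost by truncating their matrices to
the last six coordinates. -/
lemma extend_cornerCode {k : ℕ} (hk : k < 10) :
    extend (bitMat 6 6 (cornerCode k)) = bitMat 8 8 (dualCode k) := by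
  have h : ∀ k < 10, mulCheck 8 8 8 idemCode (dualCode k) (dualCode k) = true ∧
      mulCheck 8 8 8 (dualCode k) idemCode (dualCode k) = true := by decide +kernel
  rw [cornerCode, ← bitMat_submatrix, extend_submatrix, extend_one, bitMat_mul (h k hk).1,
    bitMat_mul (h k hk).2]

/-- The embedding of the quiver algebra as a corner of the double Burnside algebra. -/
def cornerMap : QuiverAlgebra →ₗ[ZMod 2] BurnsideAlg :=
  burnsideInv ∘ₗ extend ∘ₗ matrixRep.hom.toLinearMap

/-- `burnsideInv` inverts `burnsideRep` only on its image. On the basis the extended matrices are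
the images of the dual elements, so they lie there. -/
lemma burnsideRep_cornerMap (x : QuiverAlgebra) :
    burnsideRep (cornerMap x) = extend (matrixRep.hom x) := by
  obtain ⟨c, rfl⟩ := exists_quiverRep_basis x
  simp only [map_sum, map_smul]
  refine Finset.sum_congr rfl fun k _ => congrArg _ ?_
  show burnsideRep (burnsideInv (extend (matrixRep.hom _))) = _
  rw [QuiverRep.hom_basis, matrixRep_basis, extend_cornerCode k.2, dualCode,
    ← burnsideRep_classSum, burnsideInv_burnsideRep]

lemma cornerMap_mul (x y : QuiverAlgebra) : cornerMap (x * y) = cornerMap x * cornerMap y := by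
  refine burnsideRep_injective ?_
  rw [map_mul burnsideRep, burnsideRep_cornerMap, burnsideRep_cornerMap, burnsideRep_cornerMap,
    map_mul, extend_mul]

lemma cornerMap_injective : Function.Injective cornerMap := by
  intro x y h
  have := congrArg burnsideRep h
  rw [burnsideRep_cornerMap, burnsideRep_cornerMap] at this
  exact matrixRep.hom_injective matrixRep_linearIndependent (extend_injective this)

/-- Shows that the corner `e A e` is no larger than `Q`. -/
lemma exists_matrixRep_hom (a : BurnsideAlg) :
    ∃ x, matrixRep.hom x = (burnsideRep a).submatrix lastSix lastSix := by
  induction mem_span_classSum a using Submodule.span_induction with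
  | mem a ha =>
    obtain ⟨i, rfl⟩ := ha
    -- The truncated matrix of each class is a combination of the ten corner matrices; its
    -- coefficients are the entries at the first ten positions.
    have h : ∀ i < 22, ∀ r < 6, (xorTo (fun k => cond ((sumCode (2 ^ i)).testBit (pos k))
        (cornerCode k) 0) 10 >>> (8 * r)) % 2 ^ 6 =
          (sumCode (2 ^ i) >>> 18 >>> (8 * r)) % 2 ^ 6 := by
      decide +kernel
    refine ⟨∑ k : Fin 10, bit2 ((sumCode (2 ^ (i : ℕ))).testBit (pos k)) • quiverRep.basis k, ?_⟩
    rw [burnsideRep_classSum, bitMat_submatrix, ← bitMat_congr (h i i.2), bitMat_xorTo, map_sum,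
      Finset.sum_range]
    refine Finset.sum_congr rfl fun k _ => ?_
    rw [map_smul, QuiverRep.hom_basis, matrixRep_basis, bitMat_cond]
  | zero => exact ⟨0, by rw [map_zero, map_zero]; rfl⟩
  | add a b _ _ ha hb =>
    obtain ⟨x, hx⟩ := ha
    obtain ⟨y, hy⟩ := hb
    exact ⟨x + y, by rw [map_add, map_add, hx, hy]; rfl⟩
  | smul r a _ ha =>
    obtain ⟨x, hx⟩ := ha
    exact ⟨r • x, by rw [map_smul, map_smul, hx]; rfl⟩

lemma burnsideRep_cornerMap_one : burnsideRep (cornerMap 1) = bitMat 8 8 idemCode := by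
  rw [burnsideRep_cornerMap, map_one, extend_one]

/-- The quiver algebra is a full corner of the double Burnside algebra. -/
def fullCorner : FullCorner (ZMod 2) BurnsideAlg QuiverAlgebra where
  φ := cornerMap
  map_mul := cornerMap_mul
  injective := cornerMap_injective
  exists_eq a := by
    obtain ⟨x, hx⟩ := exists_matrixRep_hom a
    refine ⟨x, burnsideRep_injective ?_⟩
    rw [burnsideRep_cornerMap, hx, extend_submatrix, map_mul, map_mul, burnsideRep_cornerMap,
      map_one matrixRep.hom]
  n := 3
  -- With the elements of `right` these are `1` and the matrix units `E₀₂, E₁₂` against `1` and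
  -- `E₂₀, E₂₁`. Hence `1 = e + E₀₂ e E₂₀ + E₁₂ e E₂₁`, the last two terms being `E₀₀` and `E₁₁`.
  left := ![1, classSum (dual 12), classSum (dual 15)]
  right := ![1, classSum (dual 16), classSum (dual 17)]
  sum_eq := by
    refine burnsideRep_injective ?_
    simp only [Fin.sum_univ_three, map_add, map_mul, burnsideRep_cornerMap_one, map_one,
      burnsideRep_classSum, Matrix.cons_val, one_mul, mul_one]
    rw [bitMat_mul (a := sumCode (dual 12)) (c := dualCode 12) (by decide +kernel),
      bitMat_mul (a := sumCode (dual 15)) (c := dualCode 15) (by decide +kernel),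
      bitMat_mul (a := dualCode 12) (c := dualCode 10) (by decide +kernel),
      bitMat_mul (a := dualCode 15) (c := dualCode 14) (by decide +kernel),
      ← bitMat_xor, ← bitMat_xor, ← bitMat_one]
    exact bitMat_congr (by decide +kernel)

/-- The algebra `Λ' / 2 Λ'` as a full corner of the double Burnside algebra. -/
def fullCornerLambda : FullCorner (ZMod 2) BurnsideAlg (ModTwo Lambda2') where
  φ := cornerMap ∘ₗ lambdaEquiv.symm.toLinearMap
  map_mul x y := by
    show cornerMap (lambdaEquiv.symm (x * y)) = _
    rw [map_mul, cornerMap_mul]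
    rfl
  injective := cornerMap_injective.comp lambdaEquiv.symm.injective
  exists_eq a := by
    obtain ⟨x, hx⟩ := fullCorner.exists_eq a
    refine ⟨lambdaEquiv x, ?_⟩
    show cornerMap (lambdaEquiv.symm (lambdaEquiv x)) =
      cornerMap (lambdaEquiv.symm 1) * a * cornerMap (lambdaEquiv.symm 1)
    rw [AlgEquiv.symm_apply_apply, map_one]
    exact hx
  n := fullCorner.n
  left := fullCorner.left
  right := fullCorner.right
  sum_eq := by
    show ∑ i, fullCorner.left i * cornerMap (lambdaEquiv.symm 1) * fullCorner.right i = 1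
    rw [map_one]
    exact fullCorner.sum_eq

end BurnsideS3

theorem corollary5p7 :
    Nonempty (BurnsideS3.ModTwo BurnsideS3.Lambda2' ≃ₐ[ZMod 2] BurnsideS3.QuiverAlgebra) ∧
    IsMoritaEquivalent (ZMod 2)
      (BurnsideS3.DoubleBurnside (ZMod 2) (Equiv.Perm (Fin 3)))
      (BurnsideS3.ModTwo BurnsideS3.Lambda2') ∧
    IsMoritaEquivalent (ZMod 2)
      (BurnsideS3.DoubleBurnside (ZMod 2) (Equiv.Perm (Fin 3)))
      BurnsideS3.QuiverAlgebra := by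
  exact ⟨⟨BurnsideS3.lambdaEquiv.symm⟩, BurnsideS3.fullCornerLambda.isMoritaEquivalent,
    BurnsideS3.fullCorner.isMoritaEquivalent⟩
end
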